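/- **Setting.** Let $G$ be a simple, simply connected algebraic group over an algebraically closed field of characteristic zero, with Weyl group $W$, simple roots $\Delta$, weight lattice $\Lambda$ and dominant weights $\Lambda^+$ (equivalently: an irreducible reduced crystallographic root system with a base). For a weight $\nu$ let $W_\nu\subseteq W$ be its stabilizer, and give $W$ and $W/W_\nu$ the Bruhat order; $\min_B(\sigma)\in W$ is the smallest representative of $\sigma\in W/W_\nu$. Fix dominant weights $\underline\lambda=(\lambda_1,\dots,\lambda_m)$ with sum $\lambda$, put $W_Q=W_\lambda$, and fix $\tau\in W/W_Q$. Let $\mathcal I$ be a set of non-empty subsets of $[m]=\{1,\dots,m\}$, ordered by inclusion, all of whose maximal chains have $m$ elements. For $J\in\mathcal I$ put $\underline J=J$ if $J$ is minimal in $\mathcal I$, and otherwise let $\underline J$ be the union of the sets $J\setminus K$ over all $K\in\mathcal I$ covered by $J$. Assume that $\underline J\subseteq I$ implies $J\subseteq I$ for all $I,J\in\mathcal I$. Put $e_I=\sum_{i\in\underline I}e_i\in\mathbb N_0^m$, $\lambda_I=\sum_{i\in\underline I}\lambda_i$, $W_{P_I}=W_{\lambda_I}$, let $\pi_{P_I}:W/W_Q\to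 W/W_{P_I}$ be the projection, and let $\min_Q(\theta)$, $\max_Q(\theta)$ be the smallest and the largest preimage of $\theta$ in $W/W_Q$. **Defining chain poset.** Let $W(\underline\lambda,\tau)=\{\sigma\in W/W_Q\mid\sigma\le\tau\}\times\mathcal I$ with the product order. Let $\underline W(\underline\lambda,\tau)=\coprod_{I\in\mathcal I}\{\theta\in W/W_{P_I}\mid\theta\le\pi_{P_I}(\tau)\}\times\{I\}$, ordered by the transitive hull of the relation $(\theta,I)\ge(\phi,J):\Leftrightarrow I\supseteq J$ and $\max_Q(\theta)\ge\min_Q(\phi)$. A chain in $\underline W(\underline\lambda,\tau)$ is $\tau$-standard if it has a defining chain, i.e. a chain $(\overline\theta_\ell,I_\ell)>\dots>(\overline\theta_0,I_0)$ in $W(\underline\lambda,\tau)$ whose image under $(\theta,I)\mapsto(\pi_{P_I}(\theta),I)$ is the given chain, element by element. The defining chain poset $D(\underline\lambda,\tau)\subseteq W(\underline\lambda,\tau)$ is the set of all elements that lie in a defining chain of a maximal $\tau$-standard chain; $x\succeq y$ means that $x\ge y$ in $W(\underline\lambda,\tau)$ and that $x$ and $y$ lie in a common defining chain of a maximal $\tau$-standard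 chain. Assume that $\mathcal I$ is $\tau$-standard, i.e. that $\rho:D(\underline\lambda,\tau)\to\underline W(\underline\lambda,\tau)$, $(\theta,I)\mapsto(\pi_{P_I}(\theta),I)$, is an isomorphism of posets. **LS-fan.** The bond of a covering relation $(\theta,I)\succ(\phi,J)$ in $D(\underline\lambda,\tau)$ is $|\langle\phi(\lambda_I),\beta^\vee\rangle|$ if $I=J$, where $\beta$ is the positive root with $s_\beta\min_B(\phi)=\min_B(\theta)$, and $1$ if $I\ne J$. For a maximal chain $\mathfrak C=\{p_r\succ\dots\succ p_0\}$ in $D(\underline\lambda,\tau)$ with bonds $b_{p_i,p_{i-1}}$ let $\mathrm{LS}^+_{\mathfrak C,\underline\lambda}$ be the set of all $\sum_i a_ie_{p_i}$ with $a_i\in\mathbb Q_{\ge0}$, $a_0+\dots+a_r\in\mathbb Z$ and $b_{p_i,p_{i-1}}(a_i+\dots+a_r)\in\mathbb Z$ for $i=1,\dots,r$. Let $\mathrm{LS}^+_{\underline\lambda}\subseteq\mathbb Q^{D(\underline\lambda,\tau)}$ be the union of these sets over all $\mathfrak C$, let $\deg:\mathbb Q^{D(\underline\lambda,\tau)}\to\mathbb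 Q^m$ be the linear map with $e_{(\theta,I)}\mapsto e_I$, and let $\mathrm{LS}^+_{\underline\lambda}(\underline d)=\{\underline a\in\mathrm{LS}^+_{\underline\lambda}\mid\deg\underline a=\underline d\}$. **Tableaux.** An LS-path of shape $\nu\in\Lambda^+$ is $\pi=(\sigma_p>\dots>\sigma_1;0,a_p,\dots,a_1=1)$ with $\sigma_j\in W/W_\nu$ and rational numbers $0<a_p<\dots<a_1=1$ such that for $j=2,\dots,p$ there are covering relations $\sigma_j=\kappa_t>\dots>\kappa_0=\sigma_{j-1}$ in $W/W_\nu$ with $a_j\langle\kappa_k(\nu),\beta_k^\vee\rangle\in\mathbb Z$ for all $k\ge1$, where $\beta_k$ is the positive root with $s_{\beta_k}\min_B(\kappa_{k-1})=\min_B(\kappa_k)$. An LS-tableau of type $(\underline\lambda,\mathcal I)$ is a sequence $(\pi_1,\dots,\pi_s)$, possibly empty, of LS-paths of shapes $\lambda_{I_1},\dots,\lambda_{I_s}$ for a sequence $I_1\supseteq\dots\supseteq I_s$ in $\mathcal I$ (part of the data); its degree is $e_{I_1}+\dots+e_{I_s}$. With $\mu=\lambda_{I_1}+\dots+\lambda_{I_s}$,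 it is $\tau$-standard if the sequence of all cosets occurring in $\pi_1$, then $\pi_2$, …, then $\pi_s$ (each in decreasing order) can be lifted to a weakly decreasing sequence in $W/W_\mu$ all of whose members are $\le\tau W_\mu$. **Proposition.** For $\underline d\in\mathbb N_0^m$ let $\mathbb B(\underline\lambda,\mathcal I)_{\tau,\underline d}$ be the set of $\tau$-standard LS-tableaux of type $(\underline\lambda,\mathcal I)$ and degree $\underline d$. For an LS-path $\pi=(\sigma_p>\dots>\sigma_1;0,a_p,\dots,a_1=1)$ of shape $\lambda_I$ put $\Theta^{(I)}_1(\pi)=\sum_{j=1}^p(a_j-a_{j+1})\,e_{(\sigma_j,I)}$ with $a_{p+1}=0$. Identify $\mathbb Q^{D(\underline\lambda,\tau)}$ with $\mathbb Q^{\underline W(\underline\lambda,\tau)}$ by means of $\rho$. Then $$\Theta_{\underline d}:\ \mathbb B(\underline\lambda,\mathcal I)_{\tau,\underline d}\to\mathrm{LS}^+_{\underline\lambda}(\underline d),\qquad(\pi_1,\dots,\pi_s)\mapsto\Theta^{(I_1)}_1(\pi_1)+\dots+\Theta^{(I_s)}_1(\pi_s)$$ is a well-defined bijection. -/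

import Mathlib

noncomputable section

open scoped Classical

namespace LSFan

variable {ι M N : Type*} [AddCommGroup M] [Module ℚ M] [AddCommGroup N] [Module ℚ N]
  {P : RootPairing ι ℚ M N}

/-! ### Weights, the Weyl group and its parabolic quotients -/

/-- `x` is a dominant weight: it takes integral values on all coroots and non-negative values on
the simple coroots. -/
def IsDominantWeight (b : P.Base) (x : M) : Prop :=
  (∀ i : ι, ∃ n : ℤ, P.toLinearMap x (P.coroot i) = n) ∧
    ∀ i ∈ b.support, 0 ≤ P.toLinearMap x (P.coroot i)

/-- The length of a Weyl group element: the smallest length of a decomposition into simple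
reflections. -/
def length (b : P.Base) (w : P.weylGroup) : ℕ :=
  sInf {n | ∃ l : List ι, l.length = n ∧ (∀ i ∈ l, i ∈ b.support) ∧
    (l.map (RootPairing.weylGroup.ofIdx P)).prod = w}

/-- The Bruhat order on the Weyl group: the reflexive and transitive closure of the relations
`u < s_β u` for reflections `s_β` with `ℓ(u) < ℓ(s_β u)`. -/
def BruhatLE (b : P.Base) : P.weylGroup → P.weylGroup → Prop :=
  Relation.ReflTransGen fun u v =>
    length b u < length b v ∧ ∃ i : ι, v = RootPairing.weylGroup.ofIdx P i * u

/-- The set `W/W_ν` of cosets of the stabilizer of a weight `ν`, as a set with Bruhat order.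
(The base `b` only matters for the order.) -/
def Cosets (_b : P.Base) (ν : M) : Type _ :=
  P.weylGroup ⧸ MulAction.stabilizer P.weylGroup ν

/-- The coset `w W_ν`. -/
def Cosets.mk (b : P.Base) (ν : M) (w : P.weylGroup) : Cosets b ν :=
  (QuotientGroup.mk w : P.weylGroup ⧸ MulAction.stabilizer P.weylGroup ν)

/-- The Bruhat order on `W/W_ν`, the image of the Bruhat order on `W`. -/
instance (b : P.Base) (ν : M) : LE (Cosets b ν) where
  le σ τ := ∃ u v : P.weylGroup, Cosets.mk b ν u = σ ∧ Cosets.mk b ν v = τ ∧ BruhatLE b u v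

instance (b : P.Base) (ν : M) : LT (Cosets b ν) where
  lt σ τ := σ ≤ τ ∧ σ ≠ τ

/-- The projection `W/W_μ → W/W_ν`, `w W_μ ↦ w W_ν`, for `W_μ ⊆ W_ν`. (It is defined through an
arbitrary representative; see `proj_mk` for its characterization. It is only used for weights with
`W_μ ⊆ W_ν`, namely when `μ` is a sum of dominant weights and `ν` is a sum of some of them.) -/
def proj {b : P.Base} {μ : M} (ν : M) (σ : Cosets b μ) : Cosets b ν :=
  Cosets.mk b ν (Quotient.out (s := QuotientGroup.leftRel _) σ)

theorem proj_mk (b : P.Base) {μ ν : M}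
    (h : MulAction.stabilizer P.weylGroup μ ≤ MulAction.stabilizer P.weylGroup ν)
    (w : P.weylGroup) : proj ν (Cosets.mk b μ w) = Cosets.mk b ν w := by
  unfold proj Cosets.mk
  refine QuotientGroup.eq.2 (h ?_)
  exact QuotientGroup.eq.1
    (QuotientGroup.out_eq' (w : P.weylGroup ⧸ MulAction.stabilizer P.weylGroup μ))

/-- `w = min_B(σ)`: `w` is the smallest representative of the coset `σ` in `W`. -/
def IsMinRep {b : P.Base} {ν : M} (σ : Cosets b ν) (w : P.weylGroup) : Prop :=
  Cosets.mk b ν w = σ ∧ ∀ u, Cosets.mk b ν u = σ → BruhatLE b w u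

/-- `β` (given by its index `i`) is a positive root with `s_β min_B(φ) = min_B(θ)`, and
`u = min_B(φ)`, `v = min_B(θ)`. -/
def IsReflStep {b : P.Base} {ν : M} (θ φ : Cosets b ν) (i : ι) (u v : P.weylGroup) : Prop :=
  b.IsPos i ∧ IsMinRep φ u ∧ IsMinRep θ v ∧ RootPairing.weylGroup.ofIdx P i * u = v

/-! ### LS-paths and LS-tableaux -/

/-- One step `κ > κ'` of an `(a, ν)`-chain: a covering relation in `W/W_ν` such that
`a ⟨κ(ν), β^∨⟩` is an integer for the positive root `β` with `s_β min_B(κ') = min_B(κ)`. -/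
def IsChainStep {b : P.Base} {ν : M} (a : ℚ) (κ κ' : Cosets b ν) : Prop :=
  κ' ⋖ κ ∧ ∃ i u v, IsReflStep κ κ' i u v ∧
    ∃ n : ℤ, a * P.toLinearMap (v • ν) (P.coroot i) = n

/-- There is an `(a, ν)`-chain from `σ` to `τ`. -/
def HasChain {b : P.Base} {ν : M} (a : ℚ) (σ τ : Cosets b ν) : Prop :=
  Relation.ReflTransGen (IsChainStep a) σ τ

/-- An LS-path `(σ_p > ⋯ > σ_1; 0, d_p, …, d_1 = 1)` of shape `ν`, stored as the list
`[(σ_p, d_p), …, (σ_1, d_1)]`. -/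
@[ext]
structure LSPath (b : P.Base) (ν : M) where
  steps : List (Cosets b ν × ℚ)
  pos : ∀ x ∈ steps, 0 < x.2
  chain : steps.IsChain fun x y => y.1 < x.1 ∧ x.2 < y.2 ∧ HasChain x.2 x.1 y.1
  last : steps.getLast?.map Prod.snd = some 1

/-- The cosets `σ_p, …, σ_1` of an LS-path. -/
def LSPath.dirs {b : P.Base} {ν : M} (π : LSPath b ν) : List (Cosets b ν) :=
  π.steps.map Prod.fst

/-- `∑_j (a_j - a_{j+1}) e_{σ_j}` for a list `[(σ_p, a_p), …, (σ_1, a_1)]`,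
with `a_{p+1} = prev`. -/
def increments {C : Type*} (prev : ℚ) : List (C × ℚ) → (C →₀ ℚ)
  | [] => 0
  | (σ, a) :: l => Finsupp.single σ (a - prev) + increments a l

/-- An LS-tableau: a sequence of LS-paths (its columns), each together with its shape. -/
abbrev LSTableau (b : P.Base) : Type _ := List (Σ ν : M, LSPath b ν)

/-- The sum `μ = μ_1 + ⋯ + μ_s` of the shapes of the columns. -/
def LSTableau.weight {b : P.Base} (T : LSTableau b) : M := (T.map Sigma.fst).sum

/-- The sequence of all cosets in the columns of the tableau, read from left to right. -/
def LSTableau.entries {b : P.Base} (T : LSTableau b) : List (Σ ν : M, Cosets b ν) :=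
  T.flatMap fun c => c.2.dirs.map fun σ => ⟨c.1, σ⟩

/-- `L` is a defining chain (bounded by `τ`) of the tableau: a weakly decreasing sequence in
`W/W_μ` of lifts of the entries, bounded from above by `τ`. -/
def LSTableau.IsDefiningSeq {b : P.Base} (T : LSTableau b) (τ : Cosets b T.weight)
    (L : List (Cosets b T.weight)) : Prop :=
  L.IsChain (fun σ σ' => σ' ≤ σ) ∧ (∀ σ ∈ L, σ ≤ τ) ∧
    List.Forall₂ (fun σ x => proj x.1 σ = x.2) L T.entries

/-- The LS-tableau is `τ`-standard. -/
def LSTableau.IsStandard {b : P.Base} (T : LSTableau b) (τ : Cosets b T.weight) : Prop :=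
  ∃ L, T.IsDefiningSeq τ L

/-! ### The index poset -/

variable {m : ℕ}

/-- The set `J̲`: all of `J` if `J` is minimal in `𝓘`, and otherwise the union of the sets `J \ K`
over all covering relations `K ⊊ J` in `𝓘`. -/
def under {𝓘 : Finset (Finset (Fin m))} (J : 𝓘) : Finset (Fin m) :=
  J.1.filter fun i => IsMin J ∨ ∃ K : 𝓘, K ⋖ J ∧ i ∉ K.1

/-- The conditions on an index poset `𝓘`: it consists of non-empty subsets of the index set, it is
graded of length `m - 1` (every maximal chain has `m` elements), and `J̲ ⊆ I` implies `J ⊆ I`. -/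
structure IsIndexPoset (𝓘 : Finset (Finset (Fin m))) : Prop where
  nonempty : ∀ I ∈ 𝓘, I.Nonempty
  graded : ∀ C : Set 𝓘, IsMaxChain (· ≤ ·) C → C.ncard = m
  subset_of_under : ∀ J I : 𝓘, under J ⊆ I.1 → J ≤ I

/-- The degree `e_I = ∑_{i ∈ I̲} e_i`. -/
def degVec {𝓘 : Finset (Finset (Fin m))} (I : 𝓘) : Fin m → ℕ :=
  fun i => if i ∈ under I then 1 else 0

/-- The weight `λ_I = ∑_{i ∈ I̲} λ_i`. -/
def wt (lam : Fin m → M) {𝓘 : Finset (Finset (Fin m))} (I : 𝓘) : M := ∑ i ∈ under I, lam i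

/-! ### The posets `W(λ, τ)` and `W̲(λ, τ)` and defining chains

Throughout, `W_Q` is the stabilizer of `∑ i, lam i`. -/

/-- The ambient product `W/W_Q × 𝓘`, with the product order. -/
abbrev Upper (b : P.Base) (lam : Fin m → M) (𝓘 : Finset (Finset (Fin m))) : Type _ :=
  Cosets b (∑ i, lam i) × 𝓘

/-- The ambient disjoint union of the `W/W_{P_I}`, where `W_{P_I}` is the stabilizer of `λ_I`. -/
abbrev Lower (b : P.Base) (lam : Fin m → M) (𝓘 : Finset (Finset (Fin m))) : Type _ :=
  Σ I : 𝓘, Cosets b (wt lam I)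

variable {b : P.Base} {lam : Fin m → M} {𝓘 : Finset (Finset (Fin m))}

/-- `W(λ, τ)`. -/
def upperSet (𝓘 : Finset (Finset (Fin m))) (τ : Cosets b (∑ i, lam i)) : Set (Upper b lam 𝓘) :=
  {x | x.1 ≤ τ}

/-- The underlying set of `W̲(λ, τ)`. -/
def lowerSet (𝓘 : Finset (Finset (Fin m))) (τ : Cosets b (∑ i, lam i)) : Set (Lower b lam 𝓘) :=
  {x | x.2 ≤ proj (wt lam x.1) τ}

/-- The set of lifts to `W/W_Q` of an element `θ ∈ W/W_{P_I}`. -/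
def lifts (x : Lower b lam 𝓘) : Set (Cosets b (∑ i, lam i)) := {σ | proj (wt lam x.1) σ = x.2}

/-- The relation `I ⊇ J` and `max_Q(θ) ≥ min_Q(φ)` for `x = (θ, I)` and `y = (φ, J)` in
`W̲(λ, τ)`. -/
def lowerRel (τ : Cosets b (∑ i, lam i)) (x y : Lower b lam 𝓘) : Prop :=
  x ∈ lowerSet 𝓘 τ ∧ y ∈ lowerSet 𝓘 τ ∧ y.1 ≤ x.1 ∧
    ∃ θ φ, IsGreatest (lifts x) θ ∧ IsLeast (lifts y) φ ∧ φ ≤ θ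

/-- The partial order `x ≥ y` of `W̲(λ, τ)`: the transitive hull of `lowerRel`. -/
def lowerGE (τ : Cosets b (∑ i, lam i)) : Lower b lam 𝓘 → Lower b lam 𝓘 → Prop :=
  Relation.TransGen (lowerRel τ)

/-- The map `(θ, I) ↦ (π_{P_I}(θ), I)`. -/
def projI (x : Upper b lam 𝓘) : Lower b lam 𝓘 := ⟨x.2, proj (wt lam x.2) x.1⟩

/-- `C` is a defining chain of the chain `Θ`: a chain in `W(λ, τ)` that is mapped bijectively
onto `Θ`. -/
def IsDefiningChain (τ : Cosets b (∑ i, lam i)) (C : Set (Upper b lam 𝓘))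
    (Θ : Set (Lower b lam 𝓘)) : Prop :=
  C ⊆ upperSet 𝓘 τ ∧ IsChain (· ≤ ·) C ∧ Set.BijOn projI C Θ

/-- `Θ` is a `τ`-standard chain in `W̲(λ, τ)`. -/
def IsStandardChain (τ : Cosets b (∑ i, lam i)) (Θ : Set (Lower b lam 𝓘)) : Prop :=
  Θ ⊆ lowerSet 𝓘 τ ∧ IsChain (lowerGE τ) Θ ∧ ∃ C, IsDefiningChain τ C Θ

/-- `C` is a defining chain of some maximal `τ`-standard chain. -/
def IsMaxDefiningChain (τ : Cosets b (∑ i, lam i)) (C : Set (Upper b lam 𝓘)) : Prop :=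
  ∃ Θ, Maximal (IsStandardChain τ) Θ ∧ IsDefiningChain τ C Θ

/-! ### The defining chain poset and the LS-fan of monoids -/

/-- The underlying set of the defining chain poset `D(λ, τ)`. -/
def dcp (𝓘 : Finset (Finset (Fin m))) (τ : Cosets b (∑ i, lam i)) : Set (Upper b lam 𝓘) :=
  {x | ∃ C, IsMaxDefiningChain τ C ∧ x ∈ C}

/-- The order `x ⪰ y` of the defining chain poset. -/
def dcpGE {τ : Cosets b (∑ i, lam i)} (x y : dcp 𝓘 τ) : Prop :=
  y.1 ≤ x.1 ∧ ∃ C, IsMaxDefiningChain τ C ∧ x.1 ∈ C ∧ y.1 ∈ C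

/-- The map `ρ : D(λ, τ) → W̲(λ, τ)`, `(θ, I) ↦ (π_{P_I}(θ), I)`. -/
def rho {τ : Cosets b (∑ i, lam i)} (x : dcp 𝓘 τ) : Lower b lam 𝓘 := projI x.1

/-- The index poset is `τ`-standard: `ρ` is an isomorphism of posets from `D(λ, τ)` onto
`W̲(λ, τ)`. -/
def IsTauStandard (𝓘 : Finset (Finset (Fin m))) (τ : Cosets b (∑ i, lam i)) : Prop :=
  Set.BijOn (rho (𝓘 := 𝓘) (τ := τ)) Set.univ (lowerSet 𝓘 τ) ∧
    ∀ x y : dcp 𝓘 τ, dcpGE x y ↔ lowerGE τ (rho x) (rho y)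

/-- `n` is the bond of the covering relation `p ≻ q` with `p = (θ, I)` and `q = (φ, J)`: it is
`|⟨φ(λ_I), β^∨⟩|` if `I = J`, where `β` is the positive root with `s_β min_B(φ) = min_B(θ)`, and
`1` if `I ≠ J`. -/
def IsBond {τ : Cosets b (∑ i, lam i)} (p q : dcp 𝓘 τ) (n : ℚ) : Prop :=
  (p.1.2 = q.1.2 ∧ ∃ i u v, IsReflStep p.1.1 q.1.1 i u v ∧
      n = |P.toLinearMap (u • wt lam p.1.2) (P.coroot i)|) ∨
    (p.1.2 ≠ q.1.2 ∧ n = 1)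

/-- `p` and `q` are consecutive elements, `p` above `q`, of the chain `C`. -/
def IsConsecutive {τ : Cosets b (∑ i, lam i)} (C : Set (dcp 𝓘 τ)) (p q : dcp 𝓘 τ) : Prop :=
  p ∈ C ∧ q ∈ C ∧ dcpGE p q ∧ p ≠ q ∧ ∀ z ∈ C, dcpGE p z → dcpGE z q → z = p ∨ z = q

/-- The LS-monoid `LS_C^+` of a maximal chain `C = {p_r ≻ ⋯ ≻ p_0}`: all `a = ∑ a_i e_{p_i}` with
non-negative rational coefficients such that `a_0 + ⋯ + a_r` and all
`b_{p_i, p_{i-1}} (a_i + ⋯ + a_r)` are integers. -/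
def lsMonoid {τ : Cosets b (∑ i, lam i)} (C : Set (dcp 𝓘 τ)) : Set (dcp 𝓘 τ →₀ ℚ) :=
  {a | (a.support : Set (dcp 𝓘 τ)) ⊆ C ∧ (∀ p, 0 ≤ a p) ∧
    (∃ k : ℤ, a.sum (fun _ c => c) = k) ∧
    ∀ p q, IsConsecutive C p q → ∃ n, IsBond p q n ∧
      ∃ k : ℤ, n * ∑ z ∈ a.support with dcpGE z p, a z = k}

/-- The LS-fan of monoids `LS_λ^+`: the union of the LS-monoids of all maximal chains. -/
def lsFan (𝓘 : Finset (Finset (Fin m))) (τ : Cosets b (∑ i, lam i)) : Set (dcp 𝓘 τ →₀ ℚ) :=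
  {a | ∃ C : Set (dcp 𝓘 τ), IsMaxChain dcpGE C ∧ a ∈ lsMonoid C}

/-- The degree `∑ a_{(θ, I)} e_I` of an element of `ℚ^{D(λ, τ)}`. -/
def fanDegree {τ : Cosets b (∑ i, lam i)} (a : dcp 𝓘 τ →₀ ℚ) : Fin m → ℚ :=
  a.sum fun p c => c • fun i => (degVec p.1.2 i : ℚ)

/-- The degree-`d` part `LS_λ^+(d)` of the LS-fan. -/
def lsFanDeg (𝓘 : Finset (Finset (Fin m))) (τ : Cosets b (∑ i, lam i)) (d : Fin m → ℕ) :
    Set (dcp 𝓘 τ →₀ ℚ) :=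
  {a | a ∈ lsFan 𝓘 τ ∧ fanDegree a = fun i => (d i : ℚ)}

/-! ### Tableaux of type `(λ, 𝓘)` -/

/-- A sequence of pairs `(I_k, π_k)` with `I_k ∈ 𝓘` and `π_k` an LS-path of shape `λ_{I_k}`. -/
abbrev Columns (b : P.Base) (lam : Fin m → M) (𝓘 : Finset (Finset (Fin m))) : Type _ :=
  List (Σ I : 𝓘, LSPath b (wt lam I))

/-- The underlying LS-tableau, of shape `(λ_{I_1}, …, λ_{I_s})`. -/
def Columns.tableau (T : Columns b lam 𝓘) : LSTableau b := T.map fun c => ⟨wt lam c.1, c.2⟩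

/-- The degree `e_{I_1} + ⋯ + e_{I_s}`. -/
def Columns.degree (T : Columns b lam 𝓘) : Fin m → ℕ := (T.map fun c => degVec c.1).sum

/-- The set of `τ`-standard LS-tableaux of type `(λ, 𝓘)` and degree `d`: the sequence
`I_1 ⊇ ⋯ ⊇ I_s` is weakly decreasing, and the tableau is standard with respect to the projection
of `τ` to `W/W_μ`, where `μ = λ_{I_1} + ⋯ + λ_{I_s}`. -/
def stdTableaux (𝓘 : Finset (Finset (Fin m))) (τ : Cosets b (∑ i, lam i)) (d : Fin m → ℕ) :
    Set (Columns b lam 𝓘) :=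
  {T | T.IsChain (fun c c' => c'.1 ≤ c.1) ∧ T.tableau.IsStandard (proj _ τ) ∧ T.degree = d}

/-- `Θ_1^{(I)}(π) = ∑_j (a_j - a_{j+1}) e_{σ_j}` as an element of `ℚ^{W/W_{P_I}}`, embedded in the
vector space with basis the disjoint union of the `W/W_{P_I}`. -/
def thetaOne (I : 𝓘) (π : LSPath b (wt lam I)) : Lower b lam 𝓘 →₀ ℚ :=
  (increments 0 π.steps).mapDomain fun σ => ⟨I, σ⟩

/-- `Θ_1^{(I_1)}(π_1) + ⋯ + Θ_1^{(I_s)}(π_s)`. -/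
def theta (T : Columns b lam 𝓘) : Lower b lam 𝓘 →₀ ℚ := (T.map fun c => thetaOne c.1 c.2).sum

end LSFan

end

/-! A non-negative element of total weight `k` supported on a chain is a decreasing step function on
`[0, k]`: run down the support and stay at `p` for a time equal to its coefficient. The partial sum
over all points above `p` is then the time at which the function leaves the region above `p`, and
the LS-monoid requires this time, multiplied by the bond, to be an integer at every covering
relation of the chain. Bonds are integers, so integral times are always admissible and admissibility
survives integral shifts. Hence the function can be cut at the times `1, 2, …` into columns of
length one, and conversely columns can be glued. This works in any finite poset:
`columnsSum_mem_absFan` glues, `exists_columns_of_mem_absFan` cuts, and `columnsSum_injOn` says that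
the cut is unique.

What remains is to identify abstract columns in the defining chain poset with LS-paths and abstract
tableaux with `τ`-standard ones. A covering relation that changes the index has bond `1`, so it can
only be crossed at an integral time, and a column stays in one fibre of the index map
(`IsColumn.exists_idx`). On the fibre over `I`, `ρ` turns the order into the Bruhat order of
`W/W_{P_I}`, but the bond is defined upstairs, by minimal representatives of cosets of `W_Q`. The
two conditions agree by `DCP.adm_iff_isChainStep`: if `q` is covered by `p` in the fibre, then `q`
is the largest lift below `p` of its projection, since any larger lift could replace it in a
defining chain and `ρ` is injective (`DCP.coset_eq_of_covBy`). The largest lift arises from `p` by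
the same reflection as downstairs (`exists_largest_lift`, resting on `le_mul_of_covBy`).

For standardness, a weakly decreasing lift to `W/W_μ` makes the entries pairwise comparable in the
lower poset (`lowerRel_of_isStandard`), hence in the defining chain poset. Conversely the cosets of
a decreasing sequence there decrease in `W/W_Q` below `τ`, and their projections to `W/W_μ` form a
defining sequence (`IsColumns.exists_tableau`). -/

namespace LSFan

set_option linter.unusedSectionVars false

/-! ### Reflections, positive coroots and generation by simple reflections. -/

section WeylGroup

variable {ι M N : Type*} [AddCommGroup M] [Module ℚ M] [AddCommGroup N] [Module ℚ N]
  {P : RootPairing ι ℚ M N}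

local notation "𝔰" => RootPairing.weylGroup.ofIdx P

theorem ofIdx_smul_index (i j : ι) : (𝔰 i) • j = P.reflectionPerm i j := rfl

theorem ofIdx_smul_weight (i : ι) (x : M) :
    (𝔰 i) • x = x - P.toLinearMap x (P.coroot i) • P.root i := by
  simp [RootPairing.reflection_apply]

theorem ofIdx_mul_self (i : ι) : 𝔰 i * 𝔰 i = 1 := by
  refine Subtype.ext ?_
  have : (RootPairing.Equiv.reflection P i)⁻¹ = RootPairing.Equiv.reflection P i :=
    RootPairing.Equiv.reflection_inv P i
  change RootPairing.Equiv.reflection P i * RootPairing.Equiv.reflection P i = 1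
  rw [mul_eq_one_iff_inv_eq, this]

theorem ofIdx_inv (i : ι) : (𝔰 i)⁻¹ = 𝔰 i := inv_eq_of_mul_eq_one_left (ofIdx_mul_self i)

theorem root_smul (w : P.weylGroup) (i : ι) : P.root (w • i) = w • P.root i :=
  (P.weylGroup_apply_root w i).symm

theorem pairing_smul_smul (w : P.weylGroup) (x : M) (i : ι) :
    P.toLinearMap (w • x) (P.coroot (w • i)) = P.toLinearMap x (P.coroot i) := by
  obtain ⟨w, hw⟩ := w
  induction hw using RootPairing.weylGroup.induction generalizing x i with
  | mem j =>
    change P.coroot' (P.reflectionPerm j i) (P.reflection j x) = P.coroot' i x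
    rw [RootPairing.coroot'_reflection, RootPairing.reflectionPerm_self]
  | one => rfl
  | mul w₁ w₂ h₁ h₂ ih₁ ih₂ => exact (ih₁ _ _).trans (ih₂ _ _)

theorem pairing_smul (w : P.weylGroup) (x : M) (i : ι) :
    P.toLinearMap (w • x) (P.coroot i) = P.toLinearMap x (P.coroot (w⁻¹ • i)) := by
  rw [← pairing_smul_smul w x, smul_inv_smul]

theorem eq_of_forall_smul_eq {w w' : P.weylGroup} (h : ∀ x : M, w • x = w' • x) : w = w' := by
  refine Subtype.ext (RootPairing.Equiv.weightHom_injective P ?_)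
  exact LinearEquiv.ext h

theorem mul_ofIdx_mul_inv (w : P.weylGroup) (i : ι) : w * 𝔰 i * w⁻¹ = 𝔰 (w • i) := by
  refine eq_of_forall_smul_eq fun x => ?_
  rw [mul_smul, mul_smul, ofIdx_smul_weight, ofIdx_smul_weight, smul_sub, smul_inv_smul,
    pairing_smul, inv_inv, root_smul, smul_comm]

theorem mul_ofIdx (w : P.weylGroup) (i : ι) : w * 𝔰 i = 𝔰 (w • i) * w := by
  rw [← mul_ofIdx_mul_inv, inv_mul_cancel_right]

theorem ofIdx_mul (w : P.weylGroup) (i : ι) : 𝔰 i * w = w * 𝔰 (w⁻¹ • i) := by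
  rw [mul_ofIdx, smul_inv_smul]

theorem ofIdx_neg (i : ι) : 𝔰 (𝔰 i • i) = 𝔰 i := by
  rw [← mul_ofIdx_mul_inv, mul_inv_cancel_right]

theorem ofIdx_smul_eq_iff (i : ι) (x : M) :
    (𝔰 i) • x = x ↔ P.toLinearMap x (P.coroot i) = 0 := by
  rw [ofIdx_smul_weight, sub_eq_self, smul_eq_zero, or_iff_left (P.ne_zero i)]

/-- The roots span the weight space, so the action on the finite index set is faithful. -/
instance finite_weylGroup [Finite ι] [P.IsRootSystem] : Finite P.weylGroup := by
  refine Finite.of_injective (fun (w : P.weylGroup) (i : ι) => w • i) fun w w' h => ?_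
  refine eq_of_forall_smul_eq fun x => ?_
  have hx : x ∈ Submodule.span ℚ (Set.range P.root) := by
    rw [RootPairing.IsRootSystem.span_root_eq_top]; trivial
  induction hx using Submodule.span_induction with
  | mem x hx =>
    obtain ⟨i, rfl⟩ := hx
    rw [← root_smul, ← root_smul]
    exact congrArg P.root (congrFun h i)
  | zero => simp
  | add x y _ _ hx hy => rw [smul_add, smul_add, hx, hy]
  | smul c x _ hx => rw [smul_comm, smul_comm w', hx]

/-- The coroot with index `i` is positive. -/
def CorootPos (b : P.Base) (i : ι) : Prop := b.flip.IsPos i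

variable {b : P.Base}

theorem corootPos_neg_iff (i : ι) : CorootPos b (𝔰 i • i) ↔ ¬ CorootPos b i :=
  RootPairing.Base.IsPos.neg_iff_not b.flip i

theorem corootPos_of_mem_support {i : ι} (hi : i ∈ b.support) : CorootPos b i :=
  RootPairing.Base.isPos_of_mem_support (b := b.flip) hi

theorem CorootPos.pairing_nonneg {i : ι} (hi : CorootPos b i) {x : M}
    (hx : IsDominantWeight b x) : 0 ≤ P.toLinearMap x (P.coroot i) := by
  obtain ⟨f, -, hf, h⟩ := b.flip.exists_root_eq_sum_int i
  have hh := RootPairing.Base.height_eq_sum (b := b.flip) h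
  have hpos : 0 < b.flip.height i := hi
  change P.coroot i = ∑ j ∈ b.support, f j • P.coroot j at h
  rcases hf with hf | hf
  · rw [h, map_sum]
    refine Finset.sum_nonneg fun j hj => ?_
    rw [map_zsmul]
    exact zsmul_nonneg (hx.2 j hj) (hf.le j)
  · rw [hh] at hpos
    exact absurd hpos (not_lt.2 (Finset.sum_nonpos fun j _ => hf.le j))

theorem CorootPos.smul [Finite ι] [P.IsCrystallographic] [P.IsReduced] {i j : ι}
    (hi : CorootPos b i) (hj : j ∈ b.support) (hij : i ≠ j) : CorootPos b (𝔰 j • i) :=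
  RootPairing.Base.IsPos.reflectionPerm (P := P.flip) (b := b.flip) hi hj hij

/-- Every root is reached from simple ones by simple reflections and signs, and conjugating a
reflection by a simple one reflects its root. -/
theorem exists_word [Finite ι] [P.IsCrystallographic] [P.IsReduced] (b : P.Base)
    (w : P.weylGroup) :
    ∃ l : List ι, (∀ i ∈ l, i ∈ b.support) ∧ (l.map 𝔰).prod = w := by
  have key : ∀ i : ι, ∃ l : List ι, (∀ i ∈ l, i ∈ b.support) ∧ (l.map 𝔰).prod = 𝔰 i := by
    intro i
    refine b.induction_reflect i
      (p := fun i => ∃ l : List ι, (∀ i ∈ l, i ∈ b.support) ∧ (l.map 𝔰).prod = 𝔰 i) ?_ ?_ ?_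
    · rintro i ⟨l, hl, h⟩
      exact ⟨l, hl, h.trans (ofIdx_neg i).symm⟩
    · intro i hi
      exact ⟨[i], by simpa using hi, by simp⟩
    · rintro i j ⟨l, hl, h⟩ hj
      refine ⟨[j] ++ l ++ [j], ?_, ?_⟩
      · simp only [List.mem_append, List.mem_singleton]
        rintro k ((rfl | hk) | rfl)
        exacts [hj, hl k hk, hj]
      rw [← ofIdx_smul_index, ← mul_ofIdx_mul_inv, ofIdx_inv]
      simp [h, mul_assoc]
  obtain ⟨w, hw⟩ := w
  induction hw using RootPairing.weylGroup.induction with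
  | mem i => exact key i
  | one => exact ⟨[], by simp, rfl⟩
  | mul x y hx hy ihx ihy =>
    obtain ⟨l, hl, h⟩ := ihx
    obtain ⟨l', hl', h'⟩ := ihy
    refine ⟨l ++ l', ?_, ?_⟩
    · intro i hi
      rcases List.mem_append.1 hi with hi | hi
      exacts [hl i hi, hl' i hi]
    · rw [List.map_append, List.prod_append, h, h']; rfl

end WeylGroup

/-! ### Length, exchange condition and lifting property of the Bruhat order. -/

section Bruhat

variable {ι M N : Type*} [Finite ι] [AddCommGroup M] [Module ℚ M] [AddCommGroup N] [Module ℚ N]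
  {P : RootPairing ι ℚ M N} [P.IsCrystallographic] [P.IsReduced] {b : P.Base}

local notation "𝔰" => RootPairing.weylGroup.ofIdx P

theorem length_le_of_word {l : List ι} (hl : ∀ i ∈ l, i ∈ b.support) :
    length b (l.map 𝔰).prod ≤ l.length :=
  Nat.sInf_le ⟨l, rfl, hl, rfl⟩

theorem exists_reduced_word (b : P.Base) (w : P.weylGroup) :
    ∃ l : List ι, l.length = length b w ∧ (∀ i ∈ l, i ∈ b.support) ∧ (l.map 𝔰).prod = w := by
  obtain ⟨l, hl, h⟩ := exists_word b w
  exact Nat.sInf_mem (s := {n | ∃ l : List ι, l.length = n ∧ (∀ i ∈ l, i ∈ b.support) ∧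
    (l.map 𝔰).prod = w}) ⟨_, l, rfl, hl, h⟩

/-- Exchange condition. Letters are applied to the coroot `i` one by one. A simple reflection makes
no positive coroot negative except its own, so at some stage the current coroot is the next letter;
that letter is deleted. -/
theorem exists_delete_letter (l : List ι) (hl : ∀ i ∈ l, i ∈ b.support) {i : ι}
    (hi : CorootPos b i) (h : ¬ CorootPos b ((l.map 𝔰).prod⁻¹ • i)) :
    ∃ l' : List ι, l'.length + 1 = l.length ∧ (∀ i ∈ l', i ∈ b.support) ∧
      (l'.map 𝔰).prod = 𝔰 i * (l.map 𝔰).prod := by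
  induction l generalizing i with
  | nil => simp [hi] at h
  | cons j l ih =>
    have hj : j ∈ b.support := hl j (by simp)
    have hl' : ∀ i ∈ l, i ∈ b.support := fun i hi => hl i (by simp [hi])
    by_cases hij : i = j
    · subst hij
      exact ⟨l, rfl, hl', by rw [List.map_cons, List.prod_cons, ← mul_assoc, ofIdx_mul_self,
        one_mul]⟩
    · obtain ⟨l', h₁, h₂, h₃⟩ := ih hl' (hi.smul hj hij) (by
        rwa [List.map_cons, List.prod_cons, mul_inv_rev, mul_smul, ofIdx_inv] at h)
      refine ⟨j :: l', by simp [h₁], by simpa [hj] using h₂, ?_⟩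
      rw [List.map_cons, List.prod_cons, List.map_cons, List.prod_cons, h₃, ← mul_assoc,
        mul_ofIdx, ← mul_smul, ofIdx_mul_self, one_smul, mul_assoc]

theorem length_ofIdx_mul_lt {w : P.weylGroup} {i : ι} (hi : CorootPos b i)
    (h : ¬ CorootPos b (w⁻¹ • i)) : length b (𝔰 i * w) < length b w := by
  obtain ⟨l, h₁, h₂, rfl⟩ := exists_reduced_word b w
  obtain ⟨l', h₃, h₄, h₅⟩ := exists_delete_letter l h₂ hi h
  rw [← h₁, ← h₅]
  have := length_le_of_word h₄
  omega

theorem length_lt_ofIdx_mul {w : P.weylGroup} {i : ι} (hi : CorootPos b i)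
    (h : CorootPos b (w⁻¹ • i)) : length b w < length b (𝔰 i * w) := by
  have := length_ofIdx_mul_lt (w := 𝔰 i * w) hi (by
    rw [mul_inv_rev, mul_smul, ofIdx_inv]
    have h₂ : w⁻¹ • 𝔰 i • i = 𝔰 (w⁻¹ • i) • w⁻¹ • i := by
      rw [← mul_ofIdx_mul_inv, inv_inv, smul_smul, smul_smul, mul_inv_cancel_right]
    rw [h₂, corootPos_neg_iff, not_not]
    exact h)
  rwa [← mul_assoc, ofIdx_mul_self, one_mul] at this

theorem length_lt_ofIdx_mul_iff {w : P.weylGroup} {i : ι} (hi : CorootPos b i) :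
    length b w < length b (𝔰 i * w) ↔ CorootPos b (w⁻¹ • i) :=
  ⟨fun h => by_contra fun h' => (length_ofIdx_mul_lt hi h').not_gt h, length_lt_ofIdx_mul hi⟩

theorem length_lt_mul_ofIdx_iff {w : P.weylGroup} {i : ι} (hi : CorootPos b i) :
    length b w < length b (w * 𝔰 i) ↔ CorootPos b (w • i) := by
  rw [mul_ofIdx]
  by_cases h : CorootPos b (w • i)
  · rw [length_lt_ofIdx_mul_iff h, inv_smul_smul]
    exact ⟨fun _ => h, fun _ => hi⟩
  · rw [← ofIdx_neg, length_lt_ofIdx_mul_iff ((corootPos_neg_iff _).2 h)]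
    have h₂ : w⁻¹ • 𝔰 (w • i) • w • i = 𝔰 i • i := by
      rw [← mul_ofIdx_mul_inv, smul_smul, smul_smul]; congr 1; group
    rw [h₂, corootPos_neg_iff]
    exact ⟨fun h' => absurd hi h', fun h' => absurd h' h⟩

/-- Every reflection is the reflection of a positive coroot. -/
theorem exists_corootPos (b : P.Base) (i : ι) : ∃ j, CorootPos b j ∧ 𝔰 j = 𝔰 i := by
  by_cases h : CorootPos b i
  · exact ⟨i, h, rfl⟩
  · exact ⟨𝔰 i • i, (corootPos_neg_iff i).2 h, ofIdx_neg i⟩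

theorem exists_isPos (b : P.Base) (i : ι) : ∃ j, b.IsPos j ∧ 𝔰 j = 𝔰 i := by
  by_cases h : b.IsPos i
  · exact ⟨i, h, rfl⟩
  · exact ⟨𝔰 i • i, (RootPairing.Base.IsPos.neg_iff_not b i).2 h, ofIdx_neg i⟩

theorem length_ofIdx_mul_ne (b : P.Base) (w : P.weylGroup) (i : ι) :
    length b (𝔰 i * w) ≠ length b w := by
  obtain ⟨j, hj, h⟩ := exists_corootPos b i
  rw [← h]
  by_cases h' : CorootPos b (w⁻¹ • j)
  · exact (length_lt_ofIdx_mul hj h').ne'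
  · exact (length_ofIdx_mul_lt hj h').ne

theorem length_mul_ofIdx_ne (b : P.Base) (w : P.weylGroup) (i : ι) :
    length b (w * 𝔰 i) ≠ length b w := by
  rw [mul_ofIdx]; exact length_ofIdx_mul_ne b w _

theorem length_inv (b : P.Base) (w : P.weylGroup) : length b w⁻¹ = length b w := by
  have key : ∀ w : P.weylGroup, length b w⁻¹ ≤ length b w := by
    intro w
    obtain ⟨l, h₁, h₂, rfl⟩ := exists_reduced_word b w
    rw [← h₁, ← List.length_reverse]
    refine le_of_eq_of_le ?_ (length_le_of_word (b := b) (l := l.reverse) (by simpa using h₂))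
    congr 1
    rw [List.prod_inv_reverse, List.map_reverse, List.map_map]
    congr 2
    exact List.map_congr_left fun i _ => ofIdx_inv i
  exact le_antisymm (key w) (by simpa using key w⁻¹)

theorem length_one (b : P.Base) : length b (1 : P.weylGroup) = 0 :=
  Nat.le_zero.1 (length_le_of_word (b := b) (l := []) (by simp))

theorem length_mul_simple_le (w : P.weylGroup) {j : ι} (hj : j ∈ b.support) :
    length b (w * 𝔰 j) ≤ length b w + 1 := by
  obtain ⟨l, h₁, h₂, rfl⟩ := exists_reduced_word b w
  rw [← h₁]
  have := length_le_of_word (b := b) (l := l ++ [j]) (by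
    intro i hi
    rcases List.mem_append.1 hi with hi | hi
    · exact h₂ i hi
    · rw [List.mem_singleton.1 hi]; exact hj)
  simpa using this

theorem length_simple_mul_le (w : P.weylGroup) {j : ι} (hj : j ∈ b.support) :
    length b (𝔰 j * w) ≤ length b w + 1 := by
  rw [← length_inv b, ← length_inv b w, mul_inv_rev, ofIdx_inv]
  exact length_mul_simple_le _ hj

theorem le_length_simple_mul (w : P.weylGroup) {j : ι} (hj : j ∈ b.support) :
    length b w ≤ length b (𝔰 j * w) + 1 := by
  have := length_simple_mul_le (𝔰 j * w) hj
  rwa [← mul_assoc, ofIdx_mul_self, one_mul] at this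

theorem exists_right_descent {w : P.weylGroup} (hw : w ≠ 1) :
    ∃ j ∈ b.support, length b (w * 𝔰 j) < length b w := by
  obtain ⟨l, h₁, h₂, rfl⟩ := exists_reduced_word b w
  rcases List.eq_nil_or_concat l with rfl | ⟨l, j, rfl⟩
  · exact absurd rfl hw
  refine ⟨j, h₂ j (by simp), ?_⟩
  rw [← h₁]
  have : ((l.concat j).map 𝔰).prod * 𝔰 j = (l.map 𝔰).prod := by
    simp [mul_assoc, ofIdx_mul_self]
  rw [this]
  refine (length_le_of_word fun i hi => h₂ i (by simp [hi])).trans_lt (by simp)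

theorem exists_left_descent {w : P.weylGroup} (hw : w ≠ 1) :
    ∃ j ∈ b.support, length b (𝔰 j * w) < length b w := by
  obtain ⟨j, hj, h⟩ := exists_right_descent (b := b) (inv_ne_one.2 hw)
  refine ⟨j, hj, ?_⟩
  rwa [← length_inv b, ← length_inv b w, mul_inv_rev, ofIdx_inv]

theorem BruhatLE.rfl {u : P.weylGroup} : BruhatLE b u u := Relation.ReflTransGen.refl

theorem BruhatLE.trans {u v w : P.weylGroup} (h : BruhatLE b u v) (h' : BruhatLE b v w) :
    BruhatLE b u w := Relation.ReflTransGen.trans h h'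

theorem bruhatLE_ofIdx_mul {u : P.weylGroup} {i : ι} (h : length b u < length b (𝔰 i * u)) :
    BruhatLE b u (𝔰 i * u) := Relation.ReflTransGen.single ⟨h, i, rfl⟩

theorem ofIdx_mul_bruhatLE {u : P.weylGroup} {i : ι} (h : length b (𝔰 i * u) < length b u) :
    BruhatLE b (𝔰 i * u) u :=
  Relation.ReflTransGen.single ⟨h, i, by rw [← mul_assoc, ofIdx_mul_self, one_mul]⟩

theorem bruhatLE_mul_ofIdx {u : P.weylGroup} {i : ι} (h : length b u < length b (u * 𝔰 i)) :
    BruhatLE b u (u * 𝔰 i) := by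
  rw [mul_ofIdx] at h ⊢; exact bruhatLE_ofIdx_mul h

theorem mul_ofIdx_bruhatLE {u : P.weylGroup} {i : ι} (h : length b (u * 𝔰 i) < length b u) :
    BruhatLE b (u * 𝔰 i) u := by
  rw [mul_ofIdx] at h ⊢; exact ofIdx_mul_bruhatLE h

theorem BruhatLE.eq_or_length_lt {u v : P.weylGroup} (h : BruhatLE b u v) :
    u = v ∨ length b u < length b v := by
  induction h with
  | refl => exact Or.inl _root_.rfl
  | tail _ h ih =>
    rcases ih with rfl | ih
    exacts [Or.inr h.1, Or.inr (ih.trans h.1)]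

theorem BruhatLE.length_le {u v : P.weylGroup} (h : BruhatLE b u v) :
    length b u ≤ length b v := by
  rcases h.eq_or_length_lt with rfl | h
  exacts [le_rfl, h.le]

theorem BruhatLE.antisymm {u v : P.weylGroup} (h : BruhatLE b u v) (h' : BruhatLE b v u) :
    u = v :=
  h.eq_or_length_lt.resolve_right h'.length_le.not_gt

theorem BruhatLE.inv {u v : P.weylGroup} (h : BruhatLE b u v) : BruhatLE b u⁻¹ v⁻¹ := by
  induction h with
  | refl => exact BruhatLE.rfl
  | @tail v w _ h ih =>
    obtain ⟨h, i, rfl⟩ := h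
    refine ih.trans ?_
    rw [← length_inv, ← length_inv b (_ * _), mul_inv_rev, ofIdx_inv] at h
    rw [mul_inv_rev, ofIdx_inv]
    exact bruhatLE_mul_ofIdx h

/-- A Bruhat relation between elements of consecutive lengths is given by a reflection. -/
theorem BruhatLE.exists_ofIdx {u v : P.weylGroup} (h : BruhatLE b u v)
    (hl : length b v = length b u + 1) : ∃ i, v = 𝔰 i * u := by
  rcases Relation.ReflTransGen.cases_tail h with rfl | ⟨w, hw, h', i, hi⟩
  · omega
  · rcases BruhatLE.eq_or_length_lt hw with rfl | hlt
    · exact ⟨i, hi⟩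
    · omega

open scoped Classical in
/-- The shorter one of the elements `w` and `w s_j`. -/
noncomputable def lower (b : P.Base) (j : ι) (w : P.weylGroup) : P.weylGroup :=
  if length b (w * 𝔰 j) < length b w then w * 𝔰 j else w

open scoped Classical in
/-- The longer one of the elements `w` and `w s_j`. -/
noncomputable def upper (b : P.Base) (j : ι) (w : P.weylGroup) : P.weylGroup :=
  if length b (w * 𝔰 j) < length b w then w else w * 𝔰 j

theorem lower_of_lt {j : ι} {w : P.weylGroup} (h : length b (w * 𝔰 j) < length b w) :
    lower b j w = w * 𝔰 j := if_pos h

theorem lower_of_gt {j : ι} {w : P.weylGroup} (h : length b w < length b (w * 𝔰 j)) :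
    lower b j w = w := if_neg h.not_gt

theorem upper_of_lt {j : ι} {w : P.weylGroup} (h : length b (w * 𝔰 j) < length b w) :
    upper b j w = w := if_pos h

theorem upper_of_gt {j : ι} {w : P.weylGroup} (h : length b w < length b (w * 𝔰 j)) :
    upper b j w = w * 𝔰 j := if_neg h.not_gt

theorem lower_cases (j : ι) (w : P.weylGroup) : lower b j w = w ∨ lower b j w = w * 𝔰 j := by
  unfold lower; split_ifs <;> simp

theorem upper_cases (j : ι) (w : P.weylGroup) : upper b j w = w ∨ upper b j w = w * 𝔰 j := by
  unfold upper; split_ifs <;> simp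

theorem lower_le (j : ι) (w : P.weylGroup) : BruhatLE b (lower b j w) w := by
  unfold lower; split_ifs with h
  exacts [mul_ofIdx_bruhatLE h, BruhatLE.rfl]

theorem lower_le_mul (j : ι) (w : P.weylGroup) : BruhatLE b (lower b j w) (w * 𝔰 j) := by
  unfold lower; split_ifs with h
  · exact BruhatLE.rfl
  · exact bruhatLE_mul_ofIdx (lt_of_le_of_ne (not_lt.1 h) (length_mul_ofIdx_ne b w j).symm)

theorem le_upper (j : ι) (w : P.weylGroup) : BruhatLE b w (upper b j w) := by
  unfold upper; split_ifs with h
  · exact BruhatLE.rfl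
  · exact bruhatLE_mul_ofIdx (lt_of_le_of_ne (not_lt.1 h) (length_mul_ofIdx_ne b w j).symm)

theorem mul_le_upper (j : ι) (w : P.weylGroup) : BruhatLE b (w * 𝔰 j) (upper b j w) := by
  unfold upper; split_ifs with h
  exacts [mul_ofIdx_bruhatLE h, BruhatLE.rfl]

theorem lower_mul (j : ι) (w : P.weylGroup) : lower b j (w * 𝔰 j) = lower b j w := by
  have hw : w * 𝔰 j * 𝔰 j = w := by rw [mul_assoc, ofIdx_mul_self, mul_one]
  rcases lt_or_gt_of_ne (length_mul_ofIdx_ne b w j) with h | h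
  · rw [lower_of_lt h, lower_of_gt (by rwa [hw])]
  · rw [lower_of_gt h, lower_of_lt (by rwa [hw]), hw]

theorem upper_mul (j : ι) (w : P.weylGroup) : upper b j (w * 𝔰 j) = upper b j w := by
  have hw : w * 𝔰 j * 𝔰 j = w := by rw [mul_assoc, ofIdx_mul_self, mul_one]
  rcases lt_or_gt_of_ne (length_mul_ofIdx_ne b w j) with h | h
  · rw [upper_of_lt h, upper_of_gt (by rwa [hw]), hw]
  · rw [upper_of_gt h, upper_of_lt (by rwa [hw])]

/-- The simple reflection `𝔰 j` permutes the positive coroots other than `j`. So a Bruhat step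
survives right multiplication by `𝔰 j` unless it is itself that multiplication. -/
theorem eq_mul_or_length_mul_lt {u : P.weylGroup} {i j : ι} (hj : j ∈ b.support)
    (h : length b u < length b (𝔰 i * u)) :
    𝔰 i * u = u * 𝔰 j ∨ length b (u * 𝔰 j) < length b (𝔰 i * u * 𝔰 j) := by
  obtain ⟨i', hi, e⟩ := exists_corootPos b i
  rw [← e] at h ⊢
  rw [length_lt_ofIdx_mul_iff hi] at h
  by_cases hij : u⁻¹ • i' = j
  · left; rw [ofIdx_mul, hij]
  · right
    rw [mul_assoc]
    refine length_lt_ofIdx_mul hi ?_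
    rw [mul_inv_rev, mul_smul, ofIdx_inv]
    exact h.smul hj hij

/-- It suffices to treat one step. If the step is right multiplication by `𝔰 j`, both ends have the
same lower element; otherwise the step persists after multiplying both ends, so whichever element is
the lower one at the top dominates `v` or `v * 𝔰 j`. -/
theorem BruhatLE.lower {u v : P.weylGroup} (h : BruhatLE b u v) {j : ι} (hj : j ∈ b.support) :
    BruhatLE b (lower b j u) (lower b j v) := by
  induction h with
  | refl => exact BruhatLE.rfl
  | @tail v w _ h ih =>
    obtain ⟨h, i, rfl⟩ := h
    refine ih.trans ?_
    rcases eq_mul_or_length_mul_lt hj h with e | h'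
    · rw [e, lower_mul]; exact BruhatLE.rfl
    · rcases lower_cases (b := b) j (𝔰 i * v) with e | e <;> rw [e]
      · exact (lower_le j v).trans (bruhatLE_ofIdx_mul h)
      · rw [mul_assoc] at h' ⊢
        exact (lower_le_mul j v).trans (bruhatLE_ofIdx_mul h')

theorem BruhatLE.upper {u v : P.weylGroup} (h : BruhatLE b u v) {j : ι} (hj : j ∈ b.support) :
    BruhatLE b (upper b j u) (upper b j v) := by
  induction h with
  | refl => exact BruhatLE.rfl
  | @tail v w _ h ih =>
    obtain ⟨h, i, rfl⟩ := h
    refine ih.trans ?_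
    rcases eq_mul_or_length_mul_lt hj h with e | h'
    · rw [e, upper_mul]; exact BruhatLE.rfl
    · rcases upper_cases (b := b) j v with e | e <;> rw [e]
      · exact (bruhatLE_ofIdx_mul h).trans (le_upper j _)
      · rw [mul_assoc] at h'
        refine (bruhatLE_ofIdx_mul h').trans ?_
        rw [← mul_assoc]; exact mul_le_upper j _

/-- The lifting property, for left multiplication by a simple reflection. -/
theorem BruhatLE.simple_mul_le {u v : P.weylGroup} (h : BruhatLE b u v) {j : ι}
    (hj : j ∈ b.support) (hv : length b (𝔰 j * v) < length b v) :
    (length b (𝔰 j * u) < length b u → BruhatLE b (𝔰 j * u) (𝔰 j * v)) ∧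
      (length b u < length b (𝔰 j * u) → BruhatLE b u (𝔰 j * v)) ∧ BruhatLE b (𝔰 j * u) v := by
  -- Inversion preserves length and Bruhat order and exchanges left and right multiplication, so
  -- monotonicity of `lower` and `upper` applies.
  have e (w : P.weylGroup) : length b (𝔰 j * w) = length b (w⁻¹ * 𝔰 j) := by
    rw [← length_inv b (𝔰 j * w), mul_inv_rev, ofIdx_inv]
  rw [e, ← length_inv b v] at hv
  have h₁ := (h.inv.lower hj).inv
  have h₂ := (h.inv.upper hj).inv
  rw [lower_of_lt hv, mul_inv_rev, inv_inv, ofIdx_inv] at h₁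
  rw [upper_of_lt hv, inv_inv] at h₂
  refine ⟨fun hu => ?_, fun hu => ?_, ?_⟩
  · rw [e, ← length_inv b u] at hu
    rwa [lower_of_lt hu, mul_inv_rev, inv_inv, ofIdx_inv] at h₁
  · rw [e, ← length_inv b u] at hu
    rwa [lower_of_gt hu, inv_inv] at h₁
  · have := (mul_le_upper (b := b) j u⁻¹).inv.trans h₂
    rwa [mul_inv_rev, inv_inv, ofIdx_inv] at this

end Bruhat

/-! ### Parabolic quotients: minimal representatives and covering relations. -/

section Parabolic

variable {ι M N : Type*} [Finite ι] [AddCommGroup M] [Module ℚ M] [AddCommGroup N] [Module ℚ N]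
  {P : RootPairing ι ℚ M N} [P.IsCrystallographic] [P.IsReduced] {b : P.Base}

local notation "𝔰" => RootPairing.weylGroup.ofIdx P

theorem Cosets.mk_eq_mk_iff {ν : M} {u v : P.weylGroup} :
    Cosets.mk b ν u = Cosets.mk b ν v ↔ u • ν = v • ν := by
  refine (QuotientGroup.eq (s := MulAction.stabilizer P.weylGroup ν)).trans ?_
  rw [MulAction.mem_stabilizer_iff, mul_smul, inv_smul_eq_iff, eq_comm]

theorem Cosets.exists_rep {ν : M} (σ : Cosets b ν) : ∃ w, Cosets.mk b ν w = σ :=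
  QuotientGroup.mk_surjective σ

instance finite_cosets [P.IsRootSystem] (ν : M) : Finite (Cosets b ν) :=
  Finite.of_surjective (Cosets.mk b ν) Cosets.exists_rep

theorem Cosets.mk_le_mk {ν : M} {u v : P.weylGroup} (h : BruhatLE b u v) :
    Cosets.mk b ν u ≤ Cosets.mk b ν v := ⟨u, v, rfl, rfl, h⟩

theorem Cosets.le_refl {ν : M} (σ : Cosets b ν) : σ ≤ σ := by
  obtain ⟨w, rfl⟩ := σ.exists_rep
  exact Cosets.mk_le_mk BruhatLE.rfl

theorem isDominantWeight_zero : IsDominantWeight b (0 : M) :=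
  ⟨fun _ => ⟨0, by simp⟩, fun _ _ => by simp⟩

theorem IsDominantWeight.add {x y : M} (hx : IsDominantWeight b x) (hy : IsDominantWeight b y) :
    IsDominantWeight b (x + y) := by
  refine ⟨fun i => ?_, fun i hi => ?_⟩
  · obtain ⟨m, hm⟩ := hx.1 i
    obtain ⟨n, hn⟩ := hy.1 i
    exact ⟨m + n, by simp [hm, hn]⟩
  · simpa using add_nonneg (hx.2 i hi) (hy.2 i hi)

theorem isDominantWeight_sum {κ : Type*} (t : Finset κ) (f : κ → M)
    (h : ∀ k ∈ t, IsDominantWeight b (f k)) : IsDominantWeight b (∑ k ∈ t, f k) :=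
  Finset.sum_induction f _ (fun _ _ => IsDominantWeight.add) isDominantWeight_zero h

theorem IsDominantWeight.pairing_integral {x : M} (hx : IsDominantWeight b x) (w : P.weylGroup)
    (i : ι) : ∃ n : ℤ, P.toLinearMap (w • x) (P.coroot i) = n := by
  rw [pairing_smul]; exact hx.1 _

variable {ν : M} (hν : IsDominantWeight b ν)
include hν

/-- At a descent `w • j` is negative, so `ν = w • ν` pairs non-positively with it. By invariance
this is the pairing of `ν` with the simple coroot `j`, which dominance makes non-negative. -/
theorem simple_smul_eq_of_descent {w : P.weylGroup} (hw : w • ν = ν) {j : ι} (hj : j ∈ b.support)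
    (h : length b (w * 𝔰 j) < length b w) : 𝔰 j • ν = ν := by
  rw [ofIdx_smul_eq_iff]
  refine le_antisymm ?_ (hν.2 j hj)
  have h₁ : ¬ CorootPos b (w • j) := fun h' =>
    h.not_gt ((length_lt_mul_ofIdx_iff (corootPos_of_mem_support hj)).2 h')
  have h₂ := ((corootPos_neg_iff _).2 h₁).pairing_nonneg hν
  have h₃ : P.coroot (𝔰 (w • j) • w • j) = - P.coroot (w • j) := by
    rw [ofIdx_smul_index]; simp
  have h₄ := pairing_smul_smul w ν j
  rw [hw] at h₄
  rw [h₃, map_neg, h₄] at h₂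
  linarith

/-- By the preceding lemma every right descent of a stabilizer element lies in the stabilizer, which
is therefore generated, with lengths increasing, by the simple reflections fixing `ν`. -/
theorem stabilizer_induction {p : P.weylGroup → Prop} (one : p 1)
    (mul : ∀ w j, w • ν = ν → j ∈ b.support → 𝔰 j • ν = ν →
      length b w < length b (w * 𝔰 j) → p w → p (w * 𝔰 j))
    {w : P.weylGroup} (hw : w • ν = ν) : p w := by
  induction hn : length b w using Nat.strong_induction_on generalizing w with
  | _ n ih =>
    by_cases h1 : w = 1
    · rw [h1]; exact one
    obtain ⟨j, hj, hlt⟩ := exists_right_descent (b := b) h1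
    have hjν := simple_smul_eq_of_descent hν hw hj hlt
    have hw' : (w * 𝔰 j) • ν = ν := by rw [mul_smul, hjν, hw]
    have e : w * 𝔰 j * 𝔰 j = w := by rw [mul_assoc, ofIdx_mul_self, mul_one]
    have := mul (w * 𝔰 j) j hw' hj hjν (by rwa [e]) (ih _ (hn ▸ hlt) hw' rfl)
    rwa [e] at this

/-- For a simple reflection fixing the sum, two non-negative pairings add up to zero, so both
vanish. -/
theorem smul_eq_of_smul_add_eq {ν' : M} (hν' : IsDominantWeight b ν') {w : P.weylGroup}
    (hw : w • (ν + ν') = ν + ν') : w • ν = ν := by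
  refine stabilizer_induction (hν.add hν') (p := fun w => w • ν = ν) (one_smul _ _) ?_ hw
  intro w j _ hj hs _ hw
  rw [mul_smul]
  have : 𝔰 j • ν = ν := by
    rw [ofIdx_smul_eq_iff] at hs ⊢
    rw [map_add, LinearMap.add_apply] at hs
    linarith [hν.2 j hj, hν'.2 j hj]
  rw [this, hw]

/-- An element without right descents that fix `ν` is the minimum of its coset modulo `W_ν`. -/
theorem le_of_forall_ascent {v : P.weylGroup}
    (hv : ∀ j ∈ b.support, 𝔰 j • ν = ν → length b v < length b (v * 𝔰 j))
    {u : P.weylGroup} (hu : u • ν = v • ν) : BruhatLE b v u := by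
  have := stabilizer_induction hν (p := fun w => BruhatLE b v (v * w))
    (by rw [mul_one]; exact BruhatLE.rfl) (by
      intro w j _ hj hs _ ih
      have := ih.lower hj
      rw [lower_of_gt (hv j hj hs)] at this
      rw [← mul_assoc]
      exact this.trans (lower_le_mul j _)) (w := v⁻¹ * u)
    (by rw [mul_smul, hu, inv_smul_smul])
  rwa [mul_inv_cancel_left] at this

/-- An element without right ascents that fix `ν` is the maximum of its coset modulo `W_ν`. -/
theorem le_of_forall_descent {v : P.weylGroup}
    (hv : ∀ j ∈ b.support, 𝔰 j • ν = ν → length b (v * 𝔰 j) < length b v)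
    {u : P.weylGroup} (hu : u • ν = v • ν) : BruhatLE b u v := by
  have := stabilizer_induction hν (p := fun w => BruhatLE b (v * w) v)
    (by rw [mul_one]; exact BruhatLE.rfl) (by
      intro w j _ hj hs _ ih
      have := ih.upper hj
      rw [upper_of_lt (hv j hj hs)] at this
      rw [← mul_assoc]
      exact (mul_le_upper j _).trans this) (w := v⁻¹ * u)
    (by rw [mul_smul, hu, inv_smul_smul])
  rwa [mul_inv_cancel_left] at this

theorem isMinRep_of_forall_ascent {v : P.weylGroup}
    (hv : ∀ j ∈ b.support, 𝔰 j • ν = ν → length b v < length b (v * 𝔰 j)) :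
    IsMinRep (Cosets.mk b ν v) v :=
  ⟨rfl, fun _ hu => le_of_forall_ascent hν hv (Cosets.mk_eq_mk_iff.1 hu)⟩

omit hν in
theorem IsMinRep.length_lt {σ : Cosets b ν} {v : P.weylGroup} (hv : IsMinRep σ v) {i : ι}
    (hi : 𝔰 i • ν = ν) : length b v < length b (v * 𝔰 i) := by
  refine lt_of_le_of_ne (hv.2 _ ?_).length_le (length_mul_ofIdx_ne b v i).symm
  rw [← hv.1, Cosets.mk_eq_mk_iff, mul_smul, hi]

omit hν in
theorem IsMinRep.unique {σ : Cosets b ν} {u v : P.weylGroup} (hu : IsMinRep σ u)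
    (hv : IsMinRep σ v) : u = v :=
  (hu.2 v hv.1).antisymm (hv.2 u hu.1)

theorem exists_isMinRep (σ : Cosets b ν) : ∃ v, IsMinRep σ v := by
  obtain ⟨w, rfl⟩ := σ.exists_rep
  obtain ⟨_, ⟨v', hv', rfl⟩, hmin⟩ := exists_minimal_of_wellFoundedLT
    (fun n => ∃ v : P.weylGroup, v • ν = w • ν ∧ length b v = n) ⟨_, w, rfl, rfl⟩
  rw [← Cosets.mk_eq_mk_iff (b := b)] at hv'
  refine ⟨v', hv' ▸ isMinRep_of_forall_ascent hν fun j hj hs => ?_⟩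
  refine lt_of_not_ge fun hle => ?_
  have h := lt_of_le_of_ne hle (length_mul_ofIdx_ne b v' j)
  exact h.not_ge (hmin ⟨_, by rw [mul_smul, hs]; exact Cosets.mk_eq_mk_iff.1 hv', rfl⟩ h.le)

theorem exists_isMaxRep [P.IsRootSystem] (σ : Cosets b ν) :
    ∃ v, Cosets.mk b ν v = σ ∧ ∀ u, Cosets.mk b ν u = σ → BruhatLE b u v := by
  obtain ⟨w, rfl⟩ := σ.exists_rep
  obtain ⟨v, hv, hmax⟩ := Set.exists_max_image {v : P.weylGroup | v • ν = w • ν} (length b)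
    (Set.toFinite _) ⟨w, rfl⟩
  refine ⟨v, Cosets.mk_eq_mk_iff.2 hv, fun u hu => ?_⟩
  refine le_of_forall_descent hν (fun j hj hs => ?_) ((Cosets.mk_eq_mk_iff.1 hu).trans hv.symm)
  refine lt_of_le_of_ne (hmax _ ?_) (length_mul_ofIdx_ne b v j)
  change (v * 𝔰 j) • ν = _
  rw [mul_smul, hs]; exact hv

/-- Right descents of `v` that fix `ν` are removed one after the other by `lower`, which stays in
the cosets and preserves the relation, until `v` is minimal. -/
theorem IsMinRep.le_of_le {u₀ v₀ u v : P.weylGroup} (h : BruhatLE b u v)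
    (hu : IsMinRep (Cosets.mk b ν u) u₀) (hv : IsMinRep (Cosets.mk b ν v) v₀) :
    BruhatLE b u₀ v₀ := by
  induction hn : length b v using Nat.strong_induction_on generalizing u v with
  | _ n ih =>
    by_cases hd : ∃ j ∈ b.support, 𝔰 j • ν = ν ∧ length b (v * 𝔰 j) < length b v
    · obtain ⟨j, hj, hs, hlt⟩ := hd
      have h' := h.lower hj
      rw [lower_of_lt hlt] at h'
      have e (w : P.weylGroup) : Cosets.mk b ν (w * 𝔰 j) = Cosets.mk b ν w := by
        rw [Cosets.mk_eq_mk_iff, mul_smul, hs]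
      have e' : Cosets.mk b ν (LSFan.lower b j u) = Cosets.mk b ν u := by
        rcases lower_cases (b := b) j u with h | h <;> rw [h]
        exact e u
      exact ih _ (hn ▸ hlt) h' (e' ▸ hu) (by rwa [e]) rfl
    · push Not at hd
      have := isMinRep_of_forall_ascent hν (v := v) fun j hj hs =>
        lt_of_le_of_ne (hd j hj hs) (length_mul_ofIdx_ne b v j).symm
      rw [hv.unique this]
      exact (hu.2 u rfl).trans h

/-- The order on cosets asks only for some comparable representatives; testing it on minimal ones is
what gives transitivity and antisymmetry. -/
theorem Cosets.le_iff {σ τ : Cosets b ν} {u v : P.weylGroup} (hu : IsMinRep σ u)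
    (hv : IsMinRep τ v) : σ ≤ τ ↔ BruhatLE b u v := by
  constructor
  · rintro ⟨u', v', rfl, rfl, h⟩
    exact IsMinRep.le_of_le hν h hu hv
  · intro h
    exact ⟨u, v, hu.1, hv.1, h⟩

theorem Cosets.le_trans {σ τ κ : Cosets b ν} (h : σ ≤ τ) (h' : τ ≤ κ) : σ ≤ κ := by
  obtain ⟨u, hu⟩ := exists_isMinRep hν σ
  obtain ⟨v, hv⟩ := exists_isMinRep hν τ
  obtain ⟨w, hw⟩ := exists_isMinRep hν κ
  rw [Cosets.le_iff hν hu hv] at h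
  rw [Cosets.le_iff hν hv hw] at h'
  exact (Cosets.le_iff hν hu hw).2 (h.trans h')

theorem Cosets.le_antisymm {σ τ : Cosets b ν} (h : σ ≤ τ) (h' : τ ≤ σ) : σ = τ := by
  obtain ⟨u, hu⟩ := exists_isMinRep hν σ
  obtain ⟨v, hv⟩ := exists_isMinRep hν τ
  rw [Cosets.le_iff hν hu hv] at h
  rw [Cosets.le_iff hν hv hu] at h'
  rw [← hu.1, ← hv.1, h.antisymm h']

theorem Cosets.eq_or_eq_of_covBy {σ τ κ : Cosets b ν} (h : σ ⋖ τ) (h₁ : σ ≤ κ) (h₂ : κ ≤ τ) :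
    κ = σ ∨ κ = τ := by
  by_contra! hne
  exact h.2 (c := κ) ⟨h₁, hne.1.symm⟩ ⟨h₂, hne.2⟩

/-- The minimal representatives form a chain-complete subset: below `y` there is a minimal
representative of length one less that is still above `x`. -/
theorem exists_isMinRep_between {x y : P.weylGroup} (hx : IsMinRep (Cosets.mk b ν x) x)
    (hy : IsMinRep (Cosets.mk b ν y) y) (hxy : BruhatLE b x y) (hne : x ≠ y) :
    ∃ z, IsMinRep (Cosets.mk b ν z) z ∧ BruhatLE b x z ∧ BruhatLE b z y ∧
      length b y = length b z + 1 := by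
  induction hn : length b y using Nat.strong_induction_on generalizing x y with
  | _ n ih =>
    have hlt : length b x < length b y := hxy.eq_or_length_lt.resolve_left hne
    have hy1 : y ≠ 1 := by rintro rfl; rw [length_one] at hlt; omega
    -- Induction along a left descent of `y`. The candidate is `𝔰 j * y` as long as it lies above
    -- `x`; otherwise the answer for `𝔰 j * x` and `𝔰 j * y` is multiplied by `𝔰 j`.
    obtain ⟨j, hj, hd⟩ := exists_left_descent (b := b) hy1
    have hjy := le_length_simple_mul (b := b) y hj
    have descend : ∀ {z : P.weylGroup}, IsMinRep (Cosets.mk b ν z) z →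
        length b (𝔰 j * z) < length b z → IsMinRep (Cosets.mk b ν (𝔰 j * z)) (𝔰 j * z) := by
      intro z hz hzd
      refine isMinRep_of_forall_ascent hν fun k hk hs => ?_
      refine lt_of_le_of_ne (not_lt.1 fun hlt' => ?_) (length_mul_ofIdx_ne b _ k).symm
      have h₁ := hz.length_lt hs
      have h₂ := le_length_simple_mul (b := b) (z * 𝔰 k) hj
      rw [← mul_assoc] at h₂
      omega
    have hjymin := descend hy hd
    have hjyle : BruhatLE b (𝔰 j * y) y := ofIdx_mul_bruhatLE hd
    obtain ⟨h₁, h₂, -⟩ := hxy.simple_mul_le hj hd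
    have hsy : BruhatLE b x (𝔰 j * y) → ∃ z, IsMinRep (Cosets.mk b ν z) z ∧ BruhatLE b x z ∧
        BruhatLE b z y ∧ n = length b z + 1 :=
      fun h => ⟨𝔰 j * y, hjymin, h, hjyle, by omega⟩
    rcases lt_or_gt_of_ne (length_ofIdx_mul_ne b x j) with hxd | hxa
    swap
    · exact hsy (h₂ hxa)
    have e : 𝔰 j * (𝔰 j * x) = x := by rw [← mul_assoc, ofIdx_mul_self, one_mul]
    obtain ⟨z, hz, hz₁, hz₂, hz₃⟩ := ih _ (hn ▸ hd) (descend hx hxd) hjymin (h₁ hxd)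
      (fun h => hne (mul_left_cancel h)) rfl
    rcases lt_or_gt_of_ne (length_ofIdx_mul_ne b z j) with hzd | hza
    · have := (hz₁.simple_mul_le hj hzd).2.2
      rw [e] at this
      exact hsy (this.trans hz₂)
    have e' : 𝔰 j * (𝔰 j * z) = z := by rw [← mul_assoc, ofIdx_mul_self, one_mul]
    have hxz : BruhatLE b x (𝔰 j * z) := by
      have := ((hz₁.trans (bruhatLE_ofIdx_mul hza)).simple_mul_le hj (by rwa [e'])).2.2
      rwa [e] at this
    have hzy : BruhatLE b (𝔰 j * z) y := ((hz₂.trans hjyle).simple_mul_le hj hd).2.2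
    by_cases hmin : IsMinRep (Cosets.mk b ν (𝔰 j * z)) (𝔰 j * z)
    · have := length_simple_mul_le (b := b) z hj
      exact ⟨_, hmin, hxz, hzy, by omega⟩
    · have hk : ∃ k ∈ b.support, 𝔰 k • ν = ν ∧
          length b (𝔰 j * z * 𝔰 k) ≤ length b (𝔰 j * z) := by
        by_contra! hcon
        exact hmin (isMinRep_of_forall_ascent hν hcon)
      obtain ⟨k, hk, hs, hle⟩ := hk
      have hle := lt_of_le_of_ne hle (length_mul_ofIdx_ne b _ k)
      -- If `𝔰 j * z` is not minimal, it lies in the coset of `z`. Then the minimal element `x`,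
      -- being below it, is already below `z` and hence below `𝔰 j * y`.
      have hzz : 𝔰 j * z = z * 𝔰 k := by
        refine (eq_mul_or_length_mul_lt hk hza).resolve_right fun h => ?_
        have h₃ := hz.length_lt hs
        have h₄ := length_simple_mul_le (b := b) z hj
        omega
      rw [hzz] at hxz
      have : Cosets.mk b ν (z * 𝔰 k) = Cosets.mk b ν z := by
        rw [Cosets.mk_eq_mk_iff, mul_smul, hs]
      exact hsy ((IsMinRep.le_of_le hν hxz hx (this ▸ hz)).trans hz₂)

/-- A covering relation in `W/W_ν` is given by a reflection that increases the length of the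
minimal representatives by one. -/
theorem exists_ofIdx_of_covBy {σ τ : Cosets b ν} (h : σ ⋖ τ) {x y : P.weylGroup}
    (hx : IsMinRep σ x) (hy : IsMinRep τ y) :
    ∃ i, y = 𝔰 i * x ∧ length b y = length b x + 1 := by
  obtain ⟨z, hz, hxz, hzy, hl⟩ := exists_isMinRep_between hν (hx.1.symm ▸ hx) (hy.1.symm ▸ hy)
    ((Cosets.le_iff hν hx hy).1 h.1.1) (by
      rintro rfl; exact h.1.2 (hx.1.symm.trans hy.1))
  have hzx : z = x := by
    rcases Cosets.eq_or_eq_of_covBy hν h ((Cosets.le_iff hν hx hz).2 hxz)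
      ((Cosets.le_iff hν hz hy).2 hzy) with e | e
    · exact (e ▸ hz).unique hx
    · have := (e ▸ hz).unique hy
      rw [this] at hl; omega
  subst hzx
  obtain ⟨i, hi⟩ := hzy.exists_ofIdx hl
  exact ⟨i, hi, hl⟩

/-- When `w` grows to `w * 𝔰 j`, the coroot `w • j` is positive and its reflection fixes `ν`;
minimality of `x` keeps `x • w • j` positive, so `x * w` grows too. -/
theorem IsMinRep.length_mul {σ : Cosets b ν} {x w : P.weylGroup} (hx : IsMinRep σ x)
    (hw : w • ν = ν) : length b (x * w) = length b x + length b w := by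
  refine stabilizer_induction hν (p := fun w => length b (x * w) = length b x + length b w)
    (by rw [mul_one, length_one, add_zero]) ?_ hw
  intro w j hw hj hs hlt ih
  have hpos := (length_lt_mul_ofIdx_iff (corootPos_of_mem_support hj)).1 hlt
  have hfix : 𝔰 (w • j) • ν = ν := by
    rw [← mul_ofIdx_mul_inv, mul_smul, mul_smul, inv_smul_eq_iff.2 hw.symm, hs, hw]
  have h₁ := (length_lt_mul_ofIdx_iff hpos).1 (hx.length_lt hfix)
  rw [← mul_smul] at h₁
  have h₂ := (length_lt_mul_ofIdx_iff (corootPos_of_mem_support hj)).2 h₁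
  have h₃ := length_mul_simple_le (b := b) (x * w) hj
  have h₄ := length_mul_simple_le (b := b) w hj
  rw [← mul_assoc]
  omega

omit hν in
/-- Two reflections that move `x` to the same point different from `x` are equal. -/
theorem ofIdx_eq_of_smul_eq {x : M} {i j : ι} (h : 𝔰 i • x = 𝔰 j • x) (hne : 𝔰 i • x ≠ x) :
    𝔰 i = 𝔰 j := by
  by_cases hij : i = j
  · rw [hij]
  by_cases hneg : P.root i = -P.root j
  · rw [RootPairing.root_eq_neg_iff] at hneg
    rw [hneg, ← ofIdx_smul_index, ofIdx_neg]
  have hli := RootPairing.IsReduced.linearIndependent P hij hneg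
  rw [LinearIndependent.pair_iff] at hli
  rw [ofIdx_smul_weight, ofIdx_smul_weight] at h
  have := hli (P.toLinearMap x (P.coroot i)) (-P.toLinearMap x (P.coroot j)) (by
    rw [neg_smul, ← sub_eq_add_neg, sub_eq_zero]; exact sub_right_injective h)
  exact absurd ((ofIdx_smul_eq_iff i x).2 this.1) hne

/-- If `σ ⋖ τ` in `W/W_ν` with minimal representatives `x` and `y`, then every element of `x W_ν`
below `y w`, `w ∈ W_ν`, is below `x w`. -/
theorem le_mul_of_covBy {σ τ : Cosets b ν} (h : σ ⋖ τ) {x y : P.weylGroup} (hx : IsMinRep σ x)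
    (hy : IsMinRep τ y) {u w : P.weylGroup} (hw : w • ν = ν) (hu : Cosets.mk b ν u = σ)
    (hle : BruhatLE b u (y * w)) : BruhatLE b u (x * w) := by
  obtain ⟨i, hi, hl⟩ := exists_ofIdx_of_covBy hν h hx hy
  have hmk (w : P.weylGroup) (hw : w • ν = ν) : Cosets.mk b ν (y * w) = τ := by
    rw [← hy.1, Cosets.mk_eq_mk_iff, mul_smul, hw]
  induction hn : length b w using Nat.strong_induction_on generalizing w with
  | _ n ih =>
    -- Consider the element `z` just below `y * w` on a Bruhat chain from `u`. Its coset lies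
    -- between `σ` and `τ`, so it is one of them.
    rcases Relation.ReflTransGen.cases_tail hle with e | ⟨z, hz, hlt, k, hk⟩
    · have := hmk w hw
      rw [e, hu] at this
      exact absurd this h.1.2
    have hz' : z = 𝔰 k * (y * w) := by rw [hk, ← mul_assoc, ofIdx_mul_self, one_mul]
    have h₁ : σ ≤ Cosets.mk b ν z := hu ▸ Cosets.mk_le_mk hz
    have h₂ : Cosets.mk b ν z ≤ τ := by
      rw [← hmk w hw]; exact Cosets.mk_le_mk (Relation.ReflTransGen.single ⟨hlt, k, hk⟩)
    rcases Cosets.eq_or_eq_of_covBy hν h h₁ h₂ with e | e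
    -- If it is `σ`, the last reflection moves `x • ν` to `y • ν`, as does the covering reflection.
    -- The two coincide and `z = x * w`.
    · have e₁ : z • ν = x • ν := by rwa [← hx.1, Cosets.mk_eq_mk_iff] at e
      have e₂ : y • ν = 𝔰 k • x • ν := by
        rw [← e₁, ← mul_smul, ← hk, mul_smul, hw]
      have e₃ : 𝔰 i = 𝔰 k := by
        refine ofIdx_eq_of_smul_eq (x := x • ν) ?_ ?_
        · rw [← e₂, hi, mul_smul]
        · rw [← mul_smul, ← hi]
          intro h'
          rw [← Cosets.mk_eq_mk_iff (b := b), hx.1, hy.1] at h'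
          exact h.1.2 h'.symm
      have : z = x * w := by
        rw [hz', ← e₃, hi, ← mul_assoc, ← mul_assoc, ofIdx_mul_self, one_mul]
      exact this ▸ hz
    -- If it is `τ`, then `z = y * w'` with `w'` in the stabilizer and shorter than `w`; induction
    -- gives `u ≤ x * w'`, and `x * w' ≤ x * w` because lengths add.
    · set w' := y⁻¹ * z with hw'
      have ez : z = y * w' := by rw [hw', mul_inv_cancel_left]
      have hw'ν : w' • ν = ν := by
        rw [← hy.1, Cosets.mk_eq_mk_iff] at e
        rw [hw', mul_smul, e, inv_smul_smul]
      have hww : w' = 𝔰 (y⁻¹ • k) * w := by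
        rw [hw', hz', ← mul_assoc (𝔰 k), ofIdx_mul, mul_assoc, inv_mul_cancel_left]
      rw [ez, hy.length_mul hν hw'ν, hy.length_mul hν hw] at hlt
      have hlt' : length b w' < length b w := by omega
      refine (ih _ (hn ▸ hlt') hw'ν (ez ▸ hz) rfl).trans ?_
      have e₄ : x * w' = 𝔰 (x • y⁻¹ • k) * (x * w) := by
        rw [hww, ← mul_assoc, mul_ofIdx, mul_assoc]
      rw [e₄]
      refine ofIdx_mul_bruhatLE ?_
      rw [← e₄, hx.length_mul hν hw'ν, hx.length_mul hν hw]
      omega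

end Parabolic

/-! ### Partial sums and increments of timed sequences. -/

section Mass

variable {X : Type*}

open scoped Classical in
/-- The total weight that `a` gives to the set `t`. -/
noncomputable def massOn (t : Set X) : (X →₀ ℚ) →+ ℚ :=
  Finsupp.liftAddHom fun z => if z ∈ t then AddMonoidHom.id ℚ else 0

open scoped Classical in
theorem massOn_single (t : Set X) (x : X) (c : ℚ) :
    massOn t (Finsupp.single x c) = if x ∈ t then c else 0 := by
  unfold massOn
  rw [Finsupp.liftAddHom_apply_single]
  split_ifs <;> rfl

open scoped Classical in
theorem massOn_eq_sum (t : Set X) (a : X →₀ ℚ) :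
    massOn t a = ∑ z ∈ a.support with z ∈ t, a z := by
  rw [Finset.sum_filter]
  refine (Finsupp.liftAddHom_apply _ _).trans (Finset.sum_congr rfl fun z _ => ?_)
  beta_reduce
  split_ifs <;> rfl

theorem massOn_univ (a : X →₀ ℚ) : massOn Set.univ a = a.sum fun _ c => c := by
  rw [massOn_eq_sum]; simp [Finsupp.sum]

theorem massOn_eq_zero {t : Set X} {a : X →₀ ℚ} (h : ∀ z ∈ a.support, z ∉ t) :
    massOn t a = 0 := by
  classical
  rw [massOn_eq_sum]
  refine Finset.sum_eq_zero fun z hz => ?_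
  rw [Finset.mem_filter] at hz
  exact absurd hz.2 (h z hz.1)

theorem eq_zero_of_massOn_univ {a : X →₀ ℚ} (ha : ∀ z, 0 ≤ a z)
    (h : massOn Set.univ a = 0) : a = 0 := by
  rw [massOn_univ, Finsupp.sum, Finset.sum_eq_zero_iff_of_nonneg fun z _ => ha z] at h
  ext z
  by_contra hz
  exact hz (h z (Finsupp.mem_support_iff.2 hz))

theorem increments_nil (c : ℚ) : increments c ([] : List (X × ℚ)) = 0 := rfl

theorem increments_cons (c : ℚ) (x : X × ℚ) (l : List (X × ℚ)) :
    increments c (x :: l) = Finsupp.single x.1 (x.2 - c) + increments x.2 l := rfl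

theorem increments_support (c : ℚ) (l : List (X × ℚ)) {z : X}
    (hz : z ∈ (increments c l).support) : z ∈ l.map Prod.fst := by
  induction l generalizing c with
  | nil => simp [increments_nil] at hz
  | cons x l ih =>
    rw [increments_cons] at hz
    rw [List.map_cons, List.mem_cons]
    by_contra! h
    rw [Finsupp.mem_support_iff, Finsupp.add_apply, Finsupp.single_eq_of_ne h.1, zero_add,
      ← Finsupp.mem_support_iff] at hz
    exact h.2 (ih _ hz)

theorem increments_apply_eq_zero (c : ℚ) {l : List (X × ℚ)} {z : X}
    (hz : z ∉ l.map Prod.fst) : increments c l z = 0 := by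
  by_contra h
  exact hz (increments_support c l (Finsupp.mem_support_iff.2 h))

theorem increments_append (c : ℚ) (l l' : List (X × ℚ)) {x : X × ℚ} (hx : x ∈ l.getLast?) :
    increments c (l ++ l') = increments c l + increments x.2 l' := by
  induction l generalizing c with
  | nil => simp at hx
  | cons y l ih =>
    rw [List.cons_append, increments_cons, increments_cons, add_assoc]
    rcases l with _ | ⟨z, l⟩
    · simp only [List.getLast?_singleton, Option.mem_def, Option.some.injEq] at hx
      subst hx
      simp [increments_nil]
    · rw [ih]
      simpa using hx

theorem increments_map_add (c k : ℚ) (l : List (X × ℚ)) :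
    increments (c + k) (l.map fun x => (x.1, x.2 + k)) = increments c l := by
  induction l generalizing c with
  | nil => rfl
  | cons x l ih =>
    rw [List.map_cons, increments_cons, increments_cons, ih, add_sub_add_right_eq_sub]

theorem massOn_univ_increments (c : ℚ) (l : List (X × ℚ)) {x : X × ℚ} (hx : x ∈ l.getLast?) :
    massOn Set.univ (increments c l) = x.2 - c := by
  induction l generalizing c with
  | nil => simp at hx
  | cons y l ih =>
    rw [increments_cons, map_add, massOn_single, if_pos (Set.mem_univ _)]
    rcases l with _ | ⟨z, l⟩
    · simp only [List.getLast?_singleton, Option.mem_def, Option.some.injEq] at hx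
      subst hx
      simp [increments_nil]
    · rw [ih _ (by simpa using hx)]; ring

theorem increments_mapDomain {Y : Type*} (f : X → Y) (c : ℚ) (l : List (X × ℚ)) :
    (increments c l).mapDomain f = increments c (l.map (Prod.map f id)) := by
  induction l generalizing c with
  | nil => exact Finsupp.mapDomain_zero
  | cons x l ih =>
    rw [List.map_cons, increments_cons, increments_cons, Finsupp.mapDomain_add, ih,
      Finsupp.mapDomain_single]
    rfl

theorem increments_nonneg {c : ℚ} {l : List (X × ℚ)} (hl : l.Pairwise fun x y => x.2 < y.2)
    (hc : ∀ x ∈ l, c < x.2) (z : X) : 0 ≤ increments c l z := by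
  classical
  induction l generalizing c with
  | nil => exact le_rfl
  | cons x l ih =>
    rw [List.pairwise_cons] at hl
    rw [increments_cons, Finsupp.add_apply]
    refine add_nonneg ?_ (ih hl.2 hl.1)
    rw [Finsupp.single_apply]
    split_ifs
    · exact sub_nonneg.2 (hc x (by simp)).le
    · exact le_rfl

theorem le_of_getLast? {l : List (X × ℚ)} (hl : l.Pairwise fun x y => x.2 < y.2) {c : ℚ}
    (hlast : l.getLast?.map Prod.snd = some c) {x : X × ℚ} (hx : x ∈ l) : x.2 ≤ c := by
  induction l generalizing x with
  | nil => simp at hx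
  | cons y l ih =>
    rw [List.pairwise_cons] at hl
    rcases l with _ | ⟨z, l⟩
    · simp only [List.mem_singleton] at hx
      subst hx
      exact le_of_eq (by simpa using hlast)
    · have hlast' : (z :: l).getLast?.map Prod.snd = some c := by simpa using hlast
      rcases List.mem_cons.1 hx with rfl | hx
      · exact (hl.1 z (by simp)).le.trans (ih hl.2 hlast' (by simp))
      · exact ih hl.2 hlast' hx

end Mass

/-! ### Abstract columns in a poset and uniqueness of the decomposition. -/

section Columns

variable {X : Type*} [PartialOrder X]

/-- An abstract LS-path: a strictly decreasing sequence with strictly increasing times ending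
in `1`, consecutive members of which are joined by admissible chains. -/
structure IsColumn (adm : ℚ → X → X → Prop) (l : List (X × ℚ)) : Prop where
  pos : ∀ x ∈ l, 0 < x.2
  chain : l.IsChain fun x y => y.1 < x.1 ∧ x.2 < y.2 ∧
    Relation.ReflTransGen (fun p q => q ⋖ p ∧ adm x.2 p q) x.1 y.1
  last : l.getLast?.map Prod.snd = some 1

/-- An abstract tableau: a sequence of columns that is weakly decreasing as a whole. -/
structure IsColumns (adm : ℚ → X → X → Prop) (A : List (List (X × ℚ))) : Prop where
  column : ∀ l ∈ A, IsColumn adm l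
  sorted : (A.flatten.map Prod.fst).Pairwise (· ≥ ·)

/-- The formal sum of the columns. -/
noncomputable def columnsSum (A : List (List (X × ℚ))) : X →₀ ℚ := (A.map (increments 0)).sum

variable {adm : ℚ → X → X → Prop}

theorem IsColumn.pairwise {l : List (X × ℚ)} (h : IsColumn adm l) :
    l.Pairwise fun x y => y.1 < x.1 ∧ x.2 < y.2 := by
  have : Trans (fun x y : X × ℚ => y.1 < x.1 ∧ x.2 < y.2) (fun x y : X × ℚ => y.1 < x.1 ∧ x.2 < y.2)
      (fun x y : X × ℚ => y.1 < x.1 ∧ x.2 < y.2) :=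
    ⟨fun h h' => ⟨h'.1.trans h.1, h.2.trans h'.2⟩⟩
  exact (h.chain.imp fun _ _ h => ⟨h.1, h.2.1⟩).pairwise

theorem IsColumn.ne_nil {l : List (X × ℚ)} (h : IsColumn adm l) : l ≠ [] := by
  rintro rfl; simpa using h.last

theorem IsColumn.exists_last {l : List (X × ℚ)} (h : IsColumn adm l) :
    ∃ x ∈ l.getLast?, x.2 = 1 := by
  simpa using h.last

theorem IsColumns.tail {l : List (X × ℚ)} {A : List (List (X × ℚ))}
    (h : IsColumns adm (l :: A)) : IsColumns adm A := by
  refine ⟨fun l' hl' => h.column l' (by simp [hl']), ?_⟩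
  have := h.sorted
  rw [List.flatten_cons, List.map_append, List.pairwise_append] at this
  exact this.2.1

theorem columnsSum_cons (l : List (X × ℚ)) (A : List (List (X × ℚ))) :
    columnsSum (l :: A) = increments 0 l + columnsSum A := by
  simp [columnsSum]

theorem columnsSum_support {A : List (List (X × ℚ))} {z : X} (hz : z ∈ (columnsSum A).support) :
    z ∈ A.flatten.map Prod.fst := by
  induction A with
  | nil => simp [columnsSum] at hz
  | cons l A ih =>
    rw [columnsSum_cons] at hz
    rw [List.flatten_cons, List.map_append, List.mem_append]
    by_contra! h
    rw [Finsupp.mem_support_iff, Finsupp.add_apply, increments_apply_eq_zero 0 h.1, zero_add,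
      ← Finsupp.mem_support_iff] at hz
    exact h.2 (ih hz)

theorem columnsSum_nonneg {A : List (List (X × ℚ))} (h : IsColumns adm A) (z : X) :
    0 ≤ columnsSum A z := by
  induction A with
  | nil => exact le_rfl
  | cons l A ih =>
    have hl := h.column l (by simp)
    rw [columnsSum_cons, Finsupp.add_apply]
    exact add_nonneg (increments_nonneg (hl.pairwise.imp fun h => h.2) hl.pos z) (ih h.tail)

theorem massOn_univ_columnsSum {A : List (List (X × ℚ))} (h : IsColumns adm A) :
    massOn Set.univ (columnsSum A) = A.length := by
  induction A with
  | nil => simp [columnsSum]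
  | cons l A ih =>
    obtain ⟨x, hx, hx1⟩ := (h.column l (by simp)).exists_last
    rw [columnsSum_cons, map_add, ih h.tail, massOn_univ_increments 0 l hx, hx1]
    rw [List.length_cons]; push_cast; ring

/-! ### Uniqueness of the decomposition into columns -/

theorem le_head_of_mem_support {c : ℚ} {x : X × ℚ} {l : List (X × ℚ)} {r : X →₀ ℚ}
    (hl : (x :: l).Pairwise fun x y => y.1 < x.1 ∧ x.2 < y.2)
    (hr : ∀ z ∈ r.support, ∀ y ∈ x :: l, z ≤ y.1) {z : X}
    (hz : (increments c (x :: l) + r) z ≠ 0) : z ≤ x.1 := by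
  by_cases h : z ∈ r.support
  · exact hr z h x (by simp)
  · rw [Finsupp.add_apply, Finsupp.notMem_support_iff.1 h, add_zero] at hz
    have := increments_support c _ (Finsupp.mem_support_iff.2 hz)
    rw [List.map_cons, List.mem_cons] at this
    rcases this with rfl | h'
    · exact le_rfl
    · obtain ⟨y, hy, rfl⟩ := List.mem_map.1 h'
      exact ((List.pairwise_cons.1 hl).1 y hy).1.le

theorem le_apply_head {c : ℚ} {x : X × ℚ} {l : List (X × ℚ)} {r : X →₀ ℚ}
    (hl : (x :: l).Pairwise fun x y => y.1 < x.1 ∧ x.2 < y.2) (hr : ∀ z, 0 ≤ r z) :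
    x.2 - c ≤ (increments c (x :: l) + r) x.1 := by
  rw [List.pairwise_cons] at hl
  rw [increments_cons, Finsupp.add_apply, Finsupp.add_apply, Finsupp.single_eq_same]
  have := increments_nonneg (hl.2.imp fun h => h.2) (fun y hy => (hl.1 y hy).2) x.1
  linarith [hr x.1]

theorem apply_head_le {c : ℚ} {x : X × ℚ} {l : List (X × ℚ)} {r : X →₀ ℚ}
    (hl : (x :: l).Pairwise fun x y => y.1 < x.1 ∧ x.2 < y.2)
    (hr : ∀ z ∈ r.support, ∀ y ∈ x :: l, z ≤ y.1) (hne : l ≠ []) :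
    (increments c (x :: l) + r) x.1 ≤ x.2 - c := by
  rw [List.pairwise_cons] at hl
  rw [increments_cons, Finsupp.add_apply, Finsupp.add_apply, Finsupp.single_eq_same,
    increments_apply_eq_zero, Finsupp.notMem_support_iff.1, add_zero, add_zero]
  · intro hx
    obtain ⟨y, hy⟩ := List.exists_mem_of_ne_nil l hne
    exact (hl.1 y hy).1.not_ge (hr _ hx y (by simp [hy]))
  · intro hx
    obtain ⟨y, hy, e⟩ := List.mem_map.1 hx
    exact (hl.1 y hy).1.ne e

/-- The column can be read off from the sum: its head is the largest point of the support, and the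
coefficient there gives the time at which the head is left, unless the head is the last entry, which
ends at time `1`. Here `c` is the time already used. -/
theorem column_unique {l l' : List (X × ℚ)} {c : ℚ} {r r' : X →₀ ℚ}
    (hl : l.Pairwise fun x y => y.1 < x.1 ∧ x.2 < y.2)
    (hl' : l'.Pairwise fun x y => y.1 < x.1 ∧ x.2 < y.2)
    (hc : ∀ x ∈ l, c < x.2) (hc' : ∀ x ∈ l', c < x.2)
    (h1 : l.getLast?.map Prod.snd = some 1) (h1' : l'.getLast?.map Prod.snd = some 1)
    (hr0 : ∀ z, 0 ≤ r z) (hr0' : ∀ z, 0 ≤ r' z)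
    (hr : ∀ z ∈ r.support, ∀ y ∈ l, z ≤ y.1) (hr' : ∀ z ∈ r'.support, ∀ y ∈ l', z ≤ y.1)
    (h : increments c l + r = increments c l' + r') : l = l' := by
  induction l generalizing l' c with
  | nil => simp at h1
  | cons x l ih =>
    rcases l' with _ | ⟨x', l'⟩
    · simp at h1'
    have p₁ := le_apply_head (c := c) hl hr0
    have p₂ := le_apply_head (c := c) hl' hr0'
    have e₁ : x.1 = x'.1 := by
      refine le_antisymm (le_head_of_mem_support (c := c) hl' hr' ?_)
        (le_head_of_mem_support (c := c) hl hr ?_)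
      · rw [← h]; linarith [hc x (by simp)]
      · rw [h]; linarith [hc' x' (by simp)]
    have t₁ := le_of_getLast? (hl.imp fun h => h.2) h1 (x := x) (by simp)
    have t₂ := le_of_getLast? (hl'.imp fun h => h.2) h1' (x := x') (by simp)
    -- In general `c` plus the coefficient is at least the time, with equality if the column
    -- continues, for then the remainder misses the head. A head that ends its column has the
    -- largest possible time `1`.
    have e₂ : x.2 = x'.2 := by
      refine le_antisymm ?_ ?_
      · by_cases hn : l' = []
        · subst hn
          have : x'.2 = 1 := by simpa using h1'
          rwa [this]
        · have := apply_head_le (c := c) hl' hr' hn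
          rw [← e₁, ← h] at this
          linarith
      · by_cases hn : l = []
        · subst hn
          have : x.2 = 1 := by simpa using h1
          rwa [this]
        · have := apply_head_le (c := c) hl hr hn
          rw [e₁, h] at this
          linarith
    have e : x = x' := Prod.ext e₁ e₂
    subst e
    rw [increments_cons, increments_cons, add_assoc, add_assoc, add_right_inj] at h
    rw [List.pairwise_cons] at hl hl'
    congr 1
    rcases l with _ | ⟨y, l⟩
    · rcases l' with _ | ⟨y', l'⟩
      · rfl
      · have hx1 : x.2 = 1 := by simpa using h1
        have := le_of_getLast? (hl'.2.imp fun h => h.2) (by simpa using h1') (x := y') (by simp)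
        linarith [(hl'.1 y' (by simp)).2]
    · rcases l' with _ | ⟨y', l'⟩
      · have hx1 : x.2 = 1 := by simpa using h1'
        have := le_of_getLast? (hl.2.imp fun h => h.2) (by simpa using h1) (x := y) (by simp)
        linarith [(hl.1 y (by simp)).2]
      · exact ih hl.2 hl'.2 (fun y hy => (hl.1 y hy).2) (fun y hy => (hl'.1 y hy).2)
          (by simpa using h1) (by simpa using h1') (fun z hz y hy => hr z hz y (by simp [hy]))
          (fun z hz y hy => hr' z hz y (List.mem_cons_of_mem _ hy)) h

theorem IsColumns.le_of_mem_support {l : List (X × ℚ)} {A : List (List (X × ℚ))}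
    (h : IsColumns adm (l :: A)) {z : X} (hz : z ∈ (columnsSum A).support) {y : X × ℚ}
    (hy : y ∈ l) : z ≤ y.1 := by
  have := h.sorted
  rw [List.flatten_cons, List.map_append, List.pairwise_append] at this
  exact this.2.2 _ (List.mem_map_of_mem hy) _ (columnsSum_support hz)

/-- The total weight counts the columns; the columns are then recovered one by one, the sum of the
later ones serving as remainder. -/
theorem columnsSum_injOn : Set.InjOn columnsSum {A | IsColumns adm A} := by
  intro A hA A' hA' h
  have hlen : A.length = A'.length := by
    have := congrArg (massOn Set.univ) h
    rw [massOn_univ_columnsSum hA, massOn_univ_columnsSum hA'] at this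
    exact_mod_cast this
  induction A generalizing A' with
  | nil => exact (List.length_eq_zero_iff.1 hlen.symm).symm
  | cons l A ih =>
    rcases A' with _ | ⟨l', A'⟩
    · simp at hlen
    rw [columnsSum_cons, columnsSum_cons] at h
    have hl := IsColumns.column hA l (by simp)
    have hl' := IsColumns.column hA' l' (by simp)
    have e := column_unique hl.pairwise hl'.pairwise hl.pos hl'.pos hl.last hl'.last
      (columnsSum_nonneg (IsColumns.tail hA)) (columnsSum_nonneg (IsColumns.tail hA'))
      (fun z hz y hy => IsColumns.le_of_mem_support hA hz hy)
      (fun z hz y hy => IsColumns.le_of_mem_support hA' hz hy) h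
    subst e
    rw [ih (IsColumns.tail hA) (IsColumns.tail hA') (add_left_cancel h) (by simpa using hlen)]

end Columns

/-! ### The abstract fan: gluing columns and cutting at integral times. -/

section Fan

variable {X : Type*} [PartialOrder X]

/-- The abstract fan of monoids of a poset: the non-negative elements of integral total weight
that are supported on a maximal chain and whose partial sums are admissible for all covering
relations in that chain. -/
def absFan (adm : ℚ → X → X → Prop) : Set (X →₀ ℚ) :=
  {a | ∃ C : Set X, IsMaxChain (· ≤ ·) C ∧ (a.support : Set X) ⊆ C ∧ (∀ p, 0 ≤ a p) ∧
    (∃ k : ℤ, massOn Set.univ a = k) ∧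
    ∀ p ∈ C, ∀ q ∈ C, q ⋖ p → adm (massOn (Set.Ici p) a) p q}

variable {adm : ℚ → X → X → Prop}

/-! ### The sum of the columns lies in the fan -/

theorem exists_chain_of_reflTransGen {r : X → X → Prop} (hr : ∀ p q, r p q → q < p) {x y : X}
    (h : Relation.ReflTransGen r x y) :
    ∃ Q : Set X, IsChain (· ≤ ·) Q ∧ x ∈ Q ∧ y ∈ Q ∧ (∀ z ∈ Q, y ≤ z ∧ z ≤ x) ∧
      Relation.ReflTransGen (fun p q => r p q ∧ p ∈ Q ∧ q ∈ Q) x y := by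
  induction h using Relation.ReflTransGen.head_induction_on with
  | refl => exact ⟨{y}, by simp, by simp, by simp, by simp, .refl⟩
  | @head x x' hx _ ih =>
    obtain ⟨Q, hQ, hx', hy, hb, hp⟩ := ih
    have hlt := hr _ _ hx
    refine ⟨insert x Q, hQ.insert fun z hz _ => Or.inr ((hb z hz).2.trans hlt.le), by simp,
      by simp [hy], ?_, ?_⟩
    · rintro z (rfl | hz)
      · exact ⟨(hb x' hx').1.trans hlt.le, le_rfl⟩
      · exact ⟨(hb z hz).1, (hb z hz).2.trans hlt.le⟩
    · refine Relation.ReflTransGen.head ⟨hx, by simp, by simp [hx']⟩ (hp.lift id ?_)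
      exact fun p q h => ⟨h.1, by simp [h.2.1], by simp [h.2.2]⟩

/-- The points on the admissible paths between consecutive entries together form one chain `K`.
Where the time is integral no path is needed. -/
theorem exists_chain_of_isChain {R : List (X × ℚ)}
    (hR : R.IsChain fun x y : X × ℚ => y.1 ≤ x.1 ∧
      (Relation.ReflTransGen (fun p q => q ⋖ p ∧ adm x.2 p q) x.1 y.1 ∨ ∃ k : ℤ, x.2 = k)) :
    ∃ K : Set X, IsChain (· ≤ ·) K ∧ (∀ x ∈ R, x.1 ∈ K) ∧
      (∀ x ∈ R.head?, ∀ z ∈ K, z ≤ x.1) ∧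
      R.IsChain fun x y : X × ℚ => y.1 ≤ x.1 ∧
        (Relation.ReflTransGen (fun p q => (q ⋖ p ∧ adm x.2 p q) ∧ p ∈ K ∧ q ∈ K) x.1 y.1 ∨
          ∃ k : ℤ, x.2 = k) := by
  induction R with
  | nil => exact ⟨∅, by simp, by simp, by simp, by simp⟩
  | cons x R ih =>
    rcases R with _ | ⟨y, R⟩
    · exact ⟨{x.1}, by simp, by simp, by simp, by simp⟩
    rw [List.isChain_cons_cons] at hR
    obtain ⟨K, hK, hmem, hhead, hch⟩ := ih hR.2
    have hhead : ∀ z ∈ K, z ≤ y.1 := hhead y (by simp)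
    have key : ∃ Q : Set X, IsChain (· ≤ ·) Q ∧ x.1 ∈ Q ∧ (∀ z ∈ Q, y.1 ≤ z ∧ z ≤ x.1) ∧
        (Relation.ReflTransGen (fun p q => (q ⋖ p ∧ adm x.2 p q) ∧ p ∈ Q ∧ q ∈ Q) x.1 y.1 ∨
          ∃ k : ℤ, x.2 = k) := by
      rcases hR.1.2 with h | h
      · obtain ⟨Q, h₁, h₂, -, h₃, h₄⟩ := exists_chain_of_reflTransGen (fun p q h => h.1.lt) h
        exact ⟨Q, h₁, h₂, h₃, Or.inl h₄⟩
      · exact ⟨{x.1}, by simp, by simp, by simpa using hR.1.1, Or.inr h⟩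
    obtain ⟨Q, hQ, hxQ, hb, hp⟩ := key
    refine ⟨Q ∪ K, ?_, ?_, ?_, ?_⟩
    · rintro z (hz | hz) w (hw | hw) hne
      · exact hQ hz hw hne
      · exact Or.inr ((hhead w hw).trans (hb z hz).1)
      · exact Or.inl ((hhead z hz).trans (hb w hw).1)
      · exact hK hz hw hne
    · intro z hz
      rcases List.mem_cons.1 hz with rfl | hz
      exacts [Or.inl hxQ, Or.inr (hmem z hz)]
    · intro x' hx' z hz
      simp only [List.head?_cons, Option.mem_def, Option.some.injEq] at hx'
      subst hx'
      rcases hz with hz | hz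
      exacts [(hb z hz).2, (hhead z hz).trans hR.1.1]
    · rw [List.isChain_cons_cons]
      refine ⟨⟨hR.1.1, hp.imp_left fun h => h.lift id ?_⟩, hch.imp fun u v h => ⟨h.1,
        h.2.imp_left fun h => h.lift id ?_⟩⟩
      · exact fun p q h => ⟨h.1, Or.inl h.2.1, Or.inl h.2.2⟩
      · exact fun p q h => ⟨h.1, Or.inr h.2.1, Or.inr h.2.2⟩

/-- The path descends by covering relations inside the chain `C`, so it must use each covering
relation of `C` whose upper end it passes. -/
theorem adm_of_reflTransGen {C : Set X} (hC : IsChain (· ≤ ·) C) {t : ℚ} {x y : X}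
    (h : Relation.ReflTransGen (fun p q => (q ⋖ p ∧ adm t p q) ∧ p ∈ C ∧ q ∈ C) x y)
    {p q : X} (hp : p ∈ C) (hq : q ∈ C) (hpq : q ⋖ p) (hx : p ≤ x) (hy : ¬ p ≤ y) :
    adm t p q := by
  induction h using Relation.ReflTransGen.head_induction_on with
  | refl => exact absurd hx hy
  | @head x x' h _ ih =>
    obtain ⟨⟨hc, ha⟩, hxC, hx'C⟩ := h
    by_cases hpx : p ≤ x'
    · exact ih hpx
    have hlt : x' < p := lt_of_le_not_ge ((hC.total hp hx'C).resolve_left hpx) hpx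
    have e₁ : p = x := by
      by_contra hne
      exact hc.2 hlt (lt_of_le_of_ne hx hne)
    subst e₁
    have e₂ : q = x' := by
      rcases hC.total hq hx'C with h | h
      · by_contra hne; exact hpq.2 (lt_of_le_of_ne h hne) hlt
      · by_contra hne; exact hc.2 (lt_of_le_of_ne h (Ne.symm hne)) hpq.lt
    exact e₂ ▸ ha

/-- Telescoping turns `c` plus the partial sum into the time of the last entry above `p`, or into
`c` if there is none. Admissibility is thus needed only at the jump out of `Set.Ici p`, or at the
two ends. -/
theorem adm_massOn_increments {p q : X} {R : List (X × ℚ)} {c : ℚ}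
    (hR : R.IsChain fun x y : X × ℚ => y.1 ≤ x.1 ∧ (p ≤ x.1 → ¬ p ≤ y.1 → adm x.2 p q))
    (hlast : ∀ x ∈ R.getLast?, adm x.2 p q)
    (hc : (∀ x ∈ R.head?, ¬ p ≤ x.1 → adm c p q)) (hnil : R = [] → adm c p q) :
    adm (c + massOn (Set.Ici p) (increments c R)) p q := by
  induction R generalizing c with
  | nil => simpa [increments_nil] using hnil rfl
  | cons x R ih =>
    by_cases hpx : p ≤ x.1
    · rw [increments_cons, map_add, massOn_single, if_pos (Set.mem_Ici.2 hpx), ← add_assoc,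
        add_sub_cancel]
      rw [List.isChain_cons] at hR
      rcases R with _ | ⟨y, R⟩
      · exact ih List.IsChain.nil (by simp) (by simp) fun _ => hlast x (by simp)
      · refine ih hR.2 (by simpa using hlast) ?_ (by simp)
        intro y' hy' hpy
        exact (hR.1 y' hy').2 hpx hpy
    · have hadm := hc x (by simp) hpx
      rw [massOn_eq_zero, add_zero]
      · exact hadm
      intro z hz hpz
      have hz := increments_support _ _ hz
      have : Trans (fun x y : X × ℚ => y.1 ≤ x.1) (fun x y : X × ℚ => y.1 ≤ x.1)
        (fun x y : X × ℚ => y.1 ≤ x.1) := ⟨fun h h' => h'.trans h⟩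
      have hpw := (hR.imp fun _ _ h => h.1).pairwise
      rw [List.pairwise_cons] at hpw
      obtain ⟨y, hy, rfl⟩ := List.mem_map.1 hz
      rcases List.mem_cons.1 hy with rfl | hy
      · exact hpx hpz
      · exact hpx (le_trans hpz (hpw.1 y hy))

/-- The columns of an abstract tableau, written one after the other with accumulated times. -/
def joinColumns : ℕ → List (List (X × ℚ)) → List (X × ℚ)
  | _, [] => []
  | k, l :: A => l.map (fun x => (x.1, x.2 + (k : ℚ))) ++ joinColumns (k + 1) A

theorem joinColumns_map_fst (k : ℕ) (A : List (List (X × ℚ))) :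
    (joinColumns k A).map Prod.fst = A.flatten.map Prod.fst := by
  induction A generalizing k with
  | nil => rfl
  | cons l A ih => simp [joinColumns, ih, Function.comp_def]

theorem increments_joinColumns {k : ℕ} {A : List (List (X × ℚ))} (hA : IsColumns adm A) :
    increments k (joinColumns k A) = columnsSum A := by
  induction A generalizing k with
  | nil => rfl
  | cons l A ih =>
    obtain ⟨x, hx, hx1⟩ := (hA.column l (by simp)).exists_last
    have h₁ := increments_map_add 0 (k : ℚ) l
    have h₂ := ih (k := k + 1) hA.tail
    rw [zero_add] at h₁
    rw [columnsSum_cons, joinColumns, increments_append (x := (x.1, x.2 + k)), h₁, ← h₂, hx1]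
    · congr 2; push_cast; ring
    · rw [List.getLast?_map]
      exact Option.mem_map_of_mem _ hx

theorem joinColumns_getLast {k : ℕ} {A : List (List (X × ℚ))} (hA : IsColumns adm A)
    {x : X × ℚ} (hx : x ∈ (joinColumns k A).getLast?) : ∃ n : ℤ, x.2 = n := by
  induction A generalizing k with
  | nil => simp [joinColumns] at hx
  | cons l A ih =>
    rw [joinColumns, List.getLast?_append] at hx
    rcases h : (joinColumns (k + 1) A).getLast? with _ | y
    · obtain ⟨z, hz, hz1⟩ := (hA.column l (by simp)).exists_last
      rw [h, List.getLast?_map, Option.mem_def.1 hz] at hx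
      simp only [Option.map_some, Option.or_some, Option.getD_none, Option.mem_def,
        Option.some.injEq] at hx
      exact ⟨1 + k, by rw [← hx, hz1]; push_cast; ring⟩
    · rw [h] at hx
      simp only [Option.some_or, Option.mem_def, Option.some.injEq] at hx
      exact ih hA.tail (hx ▸ h)

theorem joinColumns_isChain
    (hshift : ∀ t p q, q ⋖ p → adm t p q → ∀ k : ℤ, adm (t + k) p q)
    {k : ℕ} {A : List (List (X × ℚ))} (hA : IsColumns adm A) :
    (joinColumns k A).IsChain fun x y : X × ℚ => y.1 ≤ x.1 ∧
      (Relation.ReflTransGen (fun p q => q ⋖ p ∧ adm x.2 p q) x.1 y.1 ∨ ∃ n : ℤ, x.2 = n) := by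
  induction A generalizing k with
  | nil => exact List.IsChain.nil
  | cons l A ih =>
    rw [joinColumns, List.isChain_append]
    refine ⟨?_, ih hA.tail, ?_⟩
    · rw [List.isChain_map]
      refine (hA.column l (by simp)).chain.imp fun x y h => ⟨h.1.le, Or.inl ?_⟩
      exact h.2.2.lift id fun p q h => ⟨h.1, by simpa using hshift _ p q h.1 h.2 k⟩
    · intro x hx y hy
      obtain ⟨z, hz, hz1⟩ := (hA.column l (by simp)).exists_last
      rw [List.getLast?_map, Option.mem_def.1 hz] at hx
      simp only [Option.map_some, Option.mem_def, Option.some.injEq] at hx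
      subst hx
      refine ⟨?_, Or.inr ⟨1 + k, by rw [hz1]; push_cast; ring⟩⟩
      have hs := hA.sorted
      rw [List.flatten_cons, List.map_append, List.pairwise_append] at hs
      refine hs.2.2 z.1 (List.mem_map_of_mem (List.mem_of_mem_getLast? hz)) y.1 ?_
      rw [← joinColumns_map_fst (k + 1)]
      exact List.mem_map_of_mem (List.mem_of_mem_head? hy)

theorem columnsSum_mem_absFan (hadm_int : ∀ p q, q ⋖ p → ∀ k : ℤ, adm k p q)
    (hshift : ∀ t p q, q ⋖ p → adm t p q → ∀ k : ℤ, adm (t + k) p q)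
    {A : List (List (X × ℚ))} (hA : IsColumns adm A) : columnsSum A ∈ absFan adm := by
  obtain ⟨K, hK, hmem, -, hch⟩ := exists_chain_of_isChain (joinColumns_isChain hshift (k := 0) hA)
  -- Any maximal chain containing the glued paths will do: its covering relations are either steps
  -- of these paths or crossed at integral times.
  obtain ⟨C, hC, hKC⟩ := hK.exists_maxChain
  have hsupp : ∀ x ∈ joinColumns 0 A, x.1 ∈ C := fun x hx => hKC (hmem x hx)
  refine ⟨C, hC, ?_, columnsSum_nonneg hA, ⟨A.length, ?_⟩, ?_⟩
  · intro z hz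
    have := columnsSum_support hz
    rw [← joinColumns_map_fst 0] at this
    obtain ⟨x, hx, rfl⟩ := List.mem_map.1 this
    exact hsupp x hx
  · rw [massOn_univ_columnsSum hA]; rfl
  · intro p hp q hq hpq
    have h0 : adm 0 p q := by simpa using hadm_int p q hpq 0
    have := adm_massOn_increments (adm := adm) (p := p) (q := q) (R := joinColumns 0 A) (c := 0)
      (hch.imp fun x y h => ⟨h.1, fun hx hy => ?_⟩) ?_ (fun _ _ _ => h0) (fun _ => h0)
    · have e := increments_joinColumns (k := 0) hA
      rw [Nat.cast_zero] at e
      rwa [zero_add, e] at this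
    · rcases h.2 with h | ⟨k, hk⟩
      · exact adm_of_reflTransGen hC.1
          (h.lift id fun p q h => ⟨h.1, hKC h.2.1, hKC h.2.2⟩) hp hq hpq hx hy
      · rw [hk]; exact hadm_int p q hpq k
    · intro x hx
      obtain ⟨k, hk⟩ := joinColumns_getLast hA hx
      rw [hk]; exact hadm_int p q hpq k

/-! ### Every element of the fan is a sum of columns -/

theorem mem_of_isMaxChain {C : Set X} (hC : IsMaxChain (· ≤ ·) C) {w : X}
    (hw : ∀ z ∈ C, w ≤ z ∨ z ≤ w) : w ∈ C := by
  rw [hC.2 (hC.1.insert fun z hz _ => hw z hz) (Set.subset_insert w C)]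
  exact Set.mem_insert _ _

/-- In a maximal chain the next element below `x` is covered by `x` in the whole poset, since
anything strictly between could be inserted. -/
theorem reflTransGen_of_isMaxChain [Finite X] {C : Set X} (hC : IsMaxChain (· ≤ ·) C) {x y : X}
    (hx : x ∈ C) (hy : y ∈ C) (hyx : y ≤ x) :
    Relation.ReflTransGen (fun p q => q ⋖ p ∧ p ∈ C ∧ q ∈ C ∧ p ≤ x ∧ y ≤ q) x y := by
  induction x using WellFoundedLT.induction with
  | _ x ih =>
    rcases hyx.eq_or_lt with rfl | hlt
    · exact .refl
    obtain ⟨z, ⟨hzC, hyz, hzx⟩, hmax⟩ := (Set.toFinite {z | z ∈ C ∧ y ≤ z ∧ z < x}).exists_maximal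
      ⟨y, hy, le_rfl, hlt⟩
    have hcov : z ⋖ x := by
      refine ⟨hzx, fun w hzw hwx => ?_⟩
      have hwC : w ∈ C := by
        refine mem_of_isMaxChain hC fun c hc => ?_
        rcases hC.1.total hx hc with h | h
        · exact Or.inl (hwx.le.trans h)
        rcases h.eq_or_lt with rfl | h
        · exact Or.inl hwx.le
        rcases hC.1.total hc hzC with h' | h'
        · exact Or.inr (h'.trans hzw.le)
        · exact Or.inr ((hmax ⟨hc, hyz.trans h', h⟩ h').trans hzw.le)
      exact hzw.not_ge (hmax ⟨hwC, hyz.trans hzw.le, hwx⟩ hzw.le)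
    refine Relation.ReflTransGen.head ⟨hcov, hx, hzC, le_rfl, hyz⟩ ?_
    exact (ih z hzx hzC hyz).lift id fun p q h => ⟨h.1, h.2.1, h.2.2.1, h.2.2.2.1.trans hzx.le,
      h.2.2.2.2⟩

/-- Greedy filling from the top of the support, starting at time `c`; `r` is the part beyond time
`1`. Admissibility is assumed only below the support, since above it the sum is just `c`, an
arbitrary intermediate time. The last clause lets admissibility pass to `r`. -/
theorem exists_column [Finite X] {C : Set X} (hC : IsMaxChain (· ≤ ·) C) (a : X →₀ ℚ) (c : ℚ)
    (hsupp : (a.support : Set X) ⊆ C) (ha : ∀ z, 0 ≤ a z) (hc0 : 0 ≤ c) (hc : c < 1)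
    (hmass : 1 ≤ c + massOn Set.univ a)
    (hadm : ∀ p ∈ C, ∀ q ∈ C, q ⋖ p → (∃ z ∈ a.support, p ≤ z) →
      adm (c + massOn (Set.Ici p) a) p q) :
    ∃ (l : List (X × ℚ)) (r : X →₀ ℚ), (∀ x ∈ l, c < x.2) ∧
      (l.IsChain fun x y => y.1 < x.1 ∧ x.2 < y.2 ∧
        Relation.ReflTransGen (fun p q => q ⋖ p ∧ adm x.2 p q) x.1 y.1) ∧
      l.getLast?.map Prod.snd = some 1 ∧ (∀ x ∈ l, x.1 ∈ a.support) ∧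
      (∀ x ∈ l.head?, ∀ z ∈ a.support, z ≤ x.1) ∧
      a = increments c l + r ∧ (∀ z, 0 ≤ r z) ∧ r.support ⊆ a.support ∧
      (∀ x ∈ l, ∀ z ∈ r.support, z ≤ x.1) ∧
      ∀ p, massOn (Set.Ici p) r = 0 ∨
        massOn (Set.Ici p) r = c + massOn (Set.Ici p) a - 1 ∧ ∃ z ∈ a.support, p ≤ z := by
  induction hn : a.support.card using Nat.strong_induction_on generalizing a c with
  | _ n ih =>
    have hne : a.support.Nonempty := by
      rw [Finsupp.support_nonempty_iff]
      rintro rfl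
      rw [map_zero] at hmass
      linarith
    obtain ⟨x, hx, hmax⟩ := a.support.exists_maximal hne
    have hmax : ∀ z ∈ a.support, z ≤ x := fun z hz =>
      (hC.1.total (hsupp hz) (hsupp hx)).elim id fun h => hmax hz h
    have hxpos : 0 < a x := lt_of_le_of_ne (ha x) (Finsupp.mem_support_iff.1 hx).symm
    -- If the largest point `x` fills the column, it contributes only `1 - c` and the excess stays
    -- in the remainder; otherwise its whole weight is used and time advances to `c + a x`.
    by_cases hcase : 1 ≤ c + a x
    · have hrapp : ∀ z, (a - Finsupp.single x (1 - c)) z =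
          a z - Finsupp.single x (1 - c) z := fun z => Finsupp.sub_apply ..
      have hr : (a - Finsupp.single x (1 - c)).support ⊆ a.support := by
        intro z hz
        by_contra hza
        rw [Finsupp.mem_support_iff, hrapp, Finsupp.notMem_support_iff.1 hza,
          Finsupp.single_eq_of_ne (fun h => hza (by rw [h]; exact hx)), sub_zero] at hz
        exact hz rfl
      refine ⟨[(x, 1)], a - Finsupp.single x (1 - c), by simpa using hc, by simp, by simp,
        by simpa using hx, ?_, ?_, ?_, hr, ?_, ?_⟩
      · intro y hy
        simp only [List.head?_cons, Option.mem_def, Option.some.injEq] at hy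
        subst hy; exact hmax
      · rw [increments_cons, increments_nil, add_zero, add_sub_cancel]
      · intro z
        rw [hrapp]
        by_cases hz : z = x
        · subst hz; rw [Finsupp.single_eq_same]; linarith
        · rw [Finsupp.single_eq_of_ne hz, sub_zero]; exact ha z
      · intro y hy z hz
        rw [List.mem_singleton.1 hy]
        exact hmax z (hr hz)
      · intro p
        by_cases hp : p ≤ x
        · right
          rw [map_sub, massOn_single, if_pos (Set.mem_Ici.2 hp)]
          exact ⟨by ring, x, hx, hp⟩
        · left
          exact massOn_eq_zero fun z hz hpz => hp (le_trans hpz (hmax z (hr hz)))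
    · push Not at hcase
      have hsplit : a = Finsupp.single x (a x) + a.erase x := (Finsupp.single_add_erase x a).symm
      have hsub : (a.erase x).support ⊆ a.support := by
        classical
        rw [Finsupp.support_erase]; exact Finset.erase_subset _ _
      have hlt : ∀ z ∈ (a.erase x).support, z < x := by
        intro z hz
        refine lt_of_le_of_ne (hmax z (hsub hz)) ?_
        rintro rfl
        rw [Finsupp.mem_support_iff, Finsupp.erase_same] at hz
        exact hz rfl
      have hup : ∀ p ≤ x, massOn (Set.Ici p) a = a x + massOn (Set.Ici p) (a.erase x) := by
        intro p hp
        conv_lhs => rw [hsplit]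
        rw [map_add, massOn_single, if_pos (Set.mem_Ici.2 hp)]
      have huniv : massOn Set.univ a = a x + massOn Set.univ (a.erase x) := by
        conv_lhs => rw [hsplit]
        rw [map_add, massOn_single, if_pos (Set.mem_univ _)]
      obtain ⟨l, r, h₁, h₂, h₃, h₄, h₅, h₆, h₇, h₈, h₉, h₁₀⟩ := ih (a.erase x).support.card
        (by
          classical
          rw [← hn, Finsupp.support_erase]; exact Finset.card_erase_lt_of_mem hx)
        (a.erase x) (c + a x) (fun z hz => hsupp (hsub hz))
        (fun z => by
          by_cases hz : z = x
          · rw [hz, Finsupp.erase_same]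
          · rw [Finsupp.erase_ne hz]; exact ha z)
        (by linarith) hcase (by rw [add_assoc, ← huniv]; exact hmass)
        (fun p hp q hq hpq ⟨z, hz, hpz⟩ => by
          rw [add_assoc, ← hup p (hpz.trans (hlt z hz).le)]
          exact hadm p hp q hq hpq ⟨z, hsub hz, hpz⟩) rfl
      refine ⟨(x, c + a x) :: l, r, ?_, ?_, ?_, ?_, ?_, ?_, h₇, h₈.trans hsub, ?_, ?_⟩
      · intro y hy
        rcases List.mem_cons.1 hy with rfl | hy
        · exact lt_add_of_pos_right c hxpos
        · linarith [h₁ y hy]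
      · rw [List.isChain_cons]
        refine ⟨fun y hy => ?_, h₂⟩
        have hyl := List.mem_of_mem_head? hy
        have hyx := hlt _ (h₄ y hyl)
        refine ⟨hyx, h₁ y hyl, ?_⟩
        refine (reflTransGen_of_isMaxChain hC (hsupp hx) (hsupp (hsub (h₄ y hyl))) hyx.le).lift id ?_
        rintro p q ⟨hpq, hp, hq, hpx, hyq⟩
        refine ⟨hpq, ?_⟩
        -- Between `x` and the next head `y` the partial sum over `Set.Ici p` sees only `x`, because
        -- the rest of the support is at most `y ≤ q < p`.
        have := hadm p hp q hq hpq ⟨x, hx, hpx⟩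
        rwa [hup p hpx, massOn_eq_zero, add_zero] at this
        intro z hz hpz
        exact (hpq.lt.trans_le ((le_trans hpz (h₅ y hy z hz)).trans hyq)).false
      · rcases l with _ | ⟨y, l⟩
        · simp at h₃
        · simpa using h₃
      · intro y hy
        rcases List.mem_cons.1 hy with rfl | hy
        exacts [hx, hsub (h₄ y hy)]
      · intro y hy
        simp only [List.head?_cons, Option.mem_def, Option.some.injEq] at hy
        subst hy; exact hmax
      · rw [increments_cons, add_assoc, ← h₆, add_sub_cancel_left]
        exact hsplit
      · intro y hy z hz
        rcases List.mem_cons.1 hy with rfl | hy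
        exacts [hmax z (hsub (h₈ hz)), h₉ y hy z hz]
      · intro p
        rcases h₁₀ p with h | ⟨h, z, hz, hpz⟩
        · exact Or.inl h
        · refine Or.inr ⟨?_, z, hsub hz, hpz⟩
          rw [h, hup p (hpz.trans (hlt z hz).le)]; ring

theorem exists_columns_of_mem_absFan [Finite X] (hadm_int : ∀ p q, q ⋖ p → ∀ k : ℤ, adm k p q)
    (hshift : ∀ t p q, q ⋖ p → adm t p q → ∀ k : ℤ, adm (t + k) p q)
    {a : X →₀ ℚ} (h : a ∈ absFan adm) : ∃ A, IsColumns adm A ∧ columnsSum A = a := by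
  obtain ⟨C, hC, hsupp, ha, ⟨k, hk⟩, hadm⟩ := h
  have hk0 : 0 ≤ k := by
    have : 0 ≤ massOn Set.univ a := by
      rw [massOn_univ]; exact Finset.sum_nonneg fun z _ => ha z
    rw [hk] at this
    exact_mod_cast this
  obtain ⟨n, rfl⟩ := Int.eq_ofNat_of_zero_le hk0
  suffices ∃ A, IsColumns adm A ∧ columnsSum A = a ∧ ∀ x ∈ A.flatten, x.1 ∈ a.support by
    obtain ⟨A, h₁, h₂, -⟩ := this
    exact ⟨A, h₁, h₂⟩
  clear hk0
  induction n generalizing a with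
  | zero =>
    refine ⟨[], ⟨by simp, by simp⟩, ?_, by simp⟩
    exact (eq_zero_of_massOn_univ ha (by simpa using hk)).symm
  | succ n ih =>
    obtain ⟨l, r, h₁, h₂, h₃, h₄, -, h₆, h₇, h₈, h₉, h₁₀⟩ := exists_column (adm := adm) hC a 0
      hsupp ha le_rfl one_pos (by rw [hk]; push_cast; linarith [n.cast_nonneg (α := ℚ)])
      (fun p hp q hq hpq _ => by rw [zero_add]; exact hadm p hp q hq hpq)
    have hl : IsColumn adm l := ⟨h₁, h₂, h₃⟩
    obtain ⟨A, hA, hsum, hmem⟩ := ih (a := r) (fun z hz => hsupp (h₈ hz)) h₇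
      -- The partial sums of the remainder vanish or have dropped by exactly `1`.
      (fun p hp q hq hpq => by
        rcases h₁₀ p with h | ⟨h, -⟩
        · rw [h]; simpa using hadm_int p q hpq 0
        · rw [h, zero_add]
          simpa [sub_eq_add_neg] using hshift _ p q hpq (hadm p hp q hq hpq) (-1))
      (by
        obtain ⟨x, hx, hx1⟩ := hl.exists_last
        have := congrArg (massOn Set.univ) h₆
        rw [map_add, massOn_univ_increments 0 l hx, hk, hx1] at this
        push_cast at this ⊢
        linarith)
    refine ⟨l :: A, ⟨?_, ?_⟩, ?_, ?_⟩
    · intro l' hl'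
      rcases List.mem_cons.1 hl' with rfl | hl'
      exacts [hl, hA.column l' hl']
    · rw [List.flatten_cons, List.map_append, List.pairwise_append]
      refine ⟨?_, hA.sorted, ?_⟩
      · rw [List.pairwise_map]
        exact hl.pairwise.imp fun h => h.1.le
      · intro z hz w hw
        obtain ⟨x, hx, rfl⟩ := List.mem_map.1 hz
        obtain ⟨y, hy, rfl⟩ := List.mem_map.1 hw
        exact h₉ x hx _ (hmem y hy)
    · rw [columnsSum_cons, hsum, h₆]
    · intro x hx
      rw [List.flatten_cons, List.mem_append] at hx
      rcases hx with hx | hx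
      exacts [h₄ x hx, h₈ (hmem x hx)]

end Fan

/-- Bonds pair the lower weight with the coroot, chain steps the upper one; these pairings differ by
a sign, irrelevant for integrality. -/
theorem exists_int_abs_mul_iff (x t : ℚ) :
    (∃ k : ℤ, |x| * t = k) ↔ ∃ k : ℤ, t * -x = k := by
  rcases abs_choice x with h | h <;> rw [h]
  · exact ⟨fun ⟨k, hk⟩ => ⟨-k, by push_cast; linarith⟩, fun ⟨k, hk⟩ => ⟨-k, by push_cast; linarith⟩⟩
  · exact ⟨fun ⟨k, hk⟩ => ⟨k, by linarith⟩, fun ⟨k, hk⟩ => ⟨k, by linarith⟩⟩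

/-! ### Projections between quotients and largest lifts. -/

section Projections

variable {ι M N : Type*} [Finite ι] [AddCommGroup M] [Module ℚ M] [AddCommGroup N] [Module ℚ N]
  {P : RootPairing ι ℚ M N} [P.IsCrystallographic] [P.IsReduced] {b : P.Base}

local notation "𝔰" => RootPairing.weylGroup.ofIdx P
local notation "Stab" => MulAction.stabilizer P.weylGroup

theorem proj_mono {μ ν : M} (h : Stab μ ≤ Stab ν) {σ τ : Cosets b μ} (hστ : σ ≤ τ) :
    proj ν σ ≤ proj ν τ := by
  obtain ⟨u, v, rfl, rfl, huv⟩ := hστ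
  rw [proj_mk b h, proj_mk b h]
  exact Cosets.mk_le_mk huv

theorem proj_proj {μ ν ξ : M} (h : Stab μ ≤ Stab ν) (h' : Stab ν ≤ Stab ξ) (σ : Cosets b μ) :
    proj ξ (proj ν σ) = proj ξ σ := by
  obtain ⟨u, rfl⟩ := σ.exists_rep
  rw [proj_mk b h, proj_mk b h', proj_mk b (h.trans h')]

theorem stabilizer_sum_le {κ : Type*} {t : Finset κ} {f : κ → M}
    (hf : ∀ k ∈ t, IsDominantWeight b (f k)) {k : κ} (hk : k ∈ t) :
    Stab (∑ k ∈ t, f k) ≤ Stab (f k) := by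
  classical
  intro w hw
  rw [← Finset.add_sum_erase t f hk] at hw
  exact smul_eq_of_smul_add_eq (hf k hk)
    (isDominantWeight_sum _ f fun j hj => hf j (Finset.mem_of_mem_erase hj)) hw

theorem isDominantWeight_list_sum {l : List M} (hl : ∀ x ∈ l, IsDominantWeight b x) :
    IsDominantWeight b l.sum := by
  induction l with
  | nil => exact isDominantWeight_zero
  | cons x l ih =>
    rw [List.sum_cons]
    exact (hl x (by simp)).add (ih fun y hy => hl y (by simp [hy]))

theorem stabilizer_list_sum_le {l : List M} (hl : ∀ x ∈ l, IsDominantWeight b x) {x : M}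
    (hx : x ∈ l) : Stab l.sum ≤ Stab x := by
  induction l with
  | nil => simp at hx
  | cons y l ih =>
    have hl' : ∀ x ∈ l, IsDominantWeight b x := fun z hz => hl z (by simp [hz])
    intro w hw
    rw [List.sum_cons] at hw
    rcases List.mem_cons.1 hx with rfl | hx
    · exact smul_eq_of_smul_add_eq (hl x (by simp)) (isDominantWeight_list_sum hl') hw
    · rw [add_comm] at hw
      exact ih hl' hx (smul_eq_of_smul_add_eq (isDominantWeight_list_sum hl') (hl y (by simp)) hw)

/-- This makes the positive root of a covering relation unique, so that bonds and chain conditions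
do not depend on a choice. -/
theorem ofIdx_injOn_isPos {i j : ι} (hi : b.IsPos i) (hj : b.IsPos j) (h : 𝔰 i = 𝔰 j) :
    i = j := by
  by_contra hij
  by_cases hneg : P.root i = -P.root j
  · rw [RootPairing.root_eq_neg_iff] at hneg
    rw [hneg] at hi
    exact (RootPairing.Base.IsPos.neg_iff_not b j).1 hi hj
  · have hli := RootPairing.IsReduced.linearIndependent P hij hneg
    rw [LinearIndependent.pair_iff] at hli
    have e : 𝔰 i • P.root i = 𝔰 j • P.root i := by rw [h]
    rw [ofIdx_smul_weight, ofIdx_smul_weight] at e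
    have := hli (P.toLinearMap (P.root i) (P.coroot i)) (-P.toLinearMap (P.root i) (P.coroot j))
      (by rw [neg_smul, ← sub_eq_add_neg, sub_eq_zero]; exact sub_right_injective e)
    simp at this

theorem pairing_ofIdx_mul_smul (i : ι) (u : P.weylGroup) (x : M) :
    P.toLinearMap ((𝔰 i * u) • x) (P.coroot i) = -P.toLinearMap (u • x) (P.coroot i) := by
  rw [mul_smul, ofIdx_smul_weight, map_sub, LinearMap.map_smul, LinearMap.sub_apply, LinearMap.smul_apply,
    P.root_coroot_eq_pairing, P.pairing_same, smul_eq_mul]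
  ring

/-- A covering relation in `W/W_ν` below an element of `W/W_μ`, `W_μ ⊆ W_ν`: among the lifts
below `p` of the smaller coset there is a largest one, and it is obtained by the same
reflection. -/
theorem exists_largest_lift {μ ν : M} (hμ : IsDominantWeight b μ) (hν : IsDominantWeight b ν)
    (hle : Stab μ ≤ Stab ν) {p q : Cosets b μ} (hqp : q ≤ p) (hcov : proj ν q ⋖ proj ν p) :
    ∃ (i : ι) (u v w : P.weylGroup), w • ν = ν ∧ IsReflStep (proj ν p) (proj ν q) i u v ∧
      IsReflStep p (Cosets.mk b μ (u * w)) i (u * w) (v * w) ∧ q ≤ Cosets.mk b μ (u * w) ∧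
      Cosets.mk b μ (u * w) ≤ p ∧ proj ν (Cosets.mk b μ (u * w)) = proj ν q := by
  obtain ⟨y, hy⟩ := exists_isMinRep hν (proj ν p)
  obtain ⟨x, hx⟩ := exists_isMinRep hν (proj ν q)
  obtain ⟨p₀, hp₀⟩ := exists_isMinRep hμ p
  obtain ⟨q₀, hq₀⟩ := exists_isMinRep hμ q
  obtain ⟨i', hi', hlen⟩ := exists_ofIdx_of_covBy hν hcov hx hy
  obtain ⟨i, hi, hii⟩ := exists_isPos b i'
  rw [← hii] at hi'
  have ep : Cosets.mk b ν p₀ = proj ν p := by rw [← hp₀.1, proj_mk b hle]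
  have eq : Cosets.mk b ν q₀ = proj ν q := by rw [← hq₀.1, proj_mk b hle]
  -- The minimal representative of `p` factors as `y * w` with `w` fixing `ν`; the largest lift is
  -- represented by `x * w`.
  set w := y⁻¹ * p₀ with hw
  have hpw : p₀ = y * w := by rw [hw, mul_inv_cancel_left]
  have hwν : w • ν = ν := by
    rw [← hy.1, Cosets.mk_eq_mk_iff] at ep
    rw [hw, mul_smul, ep, inv_smul_smul]
  have hle₀ : BruhatLE b q₀ (x * w) :=
    le_mul_of_covBy hν hcov hx hy hwν eq (hpw ▸ (Cosets.le_iff hμ hq₀ hp₀).1 hqp)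
  have hstep : y * w = 𝔰 i * (x * w) := by rw [hi', mul_assoc]
  have lx := hx.length_mul hν hwν
  have ly := hy.length_mul hν hwν
  have hxy : BruhatLE b (x * w) (y * w) := by
    rw [hstep]
    refine bruhatLE_ofIdx_mul ?_
    rw [← hstep]
    omega
  -- Lengths add over `x` and over `y`, so both products have the same ascents among the simple
  -- reflections fixing `μ`.
  have hmin : IsMinRep (Cosets.mk b μ (x * w)) (x * w) := by
    refine isMinRep_of_forall_ascent hμ fun j hj hs => ?_
    have hsν : 𝔰 j • ν = ν := hle hs
    have hwj : (w * 𝔰 j) • ν = ν := by rw [mul_smul, hsν, hwν]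
    have h₁ := hp₀.length_lt hs
    rw [hpw, mul_assoc, hy.length_mul hν hwj] at h₁
    rw [mul_assoc, hx.length_mul hν hwj]
    omega
  refine ⟨i, x, y, w, hwν, ⟨hi, hx, hy, hi'.symm⟩, ⟨hi, hmin, hpw ▸ hp₀, hstep.symm⟩, ?_, ?_, ?_⟩
  · rw [← hq₀.1]; exact Cosets.mk_le_mk hle₀
  · rw [← hp₀.1, hpw]; exact Cosets.mk_le_mk hxy
  · rw [proj_mk b hle, ← hx.1, Cosets.mk_eq_mk_iff, mul_smul, hwν]

end Projections

/-! ### The defining chain poset, its fibres and its bonds. -/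

section DefiningChainPoset

variable {ι M N : Type*} [Finite ι] [AddCommGroup M] [Module ℚ M] [AddCommGroup N] [Module ℚ N]
  {P : RootPairing ι ℚ M N} [P.IsRootSystem] [P.IsCrystallographic] [P.IsReduced] {b : P.Base}
  {m : ℕ} {lam : Fin m → M} {𝓘 : Finset (Finset (Fin m))} {τ : Cosets b (∑ i, lam i)}

local notation "𝔰" => RootPairing.weylGroup.ofIdx P
local notation "Stab" => MulAction.stabilizer P.weylGroup

theorem isDominantWeight_total (hlam : ∀ i, IsDominantWeight b (lam i)) :
    IsDominantWeight b (∑ i, lam i) := isDominantWeight_sum _ _ fun i _ => hlam i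

theorem isDominantWeight_wt (hlam : ∀ i, IsDominantWeight b (lam i)) (I : 𝓘) :
    IsDominantWeight b (wt lam I) := isDominantWeight_sum _ _ fun i _ => hlam i

theorem stabilizer_total_le_wt (hlam : ∀ i, IsDominantWeight b (lam i)) (I : 𝓘) :
    Stab (∑ i, lam i) ≤ Stab (wt lam I) := by
  intro w hw
  change w • ∑ i ∈ under I, lam i = ∑ i ∈ under I, lam i
  rw [Finset.smul_sum]
  exact Finset.sum_congr rfl fun i _ =>
    stabilizer_sum_le (fun i _ => hlam i) (Finset.mem_univ i) hw

variable (hlam : ∀ i, IsDominantWeight b (lam i))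
include hlam

theorem exists_isGreatest_lifts (x : Lower b lam 𝓘) : ∃ θ, IsGreatest (lifts x) θ := by
  have hst := stabilizer_total_le_wt hlam x.1
  obtain ⟨v, hv, hmax⟩ := exists_isMaxRep (isDominantWeight_wt hlam x.1) x.2
  refine ⟨Cosets.mk b _ v, ?_, ?_⟩
  · change proj _ _ = _
    rw [proj_mk b hst, hv]
  · intro σ hσ
    obtain ⟨u, rfl⟩ := σ.exists_rep
    change proj _ _ = _ at hσ
    rw [proj_mk b hst] at hσ
    exact Cosets.mk_le_mk (hmax u hσ)

theorem exists_isLeast_lifts (x : Lower b lam 𝓘) : ∃ θ, IsLeast (lifts x) θ := by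
  have hst := stabilizer_total_le_wt hlam x.1
  obtain ⟨v, hv, hmin⟩ := exists_isMinRep (isDominantWeight_wt hlam x.1) x.2
  refine ⟨Cosets.mk b _ v, ?_, ?_⟩
  · change proj _ _ = _
    rw [proj_mk b hst, hv]
  · intro σ hσ
    obtain ⟨u, rfl⟩ := σ.exists_rep
    change proj _ _ = _ at hσ
    rw [proj_mk b hst] at hσ
    exact Cosets.mk_le_mk (hmin u hσ)

theorem lowerRel_of_lifts {x y : Lower b lam 𝓘} (hx : x ∈ lowerSet 𝓘 τ) (hy : y ∈ lowerSet 𝓘 τ)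
    (hyx : y.1 ≤ x.1) {θ φ : Cosets b (∑ i, lam i)} (hθ : θ ∈ lifts x) (hφ : φ ∈ lifts y)
    (h : φ ≤ θ) : lowerRel τ x y := by
  obtain ⟨θ', hθ'⟩ := exists_isGreatest_lifts hlam x
  obtain ⟨φ', hφ'⟩ := exists_isLeast_lifts hlam y
  have hQ := isDominantWeight_total hlam
  exact ⟨hx, hy, hyx, θ', φ', hθ', hφ',
    Cosets.le_trans hQ (hφ'.2 hφ) (Cosets.le_trans hQ h (hθ'.2 hθ))⟩

omit hlam in
theorem lowerGE.le_fst {x y : Lower b lam 𝓘} (h : lowerGE τ x y) : y.1 ≤ x.1 := by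
  induction h with
  | single h => exact h.2.2.1
  | tail _ h ih => exact h.2.2.1.trans ih

omit hlam in
theorem lowerGE.mem_left {x y : Lower b lam 𝓘} (h : lowerGE τ x y) : x ∈ lowerSet 𝓘 τ := by
  induction h with
  | single h => exact h.1
  | tail _ _ ih => exact ih

/-- Indices decrease along the transitive hull, so a path whose ends have the same index never
leaves the fibre; there each step projects to a Bruhat relation. -/
theorem lowerGE.exists_of_le {x y : Lower b lam 𝓘} (h : lowerGE τ x y) (hxy : x.1 ≤ y.1) :
    ∃ (I : 𝓘) (θ φ : Cosets b (wt lam I)), x = ⟨I, θ⟩ ∧ y = ⟨I, φ⟩ ∧ φ ≤ θ := by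
  have key : ∀ {x y : Lower b lam 𝓘}, lowerRel τ x y → x.1 ≤ y.1 →
      ∃ (I : 𝓘) (θ φ : Cosets b (wt lam I)), x = ⟨I, θ⟩ ∧ y = ⟨I, φ⟩ ∧ φ ≤ θ := by
    rintro ⟨I, θ⟩ ⟨J, φ⟩ ⟨-, -, hJI, θ', φ', hθ, hφ, hle⟩ hIJ
    obtain rfl : I = J := le_antisymm hIJ hJI
    refine ⟨I, θ, φ, rfl, rfl, ?_⟩
    have e₁ : proj (wt lam I) θ' = θ := hθ.1
    have e₂ : proj (wt lam I) φ' = φ := hφ.1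
    rw [← e₁, ← e₂]
    exact proj_mono (stabilizer_total_le_wt hlam I) hle
  induction h with
  | single h => exact key h hxy
  | @tail y z hxy' hyz ih =>
    obtain ⟨I, θ, φ, rfl, rfl, hle⟩ := ih (hxy.trans hyz.2.2.1)
    obtain ⟨J, φ', ψ, e, rfl, hle'⟩ := key hyz ((lowerGE.le_fst hxy').trans hxy)
    cases e
    exact ⟨_, θ, ψ, rfl, rfl, Cosets.le_trans (isDominantWeight_wt hlam _) hle' hle⟩

theorem lowerGE_fiber_iff {I : 𝓘} {θ φ : Cosets b (wt lam I)}
    (hθ : (⟨I, θ⟩ : Lower b lam 𝓘) ∈ lowerSet 𝓘 τ) :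
    lowerGE τ ⟨I, θ⟩ ⟨I, φ⟩ ↔ φ ≤ θ := by
  constructor
  · intro h
    obtain ⟨J, θ', φ', e, e', hle⟩ := h.exists_of_le hlam le_rfl
    cases e
    cases e'
    exact hle
  · rintro ⟨u, v, rfl, rfl, h⟩
    have hst := stabilizer_total_le_wt hlam I
    refine Relation.TransGen.single (lowerRel_of_lifts hlam hθ ?_ le_rfl
      (θ := Cosets.mk b _ v) (φ := Cosets.mk b _ u) ?_ ?_ (Cosets.mk_le_mk h))
    · exact Cosets.le_trans (isDominantWeight_wt hlam I) (Cosets.mk_le_mk h) hθ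
    · exact proj_mk b hst v
    · exact proj_mk b hst u

theorem lowerGE_refl {x : Lower b lam 𝓘} (hx : x ∈ lowerSet 𝓘 τ) : lowerGE τ x x := by
  obtain ⟨I, θ⟩ := x
  exact (lowerGE_fiber_iff hlam hx).2 (Cosets.le_refl θ)

theorem lowerGE_antisymm {x y : Lower b lam 𝓘} (h : lowerGE τ x y) (h' : lowerGE τ y x) :
    x = y := by
  obtain ⟨I, θ, φ, rfl, rfl, hle⟩ := h.exists_of_le hlam h'.le_fst
  rw [lowerGE_fiber_iff hlam h'.mem_left] at h'
  rw [Cosets.le_antisymm (isDominantWeight_wt hlam I) h' hle]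

/-- The defining chain poset of a `τ`-standard index poset, as a type with a partial order. -/
def DCP (_ : ∀ i, IsDominantWeight b (lam i)) (_ : IsTauStandard 𝓘 τ) : Type _ := dcp 𝓘 τ

variable {hlam} {hτ : IsTauStandard 𝓘 τ}

/-- The underlying element. -/
def DCP.val (p : DCP hlam hτ) : dcp 𝓘 τ := p

/-- The index of an element of the defining chain poset. -/
def DCP.idx (p : DCP hlam hτ) : 𝓘 := p.val.1.2

/-- The coset of an element of the defining chain poset. -/
def DCP.coset (p : DCP hlam hτ) : Cosets b (∑ i, lam i) := p.val.1.1

/-- The isomorphism from the defining chain poset onto the poset of cosets. -/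
noncomputable def DCP.rho (p : DCP hlam hτ) : Lower b lam 𝓘 := LSFan.rho p.val

theorem DCP.rho_eq {p : DCP hlam hτ} {I : 𝓘} (h : p.idx = I) :
    p.rho = ⟨I, proj (wt lam I) p.coset⟩ := by
  subst h; rfl

theorem DCP.rho_mem (p : DCP hlam hτ) : p.rho ∈ lowerSet 𝓘 τ := hτ.1.1 (Set.mem_univ _)

theorem DCP.rho_injective : Function.Injective (DCP.rho (hlam := hlam) (hτ := hτ)) :=
  fun _ _ h => hτ.1.2.1 (Set.mem_univ _) (Set.mem_univ _) h

theorem DCP.exists_rho_eq {x : Lower b lam 𝓘} (hx : x ∈ lowerSet 𝓘 τ) :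
    ∃ p : DCP hlam hτ, p.rho = x := by
  obtain ⟨p, -, hp⟩ := hτ.1.2.2 hx
  exact ⟨p, hp⟩

theorem DCP.coset_le (p : DCP hlam hτ) : p.coset ≤ τ := by
  obtain ⟨C, ⟨Θ, -, hC⟩, hpC⟩ := p.val.2
  exact hC.1 hpC

/-- Lying in a common defining chain is not visibly transitive; the order axioms are transported
from the lower poset through `ρ`. -/
instance : PartialOrder (DCP hlam hτ) where
  le p q := dcpGE q.val p.val
  le_refl p := (hτ.2 _ _).2 (lowerGE_refl hlam p.rho_mem)
  le_trans p q r hpq hqr := (hτ.2 _ _).2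
    (Relation.TransGen.trans ((hτ.2 _ _).1 hqr) ((hτ.2 _ _).1 hpq))
  le_antisymm p q hpq hqp := DCP.rho_injective
    (lowerGE_antisymm hlam ((hτ.2 _ _).1 hqp) ((hτ.2 _ _).1 hpq))

instance : Finite (DCP hlam hτ) :=
  inferInstanceAs (Finite (dcp 𝓘 τ))

theorem DCP.le_iff {p q : DCP hlam hτ} : q ≤ p ↔ lowerGE τ p.rho q.rho := hτ.2 _ _

theorem DCP.coset_mono {p q : DCP hlam hτ} (h : q ≤ p) : q.coset ≤ p.coset := h.1.1

theorem DCP.idx_mono {p q : DCP hlam hτ} (h : q ≤ p) : q.idx ≤ p.idx := h.1.2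

theorem DCP.le_iff_of_idx {p q : DCP hlam hτ} {I : 𝓘} (hp : p.idx = I) (hq : q.idx = I) :
    q ≤ p ↔ proj (wt lam I) q.coset ≤ proj (wt lam I) p.coset := by
  have := p.rho_mem
  rw [DCP.rho_eq hp] at this
  rw [DCP.le_iff, DCP.rho_eq hp, DCP.rho_eq hq, lowerGE_fiber_iff hlam this]

theorem DCP.eq_iff_of_idx {p q : DCP hlam hτ} {I : 𝓘} (hp : p.idx = I) (hq : q.idx = I) :
    q = p ↔ proj (wt lam I) q.coset = proj (wt lam I) p.coset := by
  rw [← DCP.rho_injective.eq_iff, DCP.rho_eq hp, DCP.rho_eq hq, sigma_mk_injective.eq_iff]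

theorem DCP.lt_iff_of_idx {p q : DCP hlam hτ} {I : 𝓘} (hp : p.idx = I) (hq : q.idx = I) :
    q < p ↔ proj (wt lam I) q.coset < proj (wt lam I) p.coset := by
  rw [lt_iff_le_and_ne, DCP.le_iff_of_idx hp hq, ne_eq, DCP.eq_iff_of_idx hp hq]
  rfl

theorem DCP.exists_of_le_proj {p : DCP hlam hτ} {I : 𝓘}
    {κ : Cosets b (wt lam I)} (hκ : κ ≤ proj (wt lam I) p.coset) :
    ∃ r : DCP hlam hτ, r.idx = I ∧ proj (wt lam I) r.coset = κ := by
  have hmem : (⟨I, κ⟩ : Lower b lam 𝓘) ∈ lowerSet 𝓘 τ :=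
    Cosets.le_trans (isDominantWeight_wt hlam I) hκ
      (proj_mono (stabilizer_total_le_wt hlam I) p.coset_le)
  obtain ⟨r, hr⟩ := DCP.exists_rho_eq (hlam := hlam) (hτ := hτ) hmem
  have hrI : r.idx = I := congrArg Sigma.fst hr
  rw [DCP.rho_eq hrI] at hr
  exact ⟨r, hrI, eq_of_heq (Sigma.mk.inj hr).2⟩

/-- Fibres of the index map are convex, and every coset below a projected one occurs in the fibre.
-/
theorem DCP.covBy_iff_of_idx {p q : DCP hlam hτ} {I : 𝓘} (hp : p.idx = I) (hq : q.idx = I) :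
    q ⋖ p ↔ proj (wt lam I) q.coset ⋖ proj (wt lam I) p.coset := by
  constructor
  · rintro ⟨hlt, hcov⟩
    refine ⟨(DCP.lt_iff_of_idx hp hq).1 hlt, fun κ h₁ h₂ => ?_⟩
    obtain ⟨r, hr, rfl⟩ := DCP.exists_of_le_proj h₂.1
    exact hcov ((DCP.lt_iff_of_idx hr hq).2 h₁) ((DCP.lt_iff_of_idx hp hr).2 h₂)
  · rintro ⟨hlt, hcov⟩
    refine ⟨(DCP.lt_iff_of_idx hp hq).2 hlt, fun r h₁ h₂ => ?_⟩
    have hr : r.idx = I := le_antisymm (hp ▸ DCP.idx_mono h₂.le) (hq ▸ DCP.idx_mono h₁.le)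
    exact hcov ((DCP.lt_iff_of_idx hr hq).1 h₁) ((DCP.lt_iff_of_idx hp hr).1 h₂)

/-- The lift of a coset in the defining chain poset is as large as possible below the lift of a
coset that covers it. -/
theorem DCP.coset_eq_of_covBy {p q : DCP hlam hτ} {I : 𝓘} (hp : p.idx = I) (hq : q.idx = I)
    (hcov : q ⋖ p) {φ : Cosets b (∑ i, lam i)} (hqφ : q.coset ≤ φ) (hφp : φ ≤ p.coset)
    (hφ : proj (wt lam I) φ = proj (wt lam I) q.coset) : φ = q.coset := by
  classical
  have hst := stabilizer_total_le_wt hlam I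
  have hQ := isDominantWeight_total hlam
  have hcov' := (DCP.covBy_iff_of_idx hp hq).1 hcov
  obtain ⟨-, C, ⟨Θ, hΘ, hC⟩, hpC, hqC⟩ := hcov.1.le
  have ep : p.val.1 = (p.coset, I) := by rw [← hp]; rfl
  have eq : q.val.1 = (q.coset, I) := by rw [← hq]; rfl
  change p.val.1 ∈ C at hpC
  change q.val.1 ∈ C at hqC
  rw [ep] at hpC
  rw [eq] at hqC
  -- In a defining chain through `p` and `q` the lift `q.coset` is replaced by `φ`, which leaves the
  -- projected chain unchanged.
  let f : Upper b lam 𝓘 → Upper b lam 𝓘 := fun z => if z = (q.coset, I) then (φ, I) else z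
  have hfproj : ∀ z, projI (f z) = projI z := by
    intro z
    by_cases hz : z = (q.coset, I)
    · simp only [f, if_pos hz]
      rw [hz]
      simp only [projI, hφ]
    · simp only [f, if_neg hz]
  have hcomp : ∀ z ∈ C, z ≠ (q.coset, I) → z ≤ (φ, I) ∨ (φ, I) ≤ z := by
    intro z hz hne
    have below : (p.coset, I) ≤ z → (φ, I) ≤ z := fun h =>
      ⟨Cosets.le_trans hQ hφp h.1, h.2⟩
    rcases hC.2.1 hz hqC hne with h | h
    · exact Or.inl ⟨Cosets.le_trans hQ h.1 hqφ, h.2⟩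
    by_cases hzp : z = (p.coset, I)
    · exact Or.inr (below (hzp ▸ ⟨Cosets.le_refl _, le_rfl⟩))
    rcases hC.2.1 hz hpC hzp with h' | h'
    swap
    · exact Or.inr (below h')
    obtain ⟨ζ, J⟩ := z
    obtain rfl : J = I := le_antisymm h'.2 h.2
    -- An element between `q` and `p` would project to one of the two ends, but the defining chain
    -- is mapped injectively.
    rcases Cosets.eq_or_eq_of_covBy (isDominantWeight_wt hlam J) hcov' (proj_mono hst h.1)
      (proj_mono hst h'.1) with e | e
    · exact absurd (hC.2.2.2.1 hz hqC (by simp only [projI, e])) hne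
    · exact absurd (hC.2.2.2.1 hz hpC (by simp only [projI, e])) hzp
  have hC' : IsDefiningChain τ (f '' C) Θ := by
    refine ⟨?_, ?_, ?_, ?_, ?_⟩
    · rintro _ ⟨z, hz, rfl⟩
      by_cases hzq : z = (q.coset, I)
      · simp only [f, if_pos hzq]
        exact Cosets.le_trans hQ hφp p.coset_le
      · simp only [f, if_neg hzq]
        exact hC.1 hz
    · rintro _ ⟨z, hz, rfl⟩ _ ⟨z', hz', rfl⟩ hne
      by_cases hzq : z = (q.coset, I) <;> by_cases hzq' : z' = (q.coset, I)
      · exact absurd (by rw [hzq, hzq']) hne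
      · simp only [f, if_pos hzq, if_neg hzq']
        exact (hcomp z' hz' hzq').symm
      · simp only [f, if_neg hzq, if_pos hzq']
        exact hcomp z hz hzq
      · simp only [f, if_neg hzq, if_neg hzq']
        exact hC.2.1 hz hz' fun h => hne (by rw [h])
    · rintro _ ⟨z, hz, rfl⟩
      rw [hfproj]
      exact hC.2.2.1 hz
    · rintro _ ⟨z, hz, rfl⟩ _ ⟨z', hz', rfl⟩ h
      rw [hfproj, hfproj] at h
      rw [hC.2.2.2.1 hz hz' h]
    · intro x hx
      obtain ⟨z, hz, rfl⟩ := hC.2.2.2.2 hx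
      exact ⟨f z, ⟨z, hz, rfl⟩, hfproj z⟩
  have hmem : (φ, I) ∈ dcp 𝓘 τ :=
    ⟨f '' C, ⟨Θ, hΘ, hC'⟩, (q.coset, I), hqC, by simp only [f, if_pos]⟩
  -- The new lift lies in the defining chain poset with the same image under `ρ` as `q`, so
  -- injectivity of `ρ` identifies them.
  let q' : DCP hlam hτ := ⟨(φ, I), hmem⟩
  have : q' = q := (DCP.eq_iff_of_idx (I := I) hq rfl).2 hφ
  exact congrArg DCP.coset this

theorem DCP.exists_reflStep {p q : DCP hlam hτ} {I : 𝓘} (hp : p.idx = I) (hq : q.idx = I)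
    (hcov : q ⋖ p) :
    ∃ (i : ι) (u v w : P.weylGroup), w • wt lam I = wt lam I ∧
      IsReflStep (proj (wt lam I) p.coset) (proj (wt lam I) q.coset) i u v ∧
      IsReflStep p.coset q.coset i (u * w) (v * w) := by
  obtain ⟨i, u, v, w, h₁, h₂, h₃, h₄, h₅, h₆⟩ := exists_largest_lift
    (isDominantWeight_total hlam) (isDominantWeight_wt hlam I) (stabilizer_total_le_wt hlam I)
    (DCP.coset_mono hcov.le) ((DCP.covBy_iff_of_idx hp hq).1 hcov)
  rw [DCP.coset_eq_of_covBy hp hq hcov h₄ h₅ h₆] at h₃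
  exact ⟨i, u, v, w, h₁, h₂, h₃⟩

/-- The product of `t` with the bond of `p ≻ q` is an integer. -/
def DCP.Adm (t : ℚ) (p q : DCP hlam hτ) : Prop :=
  ∃ n, IsBond p.val q.val n ∧ ∃ k : ℤ, n * t = k

theorem isBond_iff_of_idx_ne {p q : DCP hlam hτ} (h : p.idx ≠ q.idx) {n : ℚ} :
    IsBond p.val q.val n ↔ n = 1 :=
  ⟨fun h' => h'.elim (fun h' => absurd h'.1 h) fun h' => h'.2, fun h' => Or.inr ⟨h, h'⟩⟩

theorem isBond_integral {p q : DCP hlam hτ} {n : ℚ}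
    (h : IsBond p.val q.val n) : ∃ k : ℤ, n = k := by
  rcases h with ⟨-, i, u, v, -, rfl⟩ | ⟨-, rfl⟩
  · obtain ⟨k, hk⟩ := (isDominantWeight_wt hlam p.val.1.2).pairing_integral u i
    exact ⟨|k|, by rw [hk]; push_cast; rfl⟩
  · exact ⟨1, by simp⟩

theorem DCP.adm_int {p q : DCP hlam hτ} (h : q ⋖ p) (k : ℤ) : DCP.Adm k p q := by
  have : ∃ n, IsBond p.val q.val n := by
    by_cases hidx : p.idx = q.idx
    · obtain ⟨i, u, v, w, -, -, hs⟩ := DCP.exists_reflStep hidx rfl h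
      exact ⟨_, Or.inl ⟨hidx, i, _, _, hs, rfl⟩⟩
    · exact ⟨1, (isBond_iff_of_idx_ne hidx).2 rfl⟩
  obtain ⟨n, hn⟩ := this
  obtain ⟨k', rfl⟩ := isBond_integral hn
  exact ⟨_, hn, k' * k, by push_cast; rfl⟩

theorem DCP.Adm.add_int {t : ℚ} {p q : DCP hlam hτ} (h : DCP.Adm t p q) (k : ℤ) :
    DCP.Adm (t + k) p q := by
  obtain ⟨n, hn, k', hk'⟩ := h
  obtain ⟨n', rfl⟩ := isBond_integral hn
  exact ⟨_, hn, k' + n' * k, by rw [mul_add, hk']; push_cast; rfl⟩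

theorem DCP.Adm.integral {t : ℚ} {p q : DCP hlam hτ} (h : DCP.Adm t p q)
    (hidx : p.idx ≠ q.idx) : ∃ k : ℤ, t = k := by
  obtain ⟨n, hn, k, hk⟩ := h
  rw [isBond_iff_of_idx_ne hidx] at hn
  exact ⟨k, by rw [← hk, hn, one_mul]⟩

/-- The same positive root serves upstairs and downstairs, and the minimal representatives differ by
a right factor `w` fixing `λ_I`, so the pairings agree up to sign. -/
theorem DCP.adm_iff_isChainStep {t : ℚ} {p q : DCP hlam hτ} {I : 𝓘} (hp : p.idx = I)
    (hq : q.idx = I) (h : q ⋖ p) :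
    DCP.Adm t p q ↔ IsChainStep t (proj (wt lam I) p.coset) (proj (wt lam I) q.coset) := by
  obtain ⟨i, u, v, w, hw, ⟨hi, hu, hv, huv⟩, ⟨hi', hu', hv', huv'⟩⟩ :=
    DCP.exists_reflStep hp hq h
  have hcov := (DCP.covBy_iff_of_idx hp hq).1 h
  have hpq : p.idx = q.idx := hp.trans hq.symm
  have hpI : p.val.1.2 = I := hp
  constructor
  · rintro ⟨n, hn, hk⟩
    rcases hn with ⟨-, j, x, y, ⟨hj, hx, hy, hxy⟩, rfl⟩ | ⟨hne, -⟩
    swap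
    · exact absurd hpq hne
    obtain rfl : x = u * w := hx.unique hu'
    obtain rfl : y = v * w := hy.unique hv'
    obtain rfl : j = i := ofIdx_injOn_isPos hj hi (mul_right_cancel (hxy.trans huv'.symm))
    rw [hpI, mul_smul, hw, exists_int_abs_mul_iff] at hk
    refine ⟨hcov, j, u, v, ⟨hi, hu, hv, huv⟩, ?_⟩
    rwa [← huv, pairing_ofIdx_mul_smul]
  · rintro ⟨-, j, x, y, ⟨hj, hx, hy, hxy⟩, hk⟩
    obtain rfl : x = u := hx.unique hu
    obtain rfl : y = v := hy.unique hv
    obtain rfl : j = i := ofIdx_injOn_isPos hj hi (mul_right_cancel (hxy.trans huv.symm))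
    refine ⟨_, Or.inl ⟨hpq, j, _, _, ⟨hi', hu', hv', huv'⟩, rfl⟩, ?_⟩
    rw [hpI, mul_smul, hw, exists_int_abs_mul_iff]
    rwa [← huv, pairing_ofIdx_mul_smul] at hk

end DefiningChainPoset

theorem pairwise_of_forall₂ {α β : Type*} {R : α → α → Prop} {S : α → β → Prop}
    {Q : β → β → Prop} {L : List α} {E : List β} (hF : List.Forall₂ S L E) (hL : L.Pairwise R)
    (h : ∀ a ∈ L, ∀ a' ∈ L, ∀ x ∈ E, ∀ x' ∈ E, S a x → S a' x' → R a a' → Q x x') :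
    E.Pairwise Q := by
  induction hF with
  | nil => exact List.Pairwise.nil
  | cons hax hF ih =>
    rw [List.pairwise_cons] at hL ⊢
    refine ⟨fun x' hx' => ?_, ih hL.2 fun a ha a' ha' x hx x' hx' =>
      h a (List.mem_cons_of_mem _ ha) a' (List.mem_cons_of_mem _ ha') x
        (List.mem_cons_of_mem _ hx) x' (List.mem_cons_of_mem _ hx')⟩
    obtain ⟨i, hi, rfl⟩ := List.mem_iff_getElem.1 hx'
    have hi' : i < _ := hF.length_eq ▸ hi
    exact h _ List.mem_cons_self _ (List.mem_cons_of_mem _ (List.getElem_mem hi'))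
      _ List.mem_cons_self _ (List.mem_cons_of_mem _ hx') hax (hF.get (i := i) hi' hi)
      (hL.1 _ (List.getElem_mem hi'))

theorem isConsecutive_iff_covBy {X : Type*} [PartialOrder X] {C : Set X}
    (hC : IsMaxChain (· ≤ ·) C) {p q : X} :
    (p ∈ C ∧ q ∈ C ∧ q ≤ p ∧ p ≠ q ∧ ∀ z ∈ C, z ≤ p → q ≤ z → z = p ∨ z = q) ↔
      p ∈ C ∧ q ∈ C ∧ q ⋖ p := by
  constructor
  · rintro ⟨hp, hq, hle, hne, h⟩
    refine ⟨hp, hq, lt_of_le_of_ne hle hne.symm, fun z h₁ h₂ => ?_⟩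
    have hz : z ∈ C := by
      refine mem_of_isMaxChain hC fun c hc => ?_
      rcases hC.1.total hc hp with hcp | hcp
      · rcases hC.1.total hc hq with hcq | hcq
        · exact Or.inr (hcq.trans h₁.le)
        · rcases h c hc hcp hcq with rfl | rfl
          exacts [Or.inl h₂.le, Or.inr h₁.le]
      · exact Or.inl (h₂.le.trans hcp)
    rcases h z hz h₂.le h₁.le with rfl | rfl
    exacts [h₂.false, h₁.false]
  · rintro ⟨hp, hq, hcov⟩
    refine ⟨hp, hq, hcov.le, hcov.ne', fun z _ h₁ h₂ => ?_⟩
    exact (hcov.eq_or_eq h₂ h₁).symm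

/-! ### Translation between LS-tableaux and abstract columns. -/

section Tableaux

variable {ι M N : Type*} [Finite ι] [AddCommGroup M] [Module ℚ M] [AddCommGroup N] [Module ℚ N]
  {P : RootPairing ι ℚ M N} [P.IsRootSystem] [P.IsCrystallographic] [P.IsReduced] {b : P.Base}
  {m : ℕ} {lam : Fin m → M} {𝓘 : Finset (Finset (Fin m))} {τ : Cosets b (∑ i, lam i)}

local notation "Stab" => MulAction.stabilizer P.weylGroup

/-- The steps of a column, as elements of the disjoint union of the `W/W_{P_I}`. -/
def rawColumn (c : Σ I : 𝓘, LSPath b (wt lam I)) : List (Lower b lam 𝓘 × ℚ) :=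
  c.2.steps.map (Prod.map (Sigma.mk c.1) id)

/-- The steps of all columns. -/
def rawColumns (T : Columns b lam 𝓘) : List (List (Lower b lam 𝓘 × ℚ)) := T.map rawColumn

theorem LSPath.steps_ne_nil {ν : M} (π : LSPath b ν) : π.steps ≠ [] := by
  intro h
  have := π.last
  simp [h] at this

theorem exists_mem_rawColumn (c : Σ I : 𝓘, LSPath b (wt lam I)) :
    ∃ x ∈ rawColumn c, x.1.1 = c.1 := by
  obtain ⟨x, hx⟩ := List.exists_mem_of_ne_nil _ c.2.steps_ne_nil
  exact ⟨_, List.mem_map_of_mem hx, rfl⟩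

theorem fst_of_mem_rawColumn {c : Σ I : 𝓘, LSPath b (wt lam I)} {x : Lower b lam 𝓘 × ℚ}
    (hx : x ∈ rawColumn c) : x.1.1 = c.1 := by
  obtain ⟨y, -, rfl⟩ := List.mem_map.1 hx
  rfl

/-- An LS-path has at least one step, so its index can be read off from the entries. -/
theorem rawColumn_injective :
    Function.Injective (rawColumn (b := b) (lam := lam) (𝓘 := 𝓘)) := by
  rintro ⟨I, π⟩ ⟨J, π'⟩ h
  obtain rfl : I = J := by
    obtain ⟨x, hx, e⟩ := exists_mem_rawColumn ⟨I, π⟩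
    rw [h] at hx
    exact e.symm.trans (fst_of_mem_rawColumn hx)
  have hinj : Function.Injective
      (Prod.map (Sigma.mk (β := fun I : 𝓘 => Cosets b (wt lam I)) I) (id : ℚ → ℚ)) :=
    Function.Injective.prodMap sigma_mk_injective Function.injective_id
  exact congrArg (Sigma.mk I) (LSPath.ext (List.map_injective_iff.2 hinj h))

theorem rawColumns_injective :
    Function.Injective (rawColumns (b := b) (lam := lam) (𝓘 := 𝓘)) :=
  List.map_injective_iff.2 rawColumn_injective

theorem theta_eq (T : Columns b lam 𝓘) :
    theta T = ((rawColumns T).map (increments 0)).sum := by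
  unfold theta rawColumns
  rw [List.map_map]
  congr 1
  refine List.map_congr_left fun c _ => ?_
  exact increments_mapDomain _ _ _

theorem entries_eq (T : Columns b lam 𝓘) :
    T.tableau.entries =
      ((rawColumns T).flatten.map Prod.fst).map fun x => ⟨wt lam x.1, x.2⟩ := by
  induction T with
  | nil => rfl
  | cons c T ih =>
    have e : Columns.tableau (c :: T) = ⟨wt lam c.1, c.2⟩ :: Columns.tableau T := rfl
    have e' : rawColumns (c :: T) = rawColumn c :: rawColumns T := rfl
    rw [e, e', List.flatten_cons, List.map_append, List.map_append, ← ih]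
    simp only [LSTableau.entries, List.flatMap_cons, LSPath.dirs, rawColumn, List.map_map]
    rfl

theorem Columns.weight_eq (T : Columns b lam 𝓘) :
    T.tableau.weight = (T.map fun c => wt lam c.1).sum := by
  simp [LSTableau.weight, Columns.tableau, Function.comp_def]

section Weights

variable (hlam : ∀ i, IsDominantWeight b (lam i))
include hlam

theorem isDominantWeight_weight (T : Columns b lam 𝓘) :
    IsDominantWeight b T.tableau.weight := by
  rw [Columns.weight_eq]
  refine isDominantWeight_list_sum fun x hx => ?_
  obtain ⟨c, -, rfl⟩ := List.mem_map.1 hx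
  exact isDominantWeight_wt hlam c.1

theorem stabilizer_weight_le {T : Columns b lam 𝓘} {c : Σ I : 𝓘, LSPath b (wt lam I)}
    (hc : c ∈ T) : Stab T.tableau.weight ≤ Stab (wt lam c.1) := by
  rw [Columns.weight_eq]
  refine stabilizer_list_sum_le (b := b) (fun x hx => ?_) (List.mem_map.2 ⟨c, hc, rfl⟩)
  obtain ⟨c, -, rfl⟩ := List.mem_map.1 hx
  exact isDominantWeight_wt hlam c.1

theorem stabilizer_total_le_weight (T : Columns b lam 𝓘) :
    Stab (∑ i, lam i) ≤ Stab T.tableau.weight := by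
  rw [Columns.weight_eq]
  intro w hw
  rw [MulAction.mem_stabilizer_iff, List.smul_sum, List.map_map]
  congr 1
  exact List.map_congr_left fun c _ => stabilizer_total_le_wt hlam c.1 hw

theorem stabilizer_weight_le_of_mem {T : Columns b lam 𝓘} {x : Lower b lam 𝓘}
    (hx : x ∈ (rawColumns T).flatten.map Prod.fst) :
    Stab T.tableau.weight ≤ Stab (wt lam x.1) := by
  obtain ⟨y, hy, rfl⟩ := List.mem_map.1 hx
  obtain ⟨l, hl, hyl⟩ := List.mem_flatten.1 hy
  obtain ⟨c, hc, rfl⟩ := List.mem_map.1 hl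
  rw [fst_of_mem_rawColumn hyl]
  exact stabilizer_weight_le hlam hc

omit hlam in
theorem pairwise_fst_rawColumns {T : Columns b lam 𝓘} (hT : T.IsChain fun c c' => c'.1 ≤ c.1) :
    ((rawColumns T).flatten.map Prod.fst).Pairwise fun x y => y.1 ≤ x.1 := by
  have : Trans (fun c c' : Σ I : 𝓘, LSPath b (wt lam I) => c'.1 ≤ c.1)
    (fun c c' : Σ I : 𝓘, LSPath b (wt lam I) => c'.1 ≤ c.1)
    (fun c c' : Σ I : 𝓘, LSPath b (wt lam I) => c'.1 ≤ c.1) := ⟨fun h h' => h'.trans h⟩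
  have hTp := hT.pairwise
  rw [List.pairwise_map, List.pairwise_flatten]
  constructor
  · intro l hl
    obtain ⟨c, -, rfl⟩ := List.mem_map.1 hl
    refine List.pairwise_of_forall_mem_list ?_
    intro x hx y hy
    rw [fst_of_mem_rawColumn hx, fst_of_mem_rawColumn hy]
  · rw [rawColumns, List.pairwise_map]
    refine hTp.imp fun h x hx y hy => ?_
    rwa [fst_of_mem_rawColumn hx, fst_of_mem_rawColumn hy]

theorem mem_lowerSet_of_proj {μ : M} (hst : Stab (∑ i, lam i) ≤ Stab μ) {x : Lower b lam 𝓘}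
    (hx : Stab μ ≤ Stab (wt lam x.1)) {σ : Cosets b μ} (hσ : σ ≤ proj μ τ)
    (h : proj (wt lam x.1) σ = x.2) : x ∈ lowerSet 𝓘 τ := by
  change x.2 ≤ _
  rw [← h, ← proj_proj hst hx τ]
  exact proj_mono hx hσ

/-- Bruhat-comparable representatives in `W` of the two cosets modulo `W_μ` also give comparable
lifts in `W/W_Q`, although these need not lie below `τ`. -/
theorem lowerRel_of_proj {μ : M} (hst : Stab (∑ i, lam i) ≤ Stab μ) {x y : Lower b lam 𝓘}
    (hx : Stab μ ≤ Stab (wt lam x.1)) (hy : Stab μ ≤ Stab (wt lam y.1))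
    {σ σ' : Cosets b μ} (hσ : σ ≤ proj μ τ) (hσ' : σ' ≤ proj μ τ)
    (h : proj (wt lam x.1) σ = x.2) (h' : proj (wt lam y.1) σ' = y.2) (hle : σ' ≤ σ)
    (hyx : y.1 ≤ x.1) : lowerRel τ x y := by
  have hxm := mem_lowerSet_of_proj hlam hst hx hσ h
  have hym := mem_lowerSet_of_proj hlam hst hy hσ' h'
  obtain ⟨u', u, rfl, rfl, huu⟩ := hle
  rw [proj_mk b hx] at h
  rw [proj_mk b hy] at h'
  exact lowerRel_of_lifts hlam hxm hym hyx (θ := Cosets.mk b _ u) (φ := Cosets.mk b _ u')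
    ((proj_mk b (stabilizer_total_le_wt hlam _) u).trans h)
    ((proj_mk b (stabilizer_total_le_wt hlam _) u').trans h') (Cosets.mk_le_mk huu)

theorem lowerRel_of_isStandard {T : Columns b lam 𝓘}
    (hT : T.IsChain fun c c' => c'.1 ≤ c.1) (hstd : T.tableau.IsStandard (proj _ τ)) :
    (∀ x ∈ (rawColumns T).flatten.map Prod.fst, x ∈ lowerSet 𝓘 τ) ∧
      ((rawColumns T).flatten.map Prod.fst).Pairwise (lowerRel τ) := by
  obtain ⟨L, hL, hLτ, hF⟩ := hstd
  have hμ := isDominantWeight_weight hlam T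
  have hst := stabilizer_total_le_weight hlam T
  rw [entries_eq, List.forall₂_map_right_iff] at hF
  constructor
  · intro x hx
    have hx' := hx
    obtain ⟨i, hi, rfl⟩ := List.mem_iff_getElem.1 hx'
    have hi' : i < L.length := hF.length_eq ▸ hi
    exact mem_lowerSet_of_proj hlam hst (stabilizer_weight_le_of_mem hlam hx)
      (hLτ _ (List.getElem_mem hi')) (hF.get (i := i) hi' hi)
  have : Trans (fun σ σ' : Cosets b T.tableau.weight => σ' ≤ σ) (fun σ σ' => σ' ≤ σ)
      (fun σ σ' => σ' ≤ σ) := ⟨fun h h' => Cosets.le_trans hμ h' h⟩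
  have hrel : ((rawColumns T).flatten.map Prod.fst).Pairwise
      fun x y => y.1 ≤ x.1 → lowerRel τ x y :=
    pairwise_of_forall₂ hF hL.pairwise fun σ hσ σ' hσ' x hx y hy h h' hle hyx =>
      lowerRel_of_proj hlam hst (stabilizer_weight_le_of_mem hlam hx)
        (stabilizer_weight_le_of_mem hlam hy) (hLτ σ hσ) (hLτ σ' hσ') h h' hle hyx
  exact ((pairwise_fst_rawColumns hT).and hrel).imp fun h => h.2 h.1

end Weights

variable {hlam : ∀ i, IsDominantWeight b (lam i)} {hτ : IsTauStandard 𝓘 τ}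

/-- The chain is lifted step by step: each lower coset stays in the image of `ρ`, and coverings and
bond conditions correspond. -/
theorem DCP.exists_of_hasChain {t : ℚ} {I : 𝓘} {σ σ' : Cosets b (wt lam I)}
    (h : HasChain t σ σ') {p : DCP hlam hτ} (hp : p.rho = ⟨I, σ⟩) :
    ∃ q : DCP hlam hτ, q.rho = ⟨I, σ'⟩ ∧
      Relation.ReflTransGen (fun p q => q ⋖ p ∧ DCP.Adm t p q) p q := by
  induction h with
  | refl => exact ⟨p, hp, .refl⟩
  | @tail κ κ' _ hstep ih =>
    obtain ⟨q, hq, hpq⟩ := ih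
    have hqI : q.idx = I := congrArg Sigma.fst hq
    rw [DCP.rho_eq hqI] at hq
    have hκ : proj (wt lam I) q.coset = κ := eq_of_heq (Sigma.mk.inj hq).2
    obtain ⟨r, hrI, hr⟩ := DCP.exists_of_le_proj (p := q) (I := I) (κ := κ')
      (by rw [hκ]; exact hstep.1.1.1)
    have hcov : r ⋖ q := by
      rw [DCP.covBy_iff_of_idx hqI hrI, hκ, hr]
      exact hstep.1
    refine ⟨r, by rw [DCP.rho_eq hrI, hr], hpq.tail ⟨hcov, ?_⟩⟩
    rw [DCP.adm_iff_isChainStep hqI hrI hcov, hκ, hr]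
    exact hstep

theorem DCP.hasChain_of_reflTransGen {t : ℚ} {I : 𝓘} {p q : DCP hlam hτ} (hp : p.idx = I)
    (hq : q.idx = I) (h : Relation.ReflTransGen (fun p q => q ⋖ p ∧ DCP.Adm t p q) p q) :
    HasChain t (proj (wt lam I) p.coset) (proj (wt lam I) q.coset) := by
  have hle : ∀ {r : DCP hlam hτ},
      Relation.ReflTransGen (fun p q => q ⋖ p ∧ DCP.Adm t p q) r q → q ≤ r := by
    intro r hr
    induction hr using Relation.ReflTransGen.head_induction_on with
    | refl => exact le_rfl
    | head h _ ih => exact ih.trans h.1.le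
  induction h using Relation.ReflTransGen.head_induction_on with
  | refl => exact .refl
  | @head p r h hr ih =>
    have hrI : r.idx = I :=
      le_antisymm (hp ▸ DCP.idx_mono h.1.le) (hq ▸ DCP.idx_mono (hle hr))
    exact Relation.ReflTransGen.head ((DCP.adm_iff_isChainStep hp hrI h.1).1 h.2) (ih hrI)

/-- A `τ`-standard tableau lifts to an abstract tableau in the defining chain poset. -/
theorem exists_isColumns_of_isStandard {T : Columns b lam 𝓘}
    (hT : T.IsChain fun c c' => c'.1 ≤ c.1) (hstd : T.tableau.IsStandard (proj _ τ)) :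
    ∃ A : List (List (DCP hlam hτ × ℚ)), IsColumns DCP.Adm A ∧
      A.map (List.map (Prod.map DCP.rho id)) = rawColumns T := by
  obtain ⟨hmem, hrel⟩ := lowerRel_of_isStandard hlam hT hstd
  have hex : rawColumns T ∈ Set.range
      (List.map (List.map (Prod.map (DCP.rho (hlam := hlam) (hτ := hτ)) (id : ℚ → ℚ)))) := by
    rw [Set.range_list_map]
    intro l hl
    rw [Set.range_list_map]
    intro x hx
    obtain ⟨p, hp⟩ := DCP.exists_rho_eq (hlam := hlam) (hτ := hτ)
      (hmem x.1 (List.mem_map_of_mem (List.mem_flatten.2 ⟨l, hl, hx⟩)))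
    exact ⟨(p, x.2), Prod.ext hp rfl⟩
  obtain ⟨A, hA⟩ := hex
  refine ⟨A, ⟨fun l hl => ?_, ?_⟩, hA⟩
  · have hl' : l.map (Prod.map DCP.rho id) ∈ rawColumns T := hA ▸ List.mem_map_of_mem hl
    obtain ⟨c, -, hc⟩ := List.mem_map.1 hl'
    refine ⟨fun x hx => ?_, ?_, ?_⟩
    · have : Prod.map DCP.rho id x ∈ rawColumn c := hc ▸ List.mem_map_of_mem hx
      obtain ⟨y, hy, e⟩ := List.mem_map.1 this
      have e₂ : y.2 = x.2 := congrArg Prod.snd e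
      rw [← e₂]
      exact c.2.pos y hy
    · have h₁ : (rawColumn c).IsChain fun x y : Lower b lam 𝓘 × ℚ =>
          ∃ σ σ' : Cosets b (wt lam c.1), x.1 = ⟨c.1, σ⟩ ∧ y.1 = ⟨c.1, σ'⟩ ∧ σ' < σ ∧
            x.2 < y.2 ∧ HasChain x.2 σ σ' := by
        rw [rawColumn, List.isChain_map]
        exact c.2.chain.imp fun x y h => ⟨x.1, y.1, rfl, rfl, h⟩
      rw [hc, List.isChain_map] at h₁
      refine h₁.imp ?_
      rintro x y ⟨σ, σ', hx, hy, hlt, ht, hch⟩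
      obtain ⟨q, hq, hpath⟩ := DCP.exists_of_hasChain hch (p := x.1) hx
      obtain rfl : q = y.1 := DCP.rho_injective (hq.trans hy.symm)
      have hxI : x.1.idx = c.1 := congrArg Sigma.fst hx
      have hyI : y.1.idx = c.1 := congrArg Sigma.fst hy
      refine ⟨?_, ht, hpath⟩
      rw [DCP.lt_iff_of_idx hxI hyI]
      change x.1.rho = _ at hx
      change y.1.rho = _ at hy
      rw [DCP.rho_eq hxI] at hx
      rw [DCP.rho_eq hyI] at hy
      rw [eq_of_heq (Sigma.mk.inj hx).2, eq_of_heq (Sigma.mk.inj hy).2]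
      exact hlt
    · have h₁ := c.2.last
      have h₂ : (rawColumn c).getLast?.map Prod.snd = c.2.steps.getLast?.map Prod.snd := by
        rw [rawColumn, List.getLast?_map, Option.map_map]; rfl
      rw [← h₁, ← h₂, hc, List.getLast?_map, Option.map_map]
      rfl
  · have e : (rawColumns T).flatten.map Prod.fst = (A.flatten.map Prod.fst).map DCP.rho := by
      rw [← hA, ← List.map_flatten, List.map_map, List.map_map]; rfl
    rw [e, List.pairwise_map] at hrel
    exact hrel.imp fun h => DCP.le_iff.2 (Relation.TransGen.single h)

/-- All times before the last lie strictly between `0` and `1`, whereas a covering relation that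
changes the index has bond `1` and needs an integral time. -/
theorem IsColumn.exists_idx {l : List (DCP hlam hτ × ℚ)} (hl : IsColumn DCP.Adm l) :
    ∃ I : 𝓘, ∀ x ∈ l, x.1.idx = I := by
  have hch : l.IsChain fun x y : DCP hlam hτ × ℚ => y.1.idx = x.1.idx := by
    refine hl.chain.imp_of_mem_imp ?_
    rintro x y hx hy ⟨-, hlt, hpath⟩
    have h0 := hl.pos x hx
    have h1 : x.2 < 1 :=
      hlt.trans_le (le_of_getLast? (hl.pairwise.imp fun h => h.2) hl.last hy)
    have hnot : ¬ ∃ k : ℤ, x.2 = k := by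
      rintro ⟨k, hk⟩
      rw [hk] at h0 h1
      have h0' : 0 < k := by exact_mod_cast h0
      have h1' : k < 1 := by exact_mod_cast h1
      omega
    clear hlt
    generalize x.1 = p at hpath
    generalize y.1 = q at hpath
    induction hpath with
    | refl => rfl
    | tail _ h ih =>
      by_contra hne
      exact hnot (h.2.integral fun e => hne (e ▸ ih))
  have : Trans (fun x y : DCP hlam hτ × ℚ => y.1.idx = x.1.idx)
    (fun x y : DCP hlam hτ × ℚ => y.1.idx = x.1.idx)
    (fun x y : DCP hlam hτ × ℚ => y.1.idx = x.1.idx) := ⟨fun h h' => h'.trans h⟩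
  rcases l with _ | ⟨x, l⟩
  · exact absurd rfl hl.ne_nil
  have := hch.pairwise
  rw [List.pairwise_cons] at this
  refine ⟨x.1.idx, fun y hy => ?_⟩
  rcases List.mem_cons.1 hy with rfl | hy
  exacts [rfl, this.1 y hy]

theorem IsColumn.exists_lsPath {l : List (DCP hlam hτ × ℚ)} (hl : IsColumn DCP.Adm l) :
    ∃ c : Σ I : 𝓘, LSPath b (wt lam I), rawColumn c = l.map (Prod.map DCP.rho id) := by
  obtain ⟨I, hI⟩ := hl.exists_idx
  refine ⟨⟨I, ⟨l.map fun x => (proj (wt lam I) x.1.coset, x.2), ?_, ?_, ?_⟩⟩, ?_⟩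
  · intro y hy
    obtain ⟨x, hx, rfl⟩ := List.mem_map.1 hy
    exact hl.pos x hx
  · rw [List.isChain_map]
    refine hl.chain.imp_of_mem_imp fun x y hx hy h => ?_
    exact ⟨(DCP.lt_iff_of_idx (hI x hx) (hI y hy)).1 h.1, h.2.1,
      DCP.hasChain_of_reflTransGen (hI x hx) (hI y hy) h.2.2⟩
  · rw [← hl.last, List.getLast?_map, Option.map_map]; rfl
  · rw [rawColumn, List.map_map]
    refine List.map_congr_left fun x hx => ?_
    exact Prod.ext (DCP.rho_eq (hI x hx)).symm rfl

/-- Every abstract tableau in the defining chain poset comes from a `τ`-standard tableau. -/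
theorem IsColumns.exists_tableau {A : List (List (DCP hlam hτ × ℚ))}
    (hA : IsColumns DCP.Adm A) :
    ∃ T : Columns b lam 𝓘, T.IsChain (fun c c' => c'.1 ≤ c.1) ∧
      T.tableau.IsStandard (proj _ τ) ∧
      rawColumns T = A.map (List.map (Prod.map DCP.rho id)) := by
  have hex : A.map (List.map (Prod.map DCP.rho id)) ∈
      Set.range (List.map (rawColumn (b := b) (lam := lam) (𝓘 := 𝓘))) := by
    rw [Set.range_list_map]
    intro l' hl'
    obtain ⟨l, hl, rfl⟩ := List.mem_map.1 hl'
    exact (hA.column l hl).exists_lsPath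
  obtain ⟨T, hT⟩ := hex
  change rawColumns T = _ at hT
  have e : (rawColumns T).flatten.map Prod.fst = (A.flatten.map Prod.fst).map DCP.rho := by
    rw [hT, ← List.map_flatten, List.map_map, List.map_map]; rfl
  have hst := stabilizer_total_le_weight hlam T
  -- The defining sequence consists of the lifts given by the defining chain poset, projected to
  -- `W/W_μ`.
  refine ⟨T, ?_, ⟨(A.flatten.map Prod.fst).map fun p => proj _ p.coset, ?_, ?_, ?_⟩, hT⟩
  · have h₁ : ((rawColumns T).flatten.map Prod.fst).Pairwise fun x y => y.1 ≤ x.1 := by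
      rw [e, List.pairwise_map]
      exact hA.sorted.imp fun h => DCP.idx_mono h
    rw [List.pairwise_map, List.pairwise_flatten] at h₁
    have h₂ := h₁.2
    rw [rawColumns, List.pairwise_map] at h₂
    refine (h₂.imp fun {c c'} h => ?_).isChain
    obtain ⟨x, hx, ex⟩ := exists_mem_rawColumn c
    obtain ⟨y, hy, ey⟩ := exists_mem_rawColumn c'
    rw [← ex, ← ey]
    exact h x hx y hy
  · refine List.Pairwise.isChain ?_
    rw [List.pairwise_map]
    exact hA.sorted.imp fun h => proj_mono hst (DCP.coset_mono h)
  · intro σ hσ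
    obtain ⟨p, -, rfl⟩ := List.mem_map.1 hσ
    exact proj_mono hst p.coset_le
  · rw [entries_eq, e, List.forall₂_map_left_iff, List.forall₂_map_right_iff,
      List.forall₂_map_right_iff, List.forall₂_same]
    intro p hp
    have hp' : p.rho ∈ (rawColumns T).flatten.map Prod.fst := e ▸ List.mem_map_of_mem hp
    exact proj_proj hst (stabilizer_weight_le_of_mem hlam hp') p.coset

theorem mapDomain_columnsSum (A : List (List (DCP hlam hτ × ℚ))) :
    (columnsSum A).mapDomain DCP.rho =
      ((A.map (List.map (Prod.map DCP.rho id))).map (increments 0)).sum := by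
  induction A with
  | nil => exact Finsupp.mapDomain_zero
  | cons l A ih =>
    rw [columnsSum_cons, Finsupp.mapDomain_add, ih, increments_mapDomain]
    simp

/-- The degree of a formal sum of cosets. -/
noncomputable def lowerDegree : (Lower b lam 𝓘 →₀ ℚ) →+ (Fin m → ℚ) :=
  Finsupp.liftAddHom fun x => (LinearMap.toSpanSingleton ℚ (Fin m → ℚ)
    fun i => (degVec x.1 i : ℚ)).toAddMonoidHom

theorem lowerDegree_increments (c : ℚ) {I : 𝓘} {l : List (Lower b lam 𝓘 × ℚ)}
    (hI : ∀ x ∈ l, x.1.1 = I) :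
    lowerDegree (increments c l) =
      massOn Set.univ (increments c l) • fun i => (degVec I i : ℚ) := by
  induction l generalizing c with
  | nil => simp [increments_nil]
  | cons x l ih =>
    rw [increments_cons, map_add, map_add, add_smul, ih _ fun y hy => hI y (by simp [hy]),
      massOn_single, if_pos (Set.mem_univ _), lowerDegree, Finsupp.liftAddHom_apply_single,
      hI x (by simp)]
    rfl

theorem lowerDegree_theta (T : Columns b lam 𝓘) :
    lowerDegree (theta T) = fun i => (T.degree i : ℚ) := by
  induction T with
  | nil => ext i; simp [theta, Columns.degree]
  | cons c T ih =>
    have e₁ : theta (c :: T) = increments 0 (rawColumn c) + theta T := by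
      rw [theta_eq, theta_eq]; simp [rawColumns]
    have e₂ : Columns.degree (c :: T) = degVec c.1 + Columns.degree T := by
      simp [Columns.degree]
    obtain ⟨x, hx, hx1⟩ : ∃ x ∈ c.2.steps.getLast?, x.2 = 1 := by simpa using c.2.last
    have hx' : Prod.map (Sigma.mk c.1) id x ∈ (rawColumn c).getLast? := by
      rw [rawColumn, List.getLast?_map]; exact Option.mem_map_of_mem _ hx
    rw [e₁, e₂, map_add, ih, lowerDegree_increments 0 fun y hy => fst_of_mem_rawColumn hy,
      massOn_univ_increments 0 _ hx']
    ext i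
    simp [hx1]

theorem lowerDegree_mapDomain (a : dcp 𝓘 τ →₀ ℚ) :
    lowerDegree (a.mapDomain rho) = fanDegree a := by
  rw [lowerDegree, Finsupp.liftAddHom_apply, Finsupp.sum_mapDomain_index_addMonoidHom]
  rfl

/-- A formal sum of elements of the defining chain poset, without the order. -/
def DCP.forget (a : DCP hlam hτ →₀ ℚ) : dcp 𝓘 τ →₀ ℚ := a

open scoped Classical in
theorem DCP.massOn_Ici (a : DCP hlam hτ →₀ ℚ) (p : DCP hlam hτ) :
    massOn (Set.Ici p) a = ∑ z ∈ (DCP.forget a).support with dcpGE z p.val, DCP.forget a z := by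
  rw [massOn_eq_sum]
  rfl

theorem DCP.isConsecutive_iff {C : Set (DCP hlam hτ)} (hC : IsMaxChain (· ≤ ·) C)
    {p q : DCP hlam hτ} :
    IsConsecutive (τ := τ) C p.val q.val ↔ p ∈ C ∧ q ∈ C ∧ q ⋖ p := by
  rw [← isConsecutive_iff_covBy hC]
  rfl

theorem DCP.mem_lsFan_iff {a : DCP hlam hτ →₀ ℚ} :
    DCP.forget a ∈ lsFan 𝓘 τ ↔ a ∈ absFan DCP.Adm := by
  constructor
  · rintro ⟨C, hC, hsupp, ha, hk, hadm⟩
    -- `dcpGE` is the reversed order, and being a maximal chain is insensitive to reversal.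
    have hC' : IsMaxChain (α := DCP hlam hτ) (· ≤ ·) C := hC.symm
    refine ⟨C, hC', hsupp, ha, ?_, fun p hp q hq hcov => ?_⟩
    · rw [massOn_univ]; exact hk
    · rw [DCP.massOn_Ici]
      exact hadm _ _ ((DCP.isConsecutive_iff hC').2 ⟨hp, hq, hcov⟩)
  · rintro ⟨C, hC, hsupp, ha, hk, hadm⟩
    refine ⟨C, hC.symm, hsupp, ha, ?_, fun p q h => ?_⟩
    · rw [massOn_univ] at hk; exact hk
    · obtain ⟨hp, hq, hcov⟩ := (DCP.isConsecutive_iff hC (p := p) (q := q)).1 h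
      have := hadm p hp q hq hcov
      rw [DCP.massOn_Ici a p] at this
      exact this

end Tableaux

end LSFan

/-! ### The bijection. -/

theorem mainTheorem3 {ι M N : Type*} [Finite ι] [AddCommGroup M] [Module ℚ M]
    [AddCommGroup N] [Module ℚ N] (P : RootPairing ι ℚ M N)
    [P.IsRootSystem] [P.IsCrystallographic] [P.IsReduced] [P.IsIrreducible] (b : P.Base)
    {m : ℕ} (lam : Fin m → M) (hlam : ∀ i, LSFan.IsDominantWeight b (lam i))
    (τ : LSFan.Cosets b (∑ i, lam i))
    (𝓘 : Finset (Finset (Fin m))) (h𝓘 : LSFan.IsIndexPoset 𝓘)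
    (hτ : LSFan.IsTauStandard 𝓘 τ) (d : Fin m → ℕ) :
    ∃ Θ : LSFan.stdTableaux 𝓘 τ d → LSFan.lsFanDeg 𝓘 τ d,
      (∀ T, (Θ T).1.mapDomain LSFan.rho = LSFan.theta T.1) ∧ Function.Bijective Θ := by
  open LSFan in
  have hadm_int : ∀ p q : DCP hlam hτ, q ⋖ p → ∀ k : ℤ, DCP.Adm k p q := fun _ _ h k =>
    DCP.adm_int h k
  have hshift : ∀ (t : ℚ) (p q : DCP hlam hτ), q ⋖ p → DCP.Adm t p q →
      ∀ k : ℤ, DCP.Adm (t + k) p q := fun _ _ _ _ h k => h.add_int k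
  have htheta : ∀ {T : Columns b lam 𝓘} {A : List (List (DCP hlam hτ × ℚ))},
      A.map (List.map (Prod.map DCP.rho id)) = rawColumns T →
      (DCP.forget (columnsSum A)).mapDomain rho = theta T := by
    intro T A h
    rw [theta_eq, ← h]
    exact mapDomain_columnsSum A
  have hdeg : ∀ {T : Columns b lam 𝓘} {a : dcp 𝓘 τ →₀ ℚ}, a.mapDomain rho = theta T →
      fanDegree a = fun i => (T.degree i : ℚ) := by
    intro T a h
    rw [← lowerDegree_mapDomain, h, lowerDegree_theta]
  choose A hA hAT using fun T : stdTableaux 𝓘 τ d =>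
    exists_isColumns_of_isStandard (hlam := hlam) (hτ := hτ) T.2.1 T.2.2.1
  refine ⟨fun T => ⟨DCP.forget (columnsSum (A T)),
    DCP.mem_lsFan_iff.2 (columnsSum_mem_absFan hadm_int hshift (hA T)), ?_⟩,
    fun T => htheta (hAT T), ?_, ?_⟩
  · rw [hdeg (htheta (hAT T)), T.2.2.2]
  · intro T T' h
    have h' : columnsSum (A T) = columnsSum (A T') := congrArg Subtype.val h
    have h'' := columnsSum_injOn (hA T) (hA T') h'
    exact Subtype.ext (rawColumns_injective (by rw [← hAT, ← hAT, h'']))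
  · rintro ⟨a, ha, had⟩
    obtain ⟨B, hB, rfl⟩ := exists_columns_of_mem_absFan hadm_int hshift
      ((DCP.mem_lsFan_iff (hlam := hlam) (hτ := hτ) (a := a)).1 ha)
    obtain ⟨T, hT₁, hT₂, hT₃⟩ := hB.exists_tableau
    -- The degree depends only on the formal sum, since each column has total weight `1`.
    have hTd : T.degree = d := by
      funext i
      have := congrFun ((hdeg (htheta hT₃.symm)).symm.trans had) i
      exact_mod_cast this
    refine ⟨⟨T, hT₁, hT₂, hTd⟩, Subtype.ext ?_⟩
    refine Finsupp.mapDomain_injective (DCP.rho_injective (hlam := hlam) (hτ := hτ)) ?_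
    exact (htheta (hAT _)).trans (htheta hT₃.symm).symm
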